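/- For a red list $R=(R(1),\dots,R(N))$ and a blue list $B=(B(1),\dots,B(N))$ of real numbers, with $N\ge 1$, let $K^*$ be the number of domination pairs, i.e. of pairs $(i,j)$ with $i<j$ and $B(j)<R(i)$ (the blue point $(j,B(j))$ has a larger $x$-coordinate and a smaller $y$-coordinate than the red point $(i,R(i))$). Consider the randomized RAM model: a fixed program operates at unit cost on registers and random-access memory cells holding words of $O(\log N)$ bits (arithmetic and comparison of words, indirect reads and writes, drawing a uniformly random element of $\{0,\dots,m-1\}$ for a given word $m$), and the real input numbers are accessed only by unit-cost comparisons of two of them. Theorem (red-blue approximate dominance counting). For every constant $c>0$ there is a RAM program which, for every $N\ge 1$ and all real lists $R$ and $B$ of length $N$, always halts within $O(N)$ steps (the constant depends only on $c$) and, with probability at least $1-1/N^c$ over its random choices, outputs a value in the range $$\left[\left(1-\frac{\log N}{N^{1/4}}\right)K^*,\ \left(1+\frac{\log N}{N^{1/4}}\right)K^*\right].$$ Here $\log$ is the natural logarithm. The program does not depend on $N$, and it works for every word size of at least $a\log_2 N + a$ bits, where the constant $a$ depends only on $c$. -/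

import Mathlib

namespace RedBlue

noncomputable section

/-! ### The counting problem -/

/-- The set of domination pairs of a red list `R` and a blue list `B` of the same length. The red
point `(i, R i)` is dominated by the blue point `(j, B j)` when the blue point has the larger
`x`-coordinate and the smaller `y`-coordinate. -/
def dominationPairs {N : ℕ} (R B : Fin N → ℝ) : Set (Fin N × Fin N) :=
  {p | p.1 < p.2 ∧ B p.2 < R p.1}

/-- The number `K*` of domination pairs. -/
def dominationCount {N : ℕ} (R B : Fin N → ℝ) : ℕ :=
  (dominationPairs R B).ncard

/-! ### A randomized word RAM

Programs are structured (sequencing, branching and loops in place of jumps). The machine has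
registers and a random-access memory, both indexed by natural numbers and holding `w`-bit words,
and a read-only list of real numbers which can be accessed only by comparing two of its entries.
Every elementary instruction, every test, and every unfolding of a sequence costs one step. -/

/-- An operand: the content of a register, or a constant. -/
inductive Operand where
  | reg (x : ℕ)
  | lit (n : ℕ)

/-- The arithmetic and comparison operations on words. -/
inductive BinOp where
  | add | sub | mul | div | mod | lt | eq

/-- The elementary instructions. The first register named is the target. -/
inductive Instr where
  /-- `x := a ⋆ b`. -/
  | op (x : ℕ) (f : BinOp) (a b : Operand)
  /-- `x := mem[a]`. -/
  | load (x : ℕ) (a : Operand)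
  /-- `mem[a] := b`. -/
  | store (a b : Operand)
  /-- `x := 1` if input number `a` is smaller than input number `b`, and `x := 0` otherwise. -/
  | compare (x : ℕ) (a b : Operand)
  /-- `x :=` a uniformly random element of `{0, …, a - 1}`. -/
  | rand (x : ℕ) (a : Operand)

/-- Programs. A test on an operand succeeds when its value is nonzero. -/
inductive Prog where
  | skip
  | instr (i : Instr)
  | seq (p q : Prog)
  | branch (a : Operand) (p q : Prog)
  | loop (a : Operand) (p : Prog)

/-- The contents of the registers and of the memory. -/
@[ext]
structure State where
  reg : ℕ → ℕ
  mem : ℕ → ℕ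

/-- The value of an operand, as a `w`-bit word. -/
def Operand.eval (w : ℕ) (s : State) : Operand → ℕ
  | .reg x => s.reg x
  | .lit n => n % 2 ^ w

/-- The value of an operation, before truncation to a word: subtraction is truncated at `0`,
division rounds down, division by `0` gives `0`, and comparisons give `1` or `0`. -/
def BinOp.eval : BinOp → ℕ → ℕ → ℕ
  | .add, a, b => a + b
  | .sub, a, b => a - b
  | .mul, a, b => a * b
  | .div, a, b => a / b
  | .mod, a, b => a % b
  | .lt, a, b => if a < b then 1 else 0
  | .eq, a, b => if a = b then 1 else 0

/-- Write the value `v`, truncated to `w` bits, to register `x`. -/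
def State.setReg (w : ℕ) (s : State) (x v : ℕ) : State :=
  { s with reg := Function.update s.reg x (v % 2 ^ w) }

/-- Write the value `v`, truncated to `w` bits, to the memory cell with address `a`. -/
def State.setMem (w : ℕ) (s : State) (a v : ℕ) : State :=
  { s with mem := Function.update s.mem a (v % 2 ^ w) }

open Classical in
/-- The outcome of comparing the input numbers with positions `a` and `b`; it is `0` if one of
the positions is outside the input. -/
def compareInput (input : List ℝ) (a b : ℕ) : ℕ :=
  if ∃ u ∈ input[a]?, ∃ v ∈ input[b]?, u < v then 1 else 0

/-- The uniform distribution on `{0, …, m - 1}`; for `m = 0` the value is `0`. -/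
def uniformBelow : ℕ → PMF ℕ
  | 0 => PMF.pure 0
  | m + 1 => PMF.uniformOfFinset (Finset.range (m + 1)) Finset.nonempty_range_add_one

/-- The effect of an elementary instruction. -/
def Instr.exec (w : ℕ) (input : List ℝ) (s : State) : Instr → PMF State
  | .op x f a b => PMF.pure (s.setReg w x (f.eval (a.eval w s) (b.eval w s)))
  | .load x a => PMF.pure (s.setReg w x (s.mem (a.eval w s)))
  | .store a b => PMF.pure (s.setMem w (a.eval w s) (b.eval w s))
  | .compare x a b =>
      PMF.pure (s.setReg w x (compareInput input (a.eval w s) (b.eval w s)))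
  | .rand x a => (uniformBelow (a.eval w s)).map fun v => s.setReg w x v

/-- A configuration: the list of program parts still to be executed (it plays the role of the
program counter), and the current state. -/
@[ext]
structure Config where
  todo : List Prog
  state : State

/-- The machine has halted when nothing is left to be executed. -/
def Config.Halted (k : Config) : Prop := k.todo = []

/-- One step of the machine with word size `w` on the given input. -/
def step (w : ℕ) (input : List ℝ) : Config → PMF Config
  | ⟨[], s⟩ => PMF.pure ⟨[], s⟩
  | ⟨.skip :: k, s⟩ => PMF.pure ⟨k, s⟩
  | ⟨.instr i :: k, s⟩ => (i.exec w input s).map fun s' => ⟨k, s'⟩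
  | ⟨.seq p q :: k, s⟩ => PMF.pure ⟨p :: q :: k, s⟩
  | ⟨.branch a p q :: k, s⟩ =>
      PMF.pure (if a.eval w s = 0 then ⟨q :: k, s⟩ else ⟨p :: k, s⟩)
  | ⟨.loop a p :: k, s⟩ =>
      PMF.pure (if a.eval w s = 0 then ⟨k, s⟩ else ⟨p :: .loop a p :: k, s⟩)

/-- The distribution of the configuration after a given number of steps (a halted machine stays
where it is). Different random instructions use independent random numbers. -/
def run (w : ℕ) (input : List ℝ) : ℕ → Config → PMF Config
  | 0, k => PMF.pure k
  | t + 1, k => (step w input k).bind (run w input t)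

/-- The initial configuration: register `0` holds the list length `N`, and all other registers
and all memory cells hold `0`. -/
def initial (w N : ℕ) (P : Prog) : Config where
  todo := [P]
  state := { reg := fun x => if x = 0 then N % 2 ^ w else 0, mem := fun _ => 0 }

/-- The distribution of the configuration reached by program `P` after `t` steps on the lists `R`
and `B`, with word size `w`. The input numbers with positions `0, …, N - 1` are the entries of
`R`, and those with positions `N, …, 2 * N - 1` are the entries of `B`. -/
def runOn (w : ℕ) (P : Prog) {N : ℕ} (R B : Fin N → ℝ) (t : ℕ) : PMF Config :=
  run w (List.ofFn R ++ List.ofFn B) t (initial w N P)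

/-- The output of the machine: the content of register `0`. -/
def Config.output (k : Config) : ℕ := k.state.reg 0

end

end RedBlue

namespace RedBlue

open Finset
open scoped ENNReal

noncomputable section

/-! ### Quantitative program logic: running time and expected cost -/

section

/-! ### Expectations of a run -/

/-! Let `K` be the number of pairs. Suppose that intervals of candidates are known which together
contain every pair exactly once, with `tot` candidates in all. Cut the intervals into chunks of
length `W`, about `tot / N + 1`, test one random element of each chunk, and output `W` times the
number of successes. This takes `O(N)` tests, and an exponential supermartingale (`isPotential_exp`,
`exists_isPotential`) bounds the probability of a relative error above `ε` by `2 * exp (-ε ^ 2 * K /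
(4 * W))`. For `ε = log N / N ^ (1 / 4)` this is a large negative power of `N` as soon as `K / W ≥ N
/ (34 * ℓ₀)`, where `ℓ₀` has order `√N * log N / E` for a large constant `E`. Hence the task is to
find, in linear time, candidates with `tot = O(ℓ₀ * K)`.

First drop all points which occur in no pair, so that the number `n` of remaining points of either
colour is at most `K`. Sweep the red points from left to right and keep at most `4 * ℓ` of them
active, where `ℓ` starts at `ℓ₀`. When the active set is full, take a random pivot of medium height
and estimate by sampling how many of the blue points still to come are below it. If there are few,
at most `2 * ℓ`, make a level: the active red points not above the pivot are finished, and their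
later partners are all among these few blue points. Red points met later which are not above the
current threshold are finished at once. If there are many, at least `ℓ / 2`, then at least `ℓ`
active red points have that many partners each, so `ℓ ^ 2 ≤ 2 * K`; the scale `ℓ` is doubled, and
the new one satisfies `ℓ ^ 2 ≤ 8 * K`.

A red point gets as direct candidates the blue points passed while it was active, at most `4 * ℓ *
n` in total. The remaining pairs are found through the levels. Both thresholds and starting
positions of the levels increase, so the levels which concern one blue point form an interval, and
so do the red points finished in these levels (`Family.Good.covers`); this gives at most `2 * ℓ * n`
further candidates. Altogether `tot ≤ 6 * ℓ * n`. Either `ℓ = ℓ₀`, or `ℓ ^ 2 ≤ 8 * K` together with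
`n ^ 2 ≤ K * N ≤ K * ℓ₀ ^ 2`; in both cases `tot ≤ 17 * K * ℓ₀` (`mul_le_of_scale`).

Time is linear because an attempt costs `O(ℓ)` and leaves at most `3 * ℓ` active points, so that `ℓ`
pushes pay for it. The pivot is the median of `2 ^ k` samples, of order `N ^ (1 / 4)`, found by
quadratic search within `O(ℓ₀)` steps. Pivot and test fail with small probability
(`choosePivot_triple`, `testLevel_triple`), and a union bound over the sweep gives the total error.
Time bounds must hold for all random outcomes; therefore the invariants are split into sure ones
(`Sweep.Safe`) and likely ones (`Sweep.Good`). Lists with `N < N₀` are counted exactly.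

The link to the machine is a calculus of expectation triples: failure to halt costs `∞`, so a finite
bound on the expected cost proves both sure termination in time and a bound for the error
probability (`Triple.run_spec`). -/

/-- The expected value of `Φ` in the final state, where a machine which has not halted counts as
`∞`, after `t` steps. -/
def expect (w : ℕ) (input : List ℝ) (Φ : State → ℝ≥0∞) : ℕ → Config → ℝ≥0∞
  | 0, ⟨[], s⟩ => Φ s
  | 0, ⟨_ :: _, _⟩ => ⊤
  | t + 1, k => ∑' k', step w input k k' * expect w input Φ t k'

theorem tsum_pure_mul {α : Type*} (a : α) (f : α → ℝ≥0∞) :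
    ∑' b, (PMF.pure a) b * f b = f a := by
  rw [tsum_eq_single a]
  · simp [PMF.pure_apply]
  · intro b hb
    simp [PMF.pure_apply, hb]

theorem tsum_bind_mul {α β : Type*} (p : PMF α) (q : α → PMF β) (f : β → ℝ≥0∞) :
    ∑' b, (p.bind q) b * f b = ∑' a, p a * ∑' b, q a b * f b := by
  simp only [PMF.bind_apply, ← ENNReal.tsum_mul_right, ← ENNReal.tsum_mul_left]
  rw [ENNReal.tsum_comm]
  simp only [mul_assoc]

theorem tsum_map_mul {α β : Type*} (p : PMF α) (g : α → β) (f : β → ℝ≥0∞) :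
    ∑' b, (p.map g) b * f b = ∑' a, p a * f (g a) := by
  rw [PMF.map, tsum_bind_mul]
  simp only [Function.comp, tsum_pure_mul]

theorem tsum_uniformBelow_mul {m : ℕ} (hm : 0 < m) (f : ℕ → ℝ≥0∞) :
    ∑' v, uniformBelow m v * f v = (∑ v ∈ range m, f v) / m := by
  obtain ⟨n, rfl⟩ := Nat.exists_eq_succ_of_ne_zero hm.ne'
  rw [uniformBelow, tsum_eq_sum (s := range (n + 1)), div_eq_mul_inv, Finset.sum_mul]
  · refine Finset.sum_congr rfl fun v hv => ?_
    rw [PMF.uniformOfFinset_apply_of_mem _ hv, mul_comm]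
    simp
  · intro v hv
    rw [PMF.uniformOfFinset_apply_of_notMem _ hv, zero_mul]

variable {w : ℕ} {input : List ℝ}

theorem expect_run (Φ : State → ℝ≥0∞) (t : ℕ) (k : Config) :
    ∑' k', run w input t k k' * expect w input Φ 0 k' = expect w input Φ t k := by
  induction t generalizing k with
  | zero => simp only [run, tsum_pure_mul]
  | succ t ih => simp only [run, tsum_bind_mul, ih, expect]

/-- A halted machine stays where it is, and one which has not halted already counts as `⊤`; so more
time can only lower the value. This allows all time bounds to be rounded up. -/
theorem expect_succ_le (Φ : State → ℝ≥0∞) (t : ℕ) (k : Config) :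
    expect w input Φ (t + 1) k ≤ expect w input Φ t k := by
  induction t generalizing k with
  | zero =>
    obtain ⟨_ | ⟨p, l⟩, s⟩ := k
    · simp [expect, step]
    · simp [expect]
  | succ t ih =>
    rw [expect, expect]
    exact ENNReal.tsum_le_tsum fun k' => mul_le_mul_right (ih k') _

theorem expect_anti (Φ : State → ℝ≥0∞) (k : Config) {t t' : ℕ} (h : t ≤ t') :
    expect w input Φ t' k ≤ expect w input Φ t k :=
  antitone_nat_of_succ_le (f := fun t => expect w input Φ t k) (fun t => expect_succ_le Φ t k) h

/-! ### Expectation triples -/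

variable (w input) in
/-- Started in state `s`, the program `p` halts within `n` steps, and the expected value of `F` in
its final state is at most `c`. This is expressed by the runs of `p` followed by an arbitrary
continuation. -/
def Triple (p : Prog) (n : ℕ) (s : State) (c : ℝ≥0∞) (F : State → ℝ≥0∞) : Prop :=
  ∀ (k : List Prog) (t : ℕ) (Φ : State → ℝ≥0∞),
    (∀ s', expect w input Φ t ⟨k, s'⟩ ≤ F s') → expect w input Φ (t + n) ⟨p :: k, s⟩ ≤ c

variable (w input) in
/-- The least bound `c` for which `Triple` holds. -/
def bestBound (p : Prog) (n : ℕ) (F : State → ℝ≥0∞) (s : State) : ℝ≥0∞ :=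
  ⨅ (c : ℝ≥0∞) (_ : Triple w input p n s c F), c

theorem Triple.bestBound_le {p : Prog} {n : ℕ} {s : State} {c : ℝ≥0∞} {F : State → ℝ≥0∞}
    (h : Triple w input p n s c F) : bestBound w input p n F s ≤ c :=
  iInf₂_le c h

theorem Triple.bestBound (p : Prog) (n : ℕ) (s : State) (F : State → ℝ≥0∞) :
    Triple w input p n s (bestBound w input p n F s) F :=
  fun k t Φ h => le_iInf₂ fun _ hc => hc k t Φ h

theorem Triple.mono {p : Prog} {n n' : ℕ} {s : State} {c c' : ℝ≥0∞} {F F' : State → ℝ≥0∞}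
    (h : Triple w input p n s c F) (hn : n ≤ n') (hc : c ≤ c') (hF : ∀ s, F' s ≤ F s) :
    Triple w input p n' s c' F' := fun k t Φ hk =>
  (expect_anti Φ _ (by omega)).trans ((h k t Φ fun s' => (hk s').trans (hF s')).trans hc)

theorem Triple.time_mono {p : Prog} {n n' : ℕ} {s : State} {c : ℝ≥0∞} {F : State → ℝ≥0∞}
    (h : Triple w input p n s c F) (hn : n ≤ n') : Triple w input p n' s c F :=
  h.mono hn le_rfl fun _ => le_rfl

theorem expect_of_step_pure {Φ : State → ℝ≥0∞} {t : ℕ} {k k' : Config}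
    (h : step w input k = PMF.pure k') :
    expect w input Φ (t + 1) k = expect w input Φ t k' := by
  rw [expect, h, tsum_pure_mul]

theorem Triple.skip {s : State} {c : ℝ≥0∞} {F : State → ℝ≥0∞} (h : F s ≤ c) :
    Triple w input .skip 1 s c F := fun k t Φ hk => by
  rw [expect_of_step_pure (k' := ⟨k, s⟩) rfl]
  exact (hk s).trans h

/-- Since a triple quantifies over continuations, `q :: k` can serve as the continuation of `p`. The
intermediate postcondition is the best bound for `q` as a function of the intermediate state, so
none has to be invented. -/
theorem Triple.seq {p q : Prog} {n m l : ℕ} {s : State} {c : ℝ≥0∞} {F : State → ℝ≥0∞}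
    (h : Triple w input p n s c (RedBlue.bestBound w input q m F)) (hl : n + m + 1 ≤ l) :
    Triple w input (.seq p q) l s c F := by
  refine Triple.time_mono (n := n + m + 1) (fun k t Φ hk => ?_) hl
  rw [← add_assoc, expect_of_step_pure (k' := ⟨p :: q :: k, s⟩) rfl,
    show t + (n + m) = t + m + n by ring]
  exact h (q :: k) (t + m) Φ fun s' => Triple.bestBound q m s' F k t Φ hk

theorem Triple.instr {i : Instr} {s s' : State} {c : ℝ≥0∞} {F : State → ℝ≥0∞}
    (hi : i.exec w input s = PMF.pure s') (h : F s' ≤ c) :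
    Triple w input (.instr i) 1 s c F := fun k t Φ hk => by
  rw [expect_of_step_pure (k' := ⟨k, s'⟩)]
  · exact (hk s').trans h
  · simp only [step, hi, PMF.pure_map]

theorem Triple.branch {a : Operand} {p q : Prog} {n : ℕ} {s : State} {c : ℝ≥0∞}
    {F : State → ℝ≥0∞} (h0 : a.eval w s = 0 → Triple w input q n s c F)
    (h1 : a.eval w s ≠ 0 → Triple w input p n s c F) :
    Triple w input (.branch a p q) (n + 1) s c F := fun k t Φ hk => by
  rw [← add_assoc, expect_of_step_pure (k' := _) rfl]
  split_ifs with h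
  · exact h0 h k t Φ hk
  · exact h1 h k t Φ hk

open Classical in
/-- The rule for loops: `I` is an invariant, `τ` bounds the remaining time, and `G` bounds the
expected final value. -/
theorem Triple.loop {a : Operand} {p : Prog} {F : State → ℝ≥0∞} (I : State → Prop)
    (τ : State → ℕ) (G : State → ℝ≥0∞)
    (hexit : ∀ s, I s → a.eval w s = 0 → F s ≤ G s)
    (hbody : ∀ s, I s → a.eval w s ≠ 0 → ∃ n, n + 1 ≤ τ s ∧ Triple w input p n s (G s)
      (fun s' => if I s' ∧ τ s' + n + 1 ≤ τ s then G s' else ⊤)) :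
    ∀ s, I s → Triple w input (.loop a p) (τ s + 1) s (G s) F := by
  suffices H : ∀ T s, τ s = T → I s → Triple w input (.loop a p) (τ s + 1) s (G s) F from
    fun s => H _ s rfl
  intro T
  induction T using Nat.strong_induction_on with
  | _ T ih =>
  intro s hT hI k t Φ hk
  rw [← add_assoc, expect_of_step_pure (k' := _) rfl]
  split_ifs with h
  · exact (expect_anti Φ _ (Nat.le_add_right t _)).trans ((hk s).trans (hexit s hI h))
  · obtain ⟨n, hn, hb⟩ := hbody s hI h
    obtain ⟨d, hd⟩ := Nat.exists_eq_add_of_le hn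
    have := hb (.loop a p :: k) (t + d + 1) Φ fun s' => ?_
    · rwa [show t + τ s = t + d + 1 + n by omega]
    · dsimp only
      -- Outcomes which violate the invariant or the time budget have value `⊤`. The hypothesis on
      -- the body therefore enforces both surely, whereas `G` is only controlled on average.
      split_ifs with hc
      · exact (expect_anti Φ _ (by omega)).trans (ih (τ s') (by omega) s' rfl hc.1 k t Φ hk)
      · exact le_top

/-! ### Loop-free programs without overflow -/

/-- The value of an operand, without truncation. -/
def Operand.val (s : State) : Operand → ℕ
  | .reg x => s.reg x
  | .lit n => n

/-- A constant has to be smaller than `M`. -/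
def Operand.Fits (M : ℕ) : Operand → Prop
  | .reg _ => True
  | .lit n => n < M

theorem Operand.Fits.eval_eq {M : ℕ} (hM : M ≤ 2 ^ w) {a : Operand} (h : a.Fits M) (s : State) :
    a.eval w s = a.val s := by
  cases a with
  | reg x => rfl
  | lit n => exact Nat.mod_eq_of_lt (lt_of_lt_of_le h hM)

/-- Set a register, without truncation. -/
def State.put (s : State) (x v : ℕ) : State := ⟨Function.update s.reg x v, s.mem⟩

/-- Set a memory cell, without truncation. -/
def State.poke (s : State) (a v : ℕ) : State := ⟨s.reg, Function.update s.mem a v⟩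

theorem State.setReg_eq {M : ℕ} (hM : M ≤ 2 ^ w) {v : ℕ} (h : v < M) (s : State) (x : ℕ) :
    s.setReg w x v = s.put x v := by
  rw [State.setReg, State.put, Nat.mod_eq_of_lt (lt_of_lt_of_le h hM)]

theorem State.setMem_eq {M : ℕ} (hM : M ≤ 2 ^ w) {v : ℕ} (h : v < M) (s : State) (x : ℕ) :
    s.setMem w x v = s.poke x v := by
  rw [State.setMem, State.poke, Nat.mod_eq_of_lt (lt_of_lt_of_le h hM)]

@[simp] theorem State.put_reg (s : State) (x v y : ℕ) :
    (s.put x v).reg y = if y = x then v else s.reg y := Function.update_apply ..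

@[simp] theorem State.put_mem (s : State) (x v : ℕ) : (s.put x v).mem = s.mem := rfl

@[simp] theorem State.poke_reg (s : State) (x v : ℕ) : (s.poke x v).reg = s.reg := rfl

theorem State.poke_mem (s : State) (x v y : ℕ) :
    (s.poke x v).mem y = if y = x then v else s.mem y := Function.update_apply ..

/-- The number of steps of a loop-free program. -/
def Prog.cost : Prog → ℕ
  | .skip => 1
  | .instr _ => 1
  | .seq p q => p.cost + q.cost + 1
  | .branch _ p q => max p.cost q.cost + 1
  | .loop _ _ => 0

/-- The weakest precondition of a deterministic loop-free program whose words stay below `M`;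
`cmp` is the result of comparisons of input numbers. -/
def Prog.wlp (M : ℕ) (cmp : ℕ → ℕ → ℕ) : Prog → (State → Prop) → State → Prop
  | .skip, Q, s => Q s
  | .instr (.op x f a b), Q, s => a.Fits M ∧ b.Fits M ∧ f.eval (a.val s) (b.val s) < M ∧
      Q (s.put x (f.eval (a.val s) (b.val s)))
  | .instr (.load x a), Q, s => a.Fits M ∧ s.mem (a.val s) < M ∧ Q (s.put x (s.mem (a.val s)))
  | .instr (.store a b), Q, s => a.Fits M ∧ b.Fits M ∧ b.val s < M ∧
      Q (s.poke (a.val s) (b.val s))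
  | .instr (.compare x a b), Q, s => a.Fits M ∧ b.Fits M ∧ Q (s.put x (cmp (a.val s) (b.val s)))
  | .instr (.rand _ _), _, _ => False
  | .seq p q, Q, s => p.wlp M cmp (q.wlp M cmp Q) s
  | .branch a p q, Q, s => a.Fits M ∧ (a.val s = 0 → q.wlp M cmp Q s) ∧
      (a.val s ≠ 0 → p.wlp M cmp Q s)
  | .loop _ _, _, _ => False

theorem Prog.wlp_mono {M : ℕ} {cmp : ℕ → ℕ → ℕ} {p : Prog} {Q Q' : State → Prop}
    (h : ∀ s, Q s → Q' s) : ∀ s, p.wlp M cmp Q s → p.wlp M cmp Q' s := by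
  induction p generalizing Q Q' with
  | skip => exact h
  | instr i => cases i <;> simp only [Prog.wlp] <;> grind
  | seq p q ihp ihq => exact ihp (ihq h)
  | branch a p q ihp ihq =>
    exact fun s hs => ⟨hs.1, fun h0 => ihq h s (hs.2.1 h0), fun h1 => ihp h s (hs.2.2 h1)⟩
  | loop a p => simp [Prog.wlp]

/-- Extracts from a postcondition the facts which do not mention the final state, such as positivity
of a measure which is known to decrease. -/
theorem Prog.wlp_nonempty {M : ℕ} {cmp : ℕ → ℕ → ℕ} {p : Prog} {Q : State → Prop} :
    ∀ s, p.wlp M cmp Q s → ∃ s', Q s' := by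
  induction p generalizing Q with
  | skip => exact fun s h => ⟨s, h⟩
  | instr i => cases i <;> simp only [Prog.wlp] <;> grind
  | seq p q ihp ihq =>
    intro s h
    obtain ⟨s', h'⟩ := ihp s h
    exact ihq s' h'
  | branch a p q ihp ihq =>
    intro s h
    by_cases h0 : a.val s = 0
    · exact ihq s (h.2.1 h0)
    · exact ihp s (h.2.2 h0)
  | loop a p => simp [Prog.wlp]

theorem compareInput_lt_two (input : List ℝ) (a b : ℕ) : compareInput input a b < 2 := by
  rw [compareInput]
  split_ifs <;> omega

/-- As long as all words stay below `M ≤ 2 ^ w`, truncation never acts, and the exact semantics of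
`wlp` is that of the machine. -/
theorem Triple.of_wlp {M : ℕ} (hM : M ≤ 2 ^ w) (hM2 : 2 ≤ M) {p : Prog} {s : State}
    {c : ℝ≥0∞} {F : State → ℝ≥0∞}
    (h : p.wlp M (compareInput input) (fun s' => F s' ≤ c) s) :
    Triple w input p p.cost s c F := by
  induction p generalizing s F c with
  | skip => exact .skip h
  | instr i =>
    cases i with
    | op x f a b =>
      obtain ⟨ha, hb, hv, hq⟩ := h
      refine .instr ?_ hq
      rw [Instr.exec, ha.eval_eq hM, hb.eval_eq hM, State.setReg_eq hM hv]
    | load x a =>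
      obtain ⟨ha, hv, hq⟩ := h
      refine .instr ?_ hq
      rw [Instr.exec, ha.eval_eq hM, State.setReg_eq hM hv]
    | store a b =>
      obtain ⟨ha, hb, hv, hq⟩ := h
      refine .instr ?_ hq
      rw [Instr.exec, ha.eval_eq hM, hb.eval_eq hM, State.setMem_eq hM hv]
    | compare x a b =>
      obtain ⟨ha, hb, hq⟩ := h
      refine .instr ?_ hq
      rw [Instr.exec, ha.eval_eq hM, hb.eval_eq hM,
        State.setReg_eq hM ((compareInput_lt_two _ _ _).trans_le hM2)]
    | rand x a => exact h.elim
  | seq p q ihp ihq =>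
    exact .seq (ihp (Prog.wlp_mono (fun s' hs' => (ihq hs').bestBound_le) s h)) le_rfl
  | branch a p q ihp ihq =>
    obtain ⟨ha, h0, h1⟩ := h
    refine .branch (fun h => ?_) (fun h => ?_)
    · rw [ha.eval_eq hM] at h
      exact (ihq (h0 h)).time_mono (le_max_right _ _)
    · rw [ha.eval_eq hM] at h
      exact (ihp (h1 h)).time_mono (le_max_left _ _)
  | loop a p => exact h.elim

theorem Triple.seq_wlp {M : ℕ} (hM : M ≤ 2 ^ w) (hM2 : 2 ≤ M) {p q : Prog} {m l : ℕ} {s : State}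
    {c : ℝ≥0∞} {F : State → ℝ≥0∞} (hl : p.cost + m + 1 ≤ l)
    (h : p.wlp M (compareInput input) (fun s' => Triple w input q m s' c F) s) :
    Triple w input (.seq p q) l s c F :=
  .seq (.of_wlp hM hM2 (Prog.wlp_mono (fun _ hs' => hs'.bestBound_le) s h)) hl

theorem bestBound_le_of_wlp {M : ℕ} (hM : M ≤ 2 ^ w) (hM2 : 2 ≤ M) {p : Prog} {n : ℕ} {s : State}
    {c : ℝ≥0∞} {F : State → ℝ≥0∞} (hn : p.cost ≤ n)
    (h : p.wlp M (compareInput input) (fun s' => F s' ≤ c) s) : bestBound w input p n F s ≤ c :=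
  ((Triple.of_wlp hM hM2 h).time_mono hn).bestBound_le

/-- The bound is on the average over the draw, multiplied out to avoid division in `ℝ≥0∞`. -/
theorem Triple.rand {M : ℕ} (hM : M ≤ 2 ^ w) {x y : ℕ} {s : State} {c : ℝ≥0∞}
    {F : State → ℝ≥0∞} (h0 : 0 < s.reg y) (hy : s.reg y ≤ M)
    (h : ∑ v ∈ range (s.reg y), F (s.put x v) ≤ s.reg y * c) :
    Triple w input (.instr (.rand x (.reg y))) 1 s c F := fun k t Φ hk => by
  rw [expect]
  simp only [step, Instr.exec, Operand.eval, tsum_map_mul, tsum_uniformBelow_mul h0]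
  refine ENNReal.div_le_of_le_mul' (le_trans (sum_le_sum fun v hv => ?_) h)
  rw [State.setReg_eq hM ((mem_range.1 hv).trans_le hy)]
  exact hk _

/-- Loops with a deterministic loop-free body, an invariant `I` and a decreasing measure `μ`. -/
theorem Triple.loop_wlp {M : ℕ} (hM : M ≤ 2 ^ w) (hM2 : 2 ≤ M) {x : ℕ} {p : Prog} {l : ℕ}
    {s : State} {c : ℝ≥0∞} {F : State → ℝ≥0∞} (I : State → Prop) (μ : State → ℕ) (hs : I s)
    (hl : (p.cost + 1) * μ s + 1 ≤ l)
    (hstep : ∀ s, I s → s.reg x ≠ 0 →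
      p.wlp M (compareInput input) (fun s' => I s' ∧ μ s' < μ s) s)
    (hexit : ∀ s, I s → s.reg x = 0 → F s ≤ c) :
    Triple w input (.loop (.reg x) p) l s c F := by
  classical
  refine Triple.time_mono (Triple.loop (a := .reg x) I (fun s => (p.cost + 1) * μ s) (fun _ => c) hexit
    (fun s hI hx => ⟨p.cost, ?_, .of_wlp hM hM2 (Prog.wlp_mono ?_ s (hstep s hI hx))⟩) s hs) hl
  · obtain ⟨s', -, hs'⟩ := Prog.wlp_nonempty s (hstep s hI hx)
    have : (p.cost + 1) * 1 ≤ (p.cost + 1) * μ s := Nat.mul_le_mul_left _ (by omega)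
    omega
  · rintro s' ⟨h1, h2⟩
    have : (p.cost + 1) * (μ s' + 1) ≤ (p.cost + 1) * μ s := Nat.mul_le_mul_left _ h2
    rw [if_pos ⟨h1, by linarith⟩]

/-- A program which halts within `n` steps and ends in a state satisfying `Q` except with
probability `δ`. -/
theorem Triple.run_spec {P : Prog} {n : ℕ} {s : State} {δ : ℝ≥0∞} {Q : State → Prop}
    {F : State → ℝ≥0∞} (h : Triple w input P n s δ F) (hδ : δ ≠ ⊤) (hF : ∀ s, ¬ Q s → 1 ≤ F s) :
    (∀ k ∈ (run w input n ⟨[P], s⟩).support, k.Halted) ∧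
      1 - δ ≤ (run w input n ⟨[P], s⟩).toOuterMeasure {k | Q k.state} := by
  have h1 := h [] 0 F fun s' => le_rfl
  rw [zero_add, ← expect_run] at h1
  set μ := run w input n ⟨[P], s⟩
  constructor
  · rintro ⟨_ | ⟨p, l⟩, s'⟩ hk
    · rfl
    -- An unhalted configuration in the support would contribute a positive multiple of `⊤` to a
    -- finite expectation.
    · have h2 := (ENNReal.le_tsum (⟨p :: l, s'⟩ : Config)).trans h1
      rw [expect, ENNReal.mul_top ((PMF.mem_support_iff _ _).1 hk), top_le_iff] at h2
      exact absurd h2 hδ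
  · rw [tsub_le_iff_right, ← μ.tsum_coe, PMF.toOuterMeasure_apply]
    refine le_trans ?_ (add_le_add_right h1 _)
    rw [← ENNReal.tsum_add]
    -- Termwise Markov inequality: each configuration either satisfies `Q`, or its cost is at least
    -- one.
    refine ENNReal.tsum_le_tsum fun k => ?_
    by_cases hk : Q k.state
    · rw [Set.indicator_of_mem (by exact hk)]
      exact le_self_add
    · refine le_add_left ?_
      refine le_mul_of_one_le_right' ?_
      obtain ⟨_ | ⟨p, l⟩, s'⟩ := k
      · exact hF _ hk
      · exact le_top

end

/-! ### Arrays in a flat memory -/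

section

/-! ### Abbreviations for programs

Sixteen arrays are interleaved in the memory: entry `i` of array `k < 16` has address `16 * i + k`.
Register `60` is used for the computation of addresses. -/

infixr:60 " ⨟ " => Prog.seq

namespace Prog

/-- `x := a`. -/
def set (x : ℕ) (a : Operand) : Prog := .instr (.op x .add a (.lit 0))
/-- `x := a + b`. -/
def add (x : ℕ) (a b : Operand) : Prog := .instr (.op x .add a b)
/-- `x := a - b`. -/
def sub (x : ℕ) (a b : Operand) : Prog := .instr (.op x .sub a b)
/-- `x := a * b`. -/
def mul (x : ℕ) (a b : Operand) : Prog := .instr (.op x .mul a b)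
/-- `x := a / b`. -/
def div (x : ℕ) (a b : Operand) : Prog := .instr (.op x .div a b)
/-- `x := 1` if `a < b`, and `x := 0` otherwise. -/
def lt (x : ℕ) (a b : Operand) : Prog := .instr (.op x .lt a b)
/-- `x := 1` if `a = b`, and `x := 0` otherwise. -/
def eq (x : ℕ) (a b : Operand) : Prog := .instr (.op x .eq a b)
/-- Compare two input numbers. -/
def cmp (x : ℕ) (a b : Operand) : Prog := .instr (.compare x a b)
/-- Load entry `i` of array `k` to register `x`. -/
def ld (x k : ℕ) (i : Operand) : Prog :=
  mul 60 (.lit 16) i ⨟ add 60 (.reg 60) (.lit k) ⨟ .instr (.load x (.reg 60))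
/-- Store `v` in entry `i` of array `k`. -/
def st (k : ℕ) (i v : Operand) : Prog :=
  mul 60 (.lit 16) i ⨟ add 60 (.reg 60) (.lit k) ⨟ .instr (.store (.reg 60) v)

end Prog

/-- Entry `i` of array `k`. -/
def State.arr (s : State) (k i : ℕ) : ℕ := s.mem (16 * i + k)

/-- Change entry `i` of array `k`. -/
def State.sto (s : State) (k i v : ℕ) : State := s.poke (16 * i + k) v

@[simp] theorem State.put_arr (s : State) (x v : ℕ) : (s.put x v).arr = s.arr := rfl

@[simp] theorem State.sto_reg (s : State) (k i v : ℕ) : (s.sto k i v).reg = s.reg := rfl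

@[simp] theorem State.put_put (s : State) (x v v' : ℕ) : (s.put x v).put x v' = s.put x v' := by
  simp [State.put]

/-- Array numbers below `16` are residues, so different entries have different addresses. -/
theorem State.sto_arr {k k' : ℕ} (hk : k < 16) (hk' : k' < 16) (s : State) (i v i' : ℕ) :
    (s.sto k i v).arr k' i' = if k' = k ∧ i' = i then v else s.arr k' i' := by
  rw [State.sto, State.arr, State.poke_mem, State.arr]
  refine if_congr ?_ rfl rfl
  omega

namespace Prog

variable {M : ℕ} {c : ℕ → ℕ → ℕ} {Q : State → Prop} {s : State} {x k : ℕ} {a b i : Operand}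

@[simp] theorem wlp_set : (set x a).wlp M c Q s ↔
    a.Fits M ∧ 0 < M ∧ a.val s < M ∧ Q (s.put x (a.val s)) := Iff.rfl
@[simp] theorem wlp_add : (add x a b).wlp M c Q s ↔
    a.Fits M ∧ b.Fits M ∧ a.val s + b.val s < M ∧ Q (s.put x (a.val s + b.val s)) := Iff.rfl
@[simp] theorem wlp_sub : (sub x a b).wlp M c Q s ↔
    a.Fits M ∧ b.Fits M ∧ a.val s - b.val s < M ∧ Q (s.put x (a.val s - b.val s)) := Iff.rfl
@[simp] theorem wlp_mul : (mul x a b).wlp M c Q s ↔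
    a.Fits M ∧ b.Fits M ∧ a.val s * b.val s < M ∧ Q (s.put x (a.val s * b.val s)) := Iff.rfl
@[simp] theorem wlp_div : (div x a b).wlp M c Q s ↔
    a.Fits M ∧ b.Fits M ∧ a.val s / b.val s < M ∧ Q (s.put x (a.val s / b.val s)) := Iff.rfl
@[simp] theorem wlp_lt : (lt x a b).wlp M c Q s ↔
    a.Fits M ∧ b.Fits M ∧ (if a.val s < b.val s then 1 else 0) < M ∧
      Q (s.put x (if a.val s < b.val s then 1 else 0)) := Iff.rfl
@[simp] theorem wlp_eq : (eq x a b).wlp M c Q s ↔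
    a.Fits M ∧ b.Fits M ∧ (if a.val s = b.val s then 1 else 0) < M ∧
      Q (s.put x (if a.val s = b.val s then 1 else 0)) := Iff.rfl
@[simp] theorem wlp_cmp : (cmp x a b).wlp M c Q s ↔
    a.Fits M ∧ b.Fits M ∧ Q (s.put x (c (a.val s) (b.val s))) := Iff.rfl
@[simp] theorem wlp_skip : skip.wlp M c Q s ↔ Q s := Iff.rfl
@[simp] theorem wlp_seq {p q : Prog} : (p ⨟ q).wlp M c Q s ↔ p.wlp M c (q.wlp M c Q) s := Iff.rfl
@[simp] theorem wlp_branch {p q : Prog} : (branch a p q).wlp M c Q s ↔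
    a.Fits M ∧ (a.val s = 0 → q.wlp M c Q s) ∧ (a.val s ≠ 0 → p.wlp M c Q s) := Iff.rfl

@[simp] theorem _root_.RedBlue.Operand.val_reg : (Operand.reg x).val s = s.reg x := rfl
@[simp] theorem _root_.RedBlue.Operand.val_lit : (Operand.lit x).val s = x := rfl
@[simp] theorem _root_.RedBlue.Operand.fits_reg : (Operand.reg x).Fits M ↔ True := Iff.rfl
@[simp] theorem _root_.RedBlue.Operand.fits_lit : (Operand.lit x).Fits M ↔ x < M := Iff.rfl

theorem val_put_of_ne (h : a ≠ .reg x) (v : ℕ) : a.val (s.put x v) = a.val s := by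
  cases a <;> aesop

theorem wlp_ld (hk : k < 16) : (ld x k i).wlp M c Q s ↔
    i.Fits M ∧ 16 < M ∧ 16 * i.val s + k < M ∧ s.arr k (i.val s) < M ∧
      Q ((s.put 60 (16 * i.val s + k)).put x (s.arr k (i.val s))) := by
  simp only [ld, wlp_seq, wlp_mul, wlp_add, Operand.fits_reg, Operand.fits_lit, Operand.val_reg,
    Operand.val_lit, State.put_reg, if_true, true_and, State.put_put]
  simp only [wlp, Operand.fits_reg, Operand.val_reg, State.put_reg, if_true, true_and,
    State.put_mem]
  constructor
  · rintro ⟨h1, h2, h3, h4, h5, h6, h7⟩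
    exact ⟨h2, h1, h5, h6, h7⟩
  · rintro ⟨h2, h1, h5, h6, h7⟩
    exact ⟨h1, h2, by omega, by omega, h5, h6, h7⟩

/-- Register `60` receives the address before `b` is read, hence `hb`. -/
theorem wlp_st (hk : k < 16) (hb : b ≠ .reg 60) : (st k i b).wlp M c Q s ↔
    i.Fits M ∧ b.Fits M ∧ 16 < M ∧ 16 * i.val s + k < M ∧ b.val s < M ∧
      Q ((s.put 60 (16 * i.val s + k)).sto k (i.val s) (b.val s)) := by
  simp only [st, wlp_seq, wlp_mul, wlp_add, Operand.fits_reg, Operand.fits_lit, Operand.val_reg,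
    Operand.val_lit, State.put_reg, if_true, true_and, State.put_put]
  simp only [wlp, Operand.fits_reg, Operand.val_reg, State.put_reg, if_true, true_and,
    val_put_of_ne hb, State.sto]
  constructor
  · rintro ⟨h1, h2, h3, h4, h5, h6, h7, h8⟩
    exact ⟨h2, h6, h1, h5, h7, h8⟩
  · rintro ⟨h2, h6, h1, h5, h7, h8⟩
    exact ⟨h1, h2, by omega, by omega, h5, h6, h7, h8⟩

@[simp] theorem cost_set : (set x a).cost = 1 := rfl
@[simp] theorem cost_add : (add x a b).cost = 1 := rfl
@[simp] theorem cost_sub : (sub x a b).cost = 1 := rfl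
@[simp] theorem cost_mul : (mul x a b).cost = 1 := rfl
@[simp] theorem cost_div : (div x a b).cost = 1 := rfl
@[simp] theorem cost_lt : (lt x a b).cost = 1 := rfl
@[simp] theorem cost_eq : (eq x a b).cost = 1 := rfl
@[simp] theorem cost_cmp : (cmp x a b).cost = 1 := rfl
@[simp] theorem cost_skip : skip.cost = 1 := rfl
@[simp] theorem cost_ld : (ld x k i).cost = 5 := rfl
@[simp] theorem cost_st : (st k i b).cost = 5 := rfl
@[simp] theorem cost_seq {p q : Prog} : (p ⨟ q).cost = p.cost + q.cost + 1 := rfl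
@[simp] theorem cost_branch {p q : Prog} : (branch a p q).cost = max p.cost q.cost + 1 := rfl

end Prog

end

/-! ### Removing unmatched points, and choosing the scales -/

section

/-! ### Preprocessing -/

open Prog Operand

/-- Red point `i` is dominated by some blue point. -/
def RedMatched (N : ℕ) (ν : ℕ → ℝ) (i : ℕ) : Prop := ∃ j < N, i < j ∧ ν (N + j) < ν i

/-- Blue point `j` dominates some red point. -/
def BlueMatched (N : ℕ) (ν : ℕ → ℝ) (j : ℕ) : Prop := ∃ i < j, ν (N + j) < ν i

/-- Array `0` marks the red points which are dominated by some blue point. -/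
def markRed : Prog :=
  (sub 20 (reg 0) (lit 1) ⨟ add 21 (reg 0) (reg 20)) ⨟
  loop (reg 20)
    (sub 20 (reg 20) (lit 1) ⨟ cmp 22 (reg 21) (reg 20) ⨟ st 0 (reg 20) (reg 22) ⨟
    add 23 (reg 0) (reg 20) ⨟ cmp 24 (reg 23) (reg 21) ⨟
    branch (reg 24) (set 21 (reg 23)) skip)

/-- Array `2` lists the positions of the blue points which dominate some red point, register `1`
holds their number, and array `1` holds the numbers of those up to a given position. -/
def listBlue : Prog :=
  (set 20 (lit 1) ⨟ set 21 (lit 0) ⨟ set 1 (lit 0) ⨟ st 1 (lit 0) (lit 0) ⨟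
    lt 22 (reg 20) (reg 0)) ⨟
  loop (reg 22)
    (add 23 (reg 0) (reg 20) ⨟ cmp 24 (reg 23) (reg 21) ⨟
    branch (reg 24) (st 2 (reg 1) (reg 23) ⨟ add 1 (reg 1) (lit 1)) skip ⨟
    st 1 (reg 20) (reg 1) ⨟
    cmp 24 (reg 21) (reg 20) ⨟ branch (reg 24) (set 21 (reg 20)) skip ⨟
    add 20 (reg 20) (lit 1) ⨟ lt 22 (reg 20) (reg 0))

/-- Register `3` is set to a power of two of order `N ^ (1 / 4)`, and register `2` to `N` if
`N < N₀`, and to a number of order `√N * log N / E` otherwise. -/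
def setParameters (N₀ E : ℕ) : Prog :=
  (set 20 (reg 0) ⨟ set 3 (lit 1) ⨟ set 21 (lit 0)) ⨟
  loop (reg 20)
    (div 20 (reg 20) (lit 16) ⨟ mul 3 (reg 3) (lit 2) ⨟ add 21 (reg 21) (lit 1)) ⨟
  lt 22 (reg 0) (lit N₀) ⨟
  branch (reg 22) (set 2 (reg 0))
    (div 2 (reg 21) (lit E) ⨟ add 2 (reg 2) (lit 1) ⨟ mul 2 (reg 2) (reg 3) ⨟
      mul 2 (reg 2) (reg 3))

variable {w M : ℕ} {input : List ℝ} {N : ℕ} {ν : ℕ → ℝ} {s : State} {F : State → ℝ≥0∞} {c : ℝ≥0∞}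

open Classical in
theorem markRed_triple (hM : M ≤ 2 ^ w) (hN : 1 ≤ N) (hNM : 64 * N + 64 ≤ M)
    (hcmp : ∀ a < 2 * N, ∀ b < 2 * N, compareInput input a b = if ν a < ν b then 1 else 0)
    (h0 : s.reg 0 = N)
    (hF : ∀ s' : State, s'.reg 0 = N →
      (∀ i < N - 1, s'.arr 0 i = if RedMatched N ν i then 1 else 0) → F s' ≤ c) :
    Triple w input markRed (100 * N) s c F := by
  have hM2 : 2 ≤ M := by omega
  refine .seq_wlp hM hM2 (m := 100 * N - 4) (by simp; omega) ?_
  simp [h0]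
  refine ⟨by omega, by omega, by omega, ?_⟩
  -- Scanning from the right, register `21` points to a lowest blue point of the suffix; one
  -- comparison with it decides whether a red point is matched.
  refine .loop_wlp hM hM2 (fun s => s.reg 0 = N ∧ s.reg 20 < N ∧ s.reg 20 + N ≤ s.reg 21 ∧
     s.reg 21 < 2 * N ∧ (∀ j < N, s.reg 20 ≤ j → ν (s.reg 21) ≤ ν (N + j)) ∧
      (∀ i < N - 1, s.reg 20 ≤ i → s.arr 0 i = if RedMatched N ν i then 1 else 0))
     (fun s => s.reg 20) ?_ ?_ ?_ ?_
  · simp [h0]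
    refine ⟨by omega, by omega, by omega, ?_, ?_⟩
    · intro j h1 h2
      rw [show j = N - 1 by omega]
    · intros; omega
  · simp
    omega
  · rintro s ⟨h1, h2, h3, h4, h5, h6⟩ h7
    obtain ⟨i, hi⟩ : ∃ i, s.reg 20 = i + 1 := Nat.exists_eq_succ_of_ne_zero h7
    obtain ⟨x, hx⟩ : ∃ x, s.reg 21 = x := ⟨_, rfl⟩
    rw [hx] at h3 h4 h5
    rw [hi] at h2 h3 h5 h6
    have e1 := hcmp x h4 i (by omega)
    have e2 := hcmp (N + i) (by omega) x h4
    have e3 : RedMatched N ν i ↔ ν x < ν i := by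
      constructor
      · rintro ⟨j, hj1, hj2, hj3⟩
        exact (h5 j hj1 hj2).trans_lt hj3
      · intro h
        exact ⟨x - N, by omega, by omega, by rwa [show N + (x - N) = x by omega]⟩
    simp [wlp_st, h1, State.sto_arr, hi, hx, e1, e2]
    have key : ∀ i' < N - 1, i ≤ i' → (if i' = i then if ν x < ν i then 1 else 0 else s.arr 0 i') =
        if RedMatched N ν i' then 1 else 0 := by
      intro i' h1 h2
      by_cases h : i' = i
      · subst h; simp [e3]
      · rw [if_neg h, h6 i' h1 (by omega)]
    refine ⟨by omega, by omega, by omega, by omega, by split_ifs <;> omega, by omega, ?_, ?_⟩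
    · intro h
      refine ⟨by omega, by omega, by omega, ?_, key⟩
      intro j hj1 hj2
      rcases hj2.eq_or_lt with rfl | hj2
      · exact h
      · exact h5 j hj1 hj2
    · intro h
      refine ⟨by omega, by omega, by omega, by omega, by omega, ?_, key⟩
      intro j hj1 hj2
      rcases hj2.eq_or_lt with rfl | hj2
      · exact le_rfl
      · exact h.le.trans (h5 j hj1 hj2)
  · rintro s ⟨h1, h2, h3, h4, h5, h6⟩ h7
    exact hF s h1 fun i hi => h6 i hi (by omega)

open Classical in
theorem listBlue_triple (hM : M ≤ 2 ^ w) (hN : 1 ≤ N) (hNM : 64 * N + 64 ≤ M)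
    (hcmp : ∀ a < 2 * N, ∀ b < 2 * N, compareInput input a b = if ν a < ν b then 1 else 0)
    (h0 : s.reg 0 = N) {f : ℕ → ℕ} (hf : ∀ i < N - 1, s.arr 0 i = f i)
    (hF : ∀ s' : State, s'.reg 0 = N → s'.reg 1 = Nat.count (BlueMatched N ν) N →
      (∀ i < N - 1, s'.arr 0 i = f i) →
      (∀ i < N, s'.arr 1 i = Nat.count (BlueMatched N ν) (i + 1)) →
      (∀ b < Nat.count (BlueMatched N ν) N, s'.arr 2 b = N + Nat.nth (BlueMatched N ν) b) →
        F s' ≤ c) :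
    Triple w input listBlue (100 * N) s c F := by
  have hM2 : 2 ≤ M := by omega
  refine .seq_wlp hM hM2 (m := 100 * N - 20) (by simp; omega) ?_
  have hlit : ∀ n ≤ 64, n < M := fun n hn => by omega
  have hite : ∀ (p : Prop) [Decidable p], (if p then 1 else 0) < M := fun p _ => by
    split_ifs <;> omega
  simp [h0, wlp_st, hlit, hite]
  set P := BlueMatched N ν with hP
  -- No red point precedes position `0`, so the scan starts at position `1`.
  have hP0 : ¬ P 0 := by rintro ⟨i, hi, -⟩; omega
  -- Dually, register `21` points to a highest red point of the prefix.
  refine .loop_wlp hM hM2 (fun s => s.reg 0 = N ∧ 1 ≤ s.reg 20 ∧ s.reg 20 ≤ N ∧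
     s.reg 21 < s.reg 20 ∧ (∀ i < s.reg 20, ν i ≤ ν (s.reg 21)) ∧
     s.reg 1 = Nat.count P (s.reg 20) ∧ s.reg 22 = (if s.reg 20 < N then 1 else 0) ∧
     (∀ i < N - 1, s.arr 0 i = f i) ∧
     (∀ i < s.reg 20, s.arr 1 i = Nat.count P (i + 1)) ∧
     (∀ b < Nat.count P (s.reg 20), s.arr 2 b = N + Nat.nth P b))
     (fun s => N - s.reg 20) ?_ ?_ ?_ ?_
  · simp [h0, State.sto_arr, Nat.count_succ, hP0]
    exact ⟨hN, hf⟩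
  · simp
    omega
  · rintro s ⟨h1, h2, h3, h4, h5, h6, h7, h8, h9, h10⟩ h11
    have h12 : s.reg 20 < N := by
      by_contra h
      rw [if_neg h] at h7; exact h11 h7
    obtain ⟨j, hj⟩ : ∃ j, s.reg 20 = j := ⟨_, rfl⟩
    obtain ⟨x, hx⟩ : ∃ x, s.reg 21 = x := ⟨_, rfl⟩
    rw [hx, hj] at h4
    rw [hx, hj] at h5
    rw [hj] at h2 h3 h6 h7 h9 h10 h12
    have e1 := hcmp (N + j) (by omega) x (by omega)
    have e2 := hcmp x (by omega) j (by omega)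
    have e3 : P j ↔ ν (N + j) < ν x := by
      constructor
      · rintro ⟨i, hi, hi'⟩
        exact hi'.trans_le (h5 i hi)
      · exact fun h => ⟨x, h4, h⟩
    have hc : Nat.count P j ≤ j := Nat.count_le _
    have hsucc := Nat.count_succ P j
    rw [e3] at hsucc
    have g5 : ν x < ν j → ∀ i ≤ j, ν i ≤ ν j := by
      intro h i hi
      rcases hi.eq_or_lt with rfl | hi
      · exact le_rfl
      · exact (h5 i hi).trans h.le
    have g5' : ν j ≤ ν x → ∀ i ≤ j, ν i ≤ ν x := by
      intro h i hi
      rcases hi.eq_or_lt with rfl | hi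
      · exact h
      · exact h5 i hi
    have g9 : ∀ i ≤ j, (if i = j then Nat.count P (j + 1) else s.arr 1 i) =
        Nat.count P (i + 1) := by
      intro i hi
      split_ifs with h
      · rw [h]
      · exact h9 i (by omega)
    have g10 : P j → ∀ b < Nat.count P j + 1, (if b = Nat.count P j then N + j else s.arr 2 b) =
        N + Nat.nth P b := by
      intro hPj b hb
      split_ifs with h
      · rw [h, Nat.nth_count hPj]
      · exact h10 b (by omega)
    rw [e3] at g10
    simp [wlp_st, h1, State.sto_arr, hj, hx, e1, e2, h6, hlit, hite]
    refine ⟨by omega, ?_, ?_⟩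
    · intro h
      rw [if_neg (not_lt.2 h), add_zero] at hsucc
      rw [hsucc] at g9
      rw [hsucc]
      refine ⟨by omega, by omega, fun h' => ?_, fun h' => ?_⟩
      · have := g5' h'
        and_intros <;> omega
      · have := g5 h'
        and_intros <;> omega
    · intro h
      rw [if_pos h] at hsucc
      rw [hsucc] at g9
      rw [hsucc]
      have := g10 h
      refine ⟨by omega, by omega, by omega, by omega, by omega, fun h' => ?_, fun h' => ?_⟩
      · have := g5' h'
        and_intros <;> omega
      · have := g5 h'
        and_intros <;> omega
  · rintro s ⟨h1, h2, h3, h4, h5, h6, h7, h8, h9, h10⟩ h11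
    have : s.reg 20 = N := by
      by_contra h
      rw [if_pos (by omega)] at h7; omega
    rw [this] at h6 h9 h10
    exact hF s h1 h6 h8 h9 h10

theorem setParameters_triple {N₀ E : ℕ} (hM : M ≤ 2 ^ w) (hN : 1 ≤ N) (hNM : 64 * N + 64 ≤ M)
    (hN₀ : N₀ < M) (hE : E < M) (h0 : s.reg 0 = N)
    (hF : ∀ (s' : State) (k : ℕ), s'.reg 0 = N → s'.reg 1 = s.reg 1 → s'.mem = s.mem →
      N < 16 ^ k → 16 ^ k ≤ 16 * N → s'.reg 3 = 2 ^ k →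
      s'.reg 2 = (if N < N₀ then N else (k / E + 1) * 2 ^ k * 2 ^ k) → F s' ≤ c) :
    Triple w input (setParameters N₀ E) (100 * N) s c F := by
  have hM2 : 2 ≤ M := by omega
  have hlit : ∀ n ≤ 64, n < M := fun n hn => by omega
  have hite : ∀ (p : Prop) [Decidable p], (if p then 1 else 0) < M := fun p _ => by
    split_ifs <;> omega
  refine .seq_wlp hM hM2 (m := 100 * N - 20) (by simp; omega) ?_
  simp [h0, hlit]
  refine ⟨by omega, ?_⟩
  refine .seq (n := 10 * N + 1) (m := 100 * N - 10 * N - 22) (.loop_wlp hM hM2 (fun s' => s'.reg 0 = N ∧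
    s'.reg 1 = s.reg 1 ∧ s'.mem = s.mem ∧ ∃ k, s'.reg 21 = k ∧ s'.reg 20 = N / 16 ^ k ∧
      16 ^ k ≤ 16 * N ∧ s'.reg 3 = 2 ^ k) (fun s => s.reg 20) ?_ ?_ ?_ ?_) (by omega)
  · simp [h0]
    omega
  · simp
    omega
  · rintro t ⟨h1, h2, h3, k, h4, h5, h6, h7⟩ h8
    have h9 : 16 ^ k ≤ N := by
      by_contra h
      rw [Nat.div_eq_of_lt (by omega)] at h5; exact h8 h5
    have h10 : N / 16 ^ k / 16 < N / 16 ^ k := Nat.div_lt_self (by omega) (by norm_num)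
    have h11 : N / 16 ^ k ≤ N := Nat.div_le_self _ _
    have h12 : 2 ^ k ≤ 16 ^ k := Nat.pow_le_pow_left (by norm_num) k
    have h13 : k < 2 ^ k := Nat.lt_two_pow_self
    simp [h1, h2, h3, h4, h5, h7, hlit, Nat.div_div_eq_div_mul, pow_succ]
    rw [Nat.div_div_eq_div_mul] at h10
    refine ⟨by omega, by omega, by omega, by omega, by omega⟩
  · rintro t ⟨h1, h2, h3, k, h4, h5, h6, h7⟩ h8
    have h9 : N < 16 ^ k := by
      rw [h8] at h5
      exact (Nat.div_eq_zero_iff_lt (by positivity)).1 h5.symm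
    -- The scale fits into a word: `k / E + 1 ≤ 4 ^ k`, so it is at most `16 ^ k ≤ 16 * N`.
    have h12 : 2 ^ k * (2 ^ k * 4 ^ k) = 16 ^ k := by
      rw [← mul_pow, ← mul_pow]; norm_num
    have h13 : k < 2 ^ k := Nat.lt_two_pow_self
    have h14 : k + 1 ≤ 4 ^ k := h13.trans_le (Nat.pow_le_pow_left (by norm_num) k)
    have h15 : k / E ≤ k := Nat.div_le_self _ _
    have h16 : (k / E + 1) * 2 ^ k * 2 ^ k ≤ 16 ^ k := by
      rw [← h12, mul_comm _ (2 ^ k)]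
      refine Nat.mul_le_mul_left _ ?_
      rw [mul_comm]
      exact Nat.mul_le_mul_left _ (by omega)
    have h17 : (k / E + 1) * 2 ^ k ≤ (k / E + 1) * 2 ^ k * 2 ^ k :=
      Nat.le_mul_of_pos_right _ (by positivity)
    have h18 : 2 ^ k ≤ 16 ^ k := Nat.pow_le_pow_left (by norm_num) k
    refine Triple.bestBound_le ((Triple.of_wlp hM hM2 ?_).time_mono (n := _) ?_)
    · simp [h1, h4, h7, hlit, hite, hN₀, hE]
      refine ⟨fun h => ?_, fun h => ?_⟩
      · refine ⟨by omega, by omega, by omega, by omega, ?_⟩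
        apply hF _ k <;> simp [h1, h2, h3, h7, h9, h6, not_lt.2 h]
      · refine ⟨by omega, ?_⟩
        apply hF _ k <;> simp [h1, h2, h3, h7, h9, h6, h]
    · simp
      omega

end

/-! ### State of the sweep, and random pivots of medium height -/

section

open Prog Operand

/-! ### The data of the sweep -/

/-- The first `l.length` entries of array `k` are the entries of `l`. -/
def State.Holds (s : State) (k : ℕ) (l : List ℕ) : Prop := ∀ i < l.length, s.arr k i = l.getD i 0

@[simp] theorem State.holds_put {s : State} {x v k : ℕ} {l : List ℕ} :
    (s.put x v).Holds k l ↔ s.Holds k l := Iff.rfl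

theorem State.holds_sto_of_ne {s : State} {k k' : ℕ} (hk : k < 16) (hk' : k' < 16) (h : k ≠ k')
    {i v : ℕ} {l : List ℕ} : (s.sto k' i v).Holds k l ↔ s.Holds k l := by
  simp [State.Holds, State.sto_arr hk' hk, h]

theorem State.Holds.concat {s : State} {k : ℕ} (hk : k < 16) {l : List ℕ} (h : s.Holds k l)
    (v : ℕ) : (s.sto k l.length v).Holds k (l ++ [v]) := by
  intro i hi
  rw [State.sto_arr hk hk]
  simp only [List.length_append, List.length_singleton] at hi
  rcases (Nat.lt_succ_iff.1 hi).eq_or_lt with rfl | hi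
  · simp
  · rw [if_neg (by omega), h i hi, List.getD_append _ _ _ _ hi]

/-- An instance of the counting problem: red point `i` is to be paired with the blue points in a
list, starting from number `cb i`. -/
structure Instance (N : ℕ) (ν : ℕ → ℝ) where
  /-- The number of blue points. -/
  nb : ℕ
  /-- The red points which take part. -/
  red : ℕ → Prop
  /-- The number of the first blue point which is to be paired with a red point. -/
  cb : ℕ → ℕ
  /-- The input positions of the blue points. -/
  bp : ℕ → ℕ
  nb_le : nb ≤ N
  cb_le : ∀ i < N, cb i ≤ nb
  cb_mono : Monotone cb
  -- Guarantees that the range from which blue points are sampled is nonempty.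
  cb_lt : ∀ i, red i → i < N - 1 → cb i < nb
  bp_lt : ∀ b < nb, bp b < 2 * N

variable {w M : ℕ} {input : List ℝ} {N : ℕ} {ν : ℕ → ℝ} {s : State} {F : State → ℝ≥0∞} {c : ℝ≥0∞}

open Classical in
/-- The instance is stored in registers `0` and `1` and arrays `0`, `1` and `2`. -/
structure Instance.Stored (I : Instance N ν) (s : State) : Prop where
  reg_zero : s.reg 0 = N
  reg_one : s.reg 1 = I.nb
  arr_zero : ∀ i < N - 1, s.arr 0 i = if I.red i then 1 else 0
  arr_one : ∀ i < N, s.arr 1 i = I.cb i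
  arr_two : ∀ b < I.nb, s.arr 2 b = I.bp b

theorem Instance.stored_put {I : Instance N ν} {x v : ℕ} (hx : 2 ≤ x) :
    I.Stored (s.put x v) ↔ I.Stored s := by
  have e0 : (s.put x v).reg 0 = s.reg 0 := by rw [State.put_reg, if_neg (by omega)]
  have e1 : (s.put x v).reg 1 = s.reg 1 := by rw [State.put_reg, if_neg (by omega)]
  exact ⟨fun ⟨h0, h1, h2, h3, h4⟩ => ⟨e0 ▸ h0, e1 ▸ h1, h2, h3, h4⟩,
    fun ⟨h0, h1, h2, h3, h4⟩ => ⟨e0 ▸ h0, e1 ▸ h1, h2, h3, h4⟩⟩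

theorem Instance.stored_sto {I : Instance N ν} {k i v : ℕ} (hk : 3 ≤ k) (hk' : k < 16) :
    I.Stored (s.sto k i v) ↔ I.Stored s := by
  have e : ∀ k' < 3, ∀ i', (s.sto k i v).arr k' i' = s.arr k' i' := fun k' h i' => by
    rw [State.sto_arr hk' (by omega), if_neg (by omega)]
  constructor
  · rintro ⟨h0, h1, h2, h3, h4⟩
    simp only [e 0 (by norm_num), e 1 (by norm_num), e 2 (by norm_num)] at h2 h3 h4
    exact ⟨h0, h1, h2, h3, h4⟩
  · rintro ⟨h0, h1, h2, h3, h4⟩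
    simp only [← e 0 (by norm_num), ← e 1 (by norm_num), ← e 2 (by norm_num)] at h2 h3 h4
    exact ⟨h0, h1, h2, h3, h4⟩

/-- The sweep over the red points. -/
structure Sweep where
  /-- The scale: at most `4 * ℓ` red points are active at a time. -/
  ℓ : ℕ
  /-- The active red points. -/
  H : List ℕ
  /-- The finished red points, with the number of the first blue point which was not yet reached
  when they were finished. -/
  G : List (ℕ × ℕ)
  /-- The levels: the position of the threshold, the number of blue points already reached, and the
  number of red points already finished. -/
  L : List (ℕ × ℕ × ℕ)

/-- The sweep is stored in registers `2`, `4`, `5`, `6`, `7`, `10` and arrays `3` to `8`. -/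
structure Sweep.Rep (σ : Sweep) (I : Instance N ν) (d : ℕ) (s : State) : Prop where
  stored : I.Stored s
  reg2 : s.reg 2 = σ.ℓ
  reg3 : s.reg 3 = d
  reg4 : s.reg 4 = σ.H.length
  reg5 : s.reg 5 = σ.G.length
  reg6 : s.reg 6 = σ.L.length
  -- The running number of direct candidates, from which the chunk length is computed later.
  reg7 : s.reg 7 = (σ.G.map fun e => e.2 - I.cb e.1).sum
  reg10 : ∀ l ∈ σ.L.getLast?, s.reg 10 = l.1
  arr3 : s.Holds 3 σ.H
  arr4 : s.Holds 4 (σ.G.map fun e => e.1)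
  arr5 : s.Holds 5 (σ.G.map fun e => e.2)
  arr6 : s.Holds 6 (σ.L.map fun l => l.1)
  arr7 : s.Holds 7 (σ.L.map fun l => l.2.1)
  arr8 : s.Holds 8 (σ.L.map fun l => l.2.2)

/-- The states agree apart from scratch registers and scratch memory. -/
def State.Same (s s' : State) : Prop :=
  (∀ r < 31, s'.reg r = s.reg r) ∧ ∀ k < 11, ∀ i, s'.arr k i = s.arr k i

theorem State.Same.refl (s : State) : s.Same s := ⟨fun _ _ => rfl, fun _ _ _ => rfl⟩

theorem State.same_put {s s' : State} {x v : ℕ} (hx : 31 ≤ x) :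
    s.Same (s'.put x v) ↔ s.Same s' := by
  refine and_congr ?_ Iff.rfl
  refine forall₂_congr fun r hr => ?_
  rw [State.put_reg, if_neg (by omega)]

theorem State.same_sto {s s' : State} {k i v : ℕ} (hk : 11 ≤ k) (hk' : k < 16) :
    s.Same (s'.sto k i v) ↔ s.Same s' := by
  refine and_congr Iff.rfl ?_
  refine forall₂_congr fun r hr => ?_
  simp [State.sto_arr hk' (show r < 16 by omega), show r ≠ k by omega]

theorem State.Same.trans {s s' s'' : State} (h : s.Same s') (h' : s'.Same s'') : s.Same s'' :=
  ⟨fun r hr => (h'.1 r hr).trans (h.1 r hr), fun k hk i => (h'.2 k hk i).trans (h.2 k hk i)⟩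

theorem State.Same.holds {s s' : State} (h : s.Same s') {k : ℕ} (hk : k < 11) {l : List ℕ}
    (hl : s.Holds k l) : s'.Holds k l := fun i hi => (h.2 k hk i).trans (hl i hi)

theorem Sweep.Rep.of_same {σ : Sweep} {I : Instance N ν} {d : ℕ} {s s' : State}
    (h : σ.Rep I d s) (hs : s.Same s') : σ.Rep I d s' where
  stored := ⟨by rw [hs.1 _ (by norm_num), h.stored.1], by rw [hs.1 _ (by norm_num), h.stored.2],
    fun i hi => by rw [hs.2 _ (by norm_num), h.stored.3 i hi],
    fun i hi => by rw [hs.2 _ (by norm_num), h.stored.4 i hi],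
    fun i hi => by rw [hs.2 _ (by norm_num), h.stored.5 i hi]⟩
  reg2 := by rw [hs.1 _ (by norm_num), h.reg2]
  reg3 := by rw [hs.1 _ (by norm_num), h.reg3]
  reg4 := by rw [hs.1 _ (by norm_num), h.reg4]
  reg5 := by rw [hs.1 _ (by norm_num), h.reg5]
  reg6 := by rw [hs.1 _ (by norm_num), h.reg6]
  reg7 := by rw [hs.1 _ (by norm_num), h.reg7]
  reg10 := by rw [hs.1 _ (by norm_num)]; exact h.reg10
  arr3 := hs.holds (by norm_num) h.arr3
  arr4 := hs.holds (by norm_num) h.arr4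
  arr5 := hs.holds (by norm_num) h.arr5
  arr6 := hs.holds (by norm_num) h.arr6
  arr7 := hs.holds (by norm_num) h.arr7
  arr8 := hs.holds (by norm_num) h.arr8

/-! ### Choosing a pivot -/

open Classical in
/-- The number of `u < n` such that `f u` satisfies `A`. -/
def hits (A : ℕ → Prop) (f : ℕ → ℕ) (n : ℕ) : ℕ := ∑ u ∈ range n, if A (f u) then 1 else 0

open Classical in
theorem hits_succ (A : ℕ → Prop) (f : ℕ → ℕ) (n : ℕ) :
    hits A f (n + 1) = hits A f n + if A (f n) then 1 else 0 := sum_range_succ _ _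

theorem hits_congr {A : ℕ → Prop} {f g : ℕ → ℕ} {n : ℕ} (h : ∀ u < n, f u = g u) :
    hits A f n = hits A g n :=
  sum_congr rfl fun u hu => by rw [h u (mem_range.1 hu)]

open Classical in
theorem hits_sto {k : ℕ} (hk : k < 16) (A : ℕ → Prop) (s : State) (u v : ℕ) :
    hits A ((s.sto k u v).arr k) (u + 1) = hits A (s.arr k) u + if A v then 1 else 0 := by
  have h : (s.sto k u v).arr k u = v := by simp [State.sto_arr hk hk]
  rw [hits_succ, h]
  congr 1
  exact hits_congr fun x hx => by rw [State.sto_arr hk hk, if_neg (by omega)]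

@[simp] theorem hits_zero (A : ℕ → Prop) (f : ℕ → ℕ) : hits A f 0 = 0 := rfl

/-- Array `11` gets `d` random active red points. -/
def samplePivots : Prog :=
  (set 31 (lit 0) ⨟ set 32 (reg 3)) ⨟
  loop (reg 32)
    (sub 32 (reg 32) (lit 1) ⨟ .instr (.rand 33 (reg 4)) ⨟
      (ld 34 3 (reg 33) ⨟ st 11 (reg 31) (reg 34) ⨟ add 31 (reg 31) (lit 1)))

open Classical in
-- Here `p m a b` bounds the expected cost when `m` draws remain and `a`, `b` draws have hit `A`,
-- `B` so far; `hp` says that it is a supermartingale.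
theorem samplePivots_triple (hM : M ≤ 2 ^ w) {d : ℕ} {H : List ℕ} (h4 : s.reg 4 = H.length)
    (h3 : s.reg 3 = d) (hH : s.Holds 3 H) (hH0 : H ≠ []) (hHM : 64 * H.length + 64 < M)
    (hdM : 64 * d + 64 ≤ M) (hHN : ∀ h ∈ H, h < M) (A B : ℕ → Prop) (p : ℕ → ℕ → ℕ → ℝ≥0∞)
    (hp : ∀ m a b, ∑ i ∈ range H.length, p m (a + if A (H.getD i 0) then 1 else 0)
      (b + if B (H.getD i 0) then 1 else 0) ≤ H.length * p (m + 1) a b)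
    (hF : ∀ s', s.Same s' → (∀ u < d, s'.arr 11 u ∈ H) →
      F s' ≤ p 0 (hits A (s'.arr 11) d) (hits B (s'.arr 11) d)) :
    Triple w input samplePivots (30 * d + 10) s (p d 0 0) F := by
  have hM2 : 2 ≤ M := by omega
  have hlit : ∀ n ≤ 64, n < M := fun n hn => by omega
  refine .seq_wlp hM hM2 (m := 30 * d + 1) (by simp; omega) ?_
  simp [h3, hlit]
  refine ⟨by omega, ?_⟩
  have key := Triple.loop (w := w) (input := input) (a := reg 32)
    (p := sub 32 (reg 32) (lit 1) ⨟ .instr (.rand 33 (reg 4)) ⨟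
      (ld 34 3 (reg 33) ⨟ st 11 (reg 31) (reg 34) ⨟ add 31 (reg 31) (lit 1))) (F := F)
    (fun s' => s.Same s' ∧ s'.reg 32 + s'.reg 31 = d ∧ ∀ u < s'.reg 31, s'.arr 11 u ∈ H)
    (fun s' => 30 * s'.reg 32)
    (fun s' => p (s'.reg 32) (hits A (s'.arr 11) (s'.reg 31))
      (hits B (s'.arr 11) (s'.reg 31))) ?_ ?_
    ((s.put 31 0).put 32 d) ?_
  · refine (key.time_mono ?_).mono le_rfl ?_ fun _ => le_rfl
    · simp
    · simp
  · rintro t ⟨h1, h2, h5⟩ h6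
    have h6' : t.reg 32 = 0 := h6
    rw [h6', zero_add] at h2
    rw [h6', h2]
    rw [h2] at h5
    exact hF t h1 h5
  · rintro t ⟨h1, h2, h5⟩ h6
    have h6' : t.reg 32 ≠ 0 := h6
    obtain ⟨m, hm⟩ := Nat.exists_eq_succ_of_ne_zero h6'
    obtain ⟨u, hu⟩ : ∃ u, t.reg 31 = u := ⟨_, rfl⟩
    have h4' : t.reg 4 = H.length := by rw [h1.1 4 (by norm_num), h4]
    have hH' : t.Holds 3 H := h1.holds (by norm_num) hH
    have hpos := List.length_pos_of_ne_nil hH0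
    rw [hm, hu] at h2
    rw [hu] at h5
    refine ⟨25, show 26 ≤ 30 * t.reg 32 by omega, ?_⟩
    refine .seq_wlp hM hM2 (m := 23) (by simp) ?_
    simp only [wlp_sub, fits_reg, fits_lit, val_reg, val_lit, hm, hu]
    refine ⟨trivial, hlit _ (by norm_num), by omega, ?_⟩
    refine .seq (n := 1) (m := 18) (Triple.rand hM ?_ ?_ ?_) (by norm_num)
    · simp [h4', hpos]
    · simp [h4']; omega
    · simp only [State.put_reg, Nat.reduceEqDiff, if_false, h4', Nat.succ_eq_add_one,
        Nat.add_sub_cancel]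
      refine le_trans (sum_le_sum fun v hv => ?_) (hp m _ _)
      rw [mem_range] at hv
      have e1 : t.arr 3 v = H.getD v 0 := hH' v hv
      have e2 : H.getD v 0 ∈ H := by
        rw [List.getD_eq_getElem _ _ hv]
        exact List.getElem_mem hv
      have e3 := hHN _ e2
      obtain ⟨y, hy⟩ : ∃ y, H.getD v 0 = y := ⟨_, rfl⟩
      rw [hy] at e1 e2 e3 ⊢
      refine bestBound_le_of_wlp hM hM2 (by simp) ?_
      simp [wlp_st, wlp_ld, hlit, e1, hu, State.same_put, State.same_sto, State.sto_arr, h1, e3]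
      refine ⟨by omega, by omega, by omega, ?_⟩
      rw [if_pos]
      · simp [hits_sto]
      · refine ⟨⟨by omega, fun x hx => ?_⟩, by omega⟩
        split_ifs with h
        · exact e2
        · exact h5 x (by omega)
  · simp [State.same_put, State.Same.refl]

theorem hits_add_hits_le {A B : ℕ → Prop} (f : ℕ → ℕ) (n : ℕ) (h : ∀ y, A y → ¬ B y) :
    hits A f n + hits B f n ≤ n := by
  induction n with
  | zero => simp
  | succ n ih =>
    rw [hits_succ, hits_succ]
    have := h (f n)
    split_ifs <;> first | omega | tauto

theorem le_hits_add_hits {A B : ℕ → Prop} (f : ℕ → ℕ) (n : ℕ) (h : ∀ y, A y ∨ B y) :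
    n ≤ hits A f n + hits B f n := by
  induction n with
  | zero => simp
  | succ n ih =>
    rw [hits_succ, hits_succ]
    have := h (f n)
    split_ifs <;> first | omega | tauto

theorem exists_of_hits_pos {A : ℕ → Prop} {f : ℕ → ℕ} {n : ℕ} (h : 0 < hits A f n) :
    ∃ u < n, A (f u) := by
  by_contra! hc
  refine h.ne' (sum_eq_zero fun u hu => ?_)
  rw [if_neg (hc u (mem_range.1 hu))]

/-- Number `u` is the position of a median. -/
def IsMedian (ν : ℕ → ℝ) (f : ℕ → ℕ) (d u : ℕ) : Prop :=
  hits (fun y => ν y < ν (f u)) f d ≤ d / 2 ∧ hits (fun y => ν (f u) < ν y) f d ≤ d / 2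

/-- Take the highest entry with at most half of the sample strictly below it. If more than half were
strictly above, the next higher value would, by maximality, have more than half below it and also
more than half at or above it. -/
theorem exists_isMedian (ν : ℕ → ℝ) (f : ℕ → ℕ) {d : ℕ} (hd : 0 < d) :
    ∃ u < d, IsMedian ν f d u := by
  classical
  let S := (range d).filter fun u => hits (fun y => ν y < ν (f u)) f d ≤ d / 2
  obtain ⟨a, ha, ha'⟩ := exists_min_image (range d) (fun u => ν (f u)) ⟨0, by simpa using hd⟩
  have haS : a ∈ S := by
    refine mem_filter.2 ⟨ha, ?_⟩
    by_contra! hc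
    obtain ⟨u, hu, hu'⟩ := exists_of_hits_pos (lt_of_le_of_lt (Nat.zero_le _) hc)
    exact (ha' u (mem_range.2 hu)).not_gt hu'
  obtain ⟨u, hu, hu'⟩ := exists_max_image S (fun u => ν (f u)) ⟨a, haS⟩
  obtain ⟨hu1, hu2⟩ := mem_filter.1 hu
  refine ⟨u, mem_range.1 hu1, hu2, ?_⟩
  by_contra! hc
  let T := (range d).filter fun x => ν (f u) < ν (f x)
  have hT : T.Nonempty := by
    obtain ⟨x, hx, hx'⟩ := exists_of_hits_pos (lt_of_le_of_lt (Nat.zero_le _) hc)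
    exact ⟨x, mem_filter.2 ⟨mem_range.2 hx, hx'⟩⟩
  obtain ⟨x, hx, hx'⟩ := exists_min_image T (fun u => ν (f u)) hT
  obtain ⟨hx1, hx2⟩ := mem_filter.1 hx
  have hxS : d / 2 < hits (fun y => ν y < ν (f x)) f d := by
    by_contra! h
    exact (hu' x (mem_filter.2 ⟨hx1, h⟩)).not_gt hx2
  have h1 : hits (fun y => ν (f u) < ν y) f d ≤ hits (fun y => ν (f x) ≤ ν y) f d := by
    refine sum_le_sum fun y hy => ?_
    by_cases h : ν (f u) < ν (f y)
    · have := hx' y (mem_filter.2 ⟨hy, h⟩)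
      simp [h, this]
    · simp [h]
  have h2 := hits_add_hits_le (A := fun y => ν y < ν (f x)) (B := fun y => ν (f x) ≤ ν y) f d
    fun y h => not_le.2 h
  omega

/-- Register `35` gets a median of the entries of array `11`. -/
def medianOfSample : Prog :=
  set 31 (reg 3) ⨟
  loop (reg 31)
    ((sub 31 (reg 31) (lit 1) ⨟ ld 33 11 (reg 31) ⨟ set 36 (lit 0) ⨟ set 37 (lit 0) ⨟
      set 38 (reg 3)) ⨟
    loop (reg 38)
      (sub 38 (reg 38) (lit 1) ⨟ ld 34 11 (reg 38) ⨟ cmp 39 (reg 34) (reg 33) ⨟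
      add 36 (reg 36) (reg 39) ⨟ cmp 39 (reg 33) (reg 34) ⨟ add 37 (reg 37) (reg 39)) ⨟
    (div 39 (reg 3) (lit 2) ⨟ lt 36 (reg 39) (reg 36) ⨟ lt 37 (reg 39) (reg 37) ⨟
      add 36 (reg 36) (reg 37) ⨟ branch (reg 36) skip (set 35 (reg 33))))

theorem hits_le (A : ℕ → Prop) (f : ℕ → ℕ) (n : ℕ) : hits A f n ≤ n := by
  induction n with
  | zero => simp
  | succ n ih =>
    rw [hits_succ]
    split_ifs <;> omega

open Classical in
theorem medianOfSample_triple (hM : M ≤ 2 ^ w) {d : ℕ} (hd : 0 < d) (h3 : s.reg 3 = d)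
    (hNM : 64 * N + 64 ≤ M) (hdM : 64 * d + 64 ≤ M)
    (hcmp : ∀ a < 2 * N, ∀ b < 2 * N, compareInput input a b = if ν a < ν b then 1 else 0)
    {f : ℕ → ℕ} (hf : ∀ u < d, s.arr 11 u = f u) (hfN : ∀ u < d, f u < N)
    (hF : ∀ s', s.Same s' → (∃ u < d, s'.reg 35 = f u ∧ IsMedian ν f d u) → F s' ≤ c) :
    Triple w input medianOfSample (200 * d * d) s c F := by
  have hM2 : 2 ≤ M := by omega
  have hlit : ∀ n ≤ 64, n < M := fun n hn => by omega
  have hite : ∀ (p : Prop) [Decidable p], (if p then 1 else 0) < M := fun p _ => by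
    split_ifs <;> omega
  have hdd : d ≤ d * d := Nat.le_mul_self d
  refine .seq_wlp hM hM2 (m := 200 * d * d - 2) (by rw [mul_assoc]; simp; omega) ?_
  simp [h3, hlit]
  refine ⟨by omega, ?_⟩
  have key := Triple.loop (w := w) (input := input) (a := reg 31)
    (p := (sub 31 (reg 31) (lit 1) ⨟ ld 33 11 (reg 31) ⨟ set 36 (lit 0) ⨟ set 37 (lit 0) ⨟
      set 38 (reg 3)) ⨟
    loop (reg 38)
      (sub 38 (reg 38) (lit 1) ⨟ ld 34 11 (reg 38) ⨟ cmp 39 (reg 34) (reg 33) ⨟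
      add 36 (reg 36) (reg 39) ⨟ cmp 39 (reg 33) (reg 34) ⨟ add 37 (reg 37) (reg 39)) ⨟
    (div 39 (reg 3) (lit 2) ⨟ lt 36 (reg 39) (reg 36) ⨟ lt 37 (reg 39) (reg 37) ⨟
      add 36 (reg 36) (reg 37) ⨟ branch (reg 36) skip (set 35 (reg 33)))) (F := F)
    -- All entries are tried, the last one first. Once a median has been among those tried, register
    -- `35` holds one; later non-medians do not overwrite it.
    (fun t => s.Same t ∧ t.reg 31 ≤ d ∧ (∀ u < d, t.arr 11 u = f u) ∧
      ((∃ u < d, t.reg 31 ≤ u ∧ IsMedian ν f d u) → ∃ u < d, t.reg 35 = f u ∧ IsMedian ν f d u))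
    (fun t => (20 * d + 70) * t.reg 31) (fun _ => c) ?_ ?_ (s.put 31 d) ?_
  · refine key.time_mono ?_
    simp
    rw [mul_assoc 200, add_mul, mul_assoc 20]
    omega
  · rintro t ⟨h1, h2, h4, h5⟩ h6
    have h6' : t.reg 31 = 0 := h6
    obtain ⟨u, hu, hu'⟩ := exists_isMedian ν f hd
    exact hF t h1 (h5 ⟨u, hu, by omega, hu'⟩)
  · rintro t ⟨h1, h2, h4, h5⟩ h6
    have h6' : t.reg 31 ≠ 0 := h6
    obtain ⟨m, hm⟩ := Nat.exists_eq_succ_of_ne_zero h6'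
    have h3' : t.reg 3 = d := by rw [h1.1 3 (by norm_num), h3]
    rw [hm] at h2
    have e1 := h4 m (by omega)
    have e2 := hfN m (by omega)
    refine ⟨20 * d + 69, ?_, ?_⟩
    · show 20 * d + 69 + 1 ≤ (20 * d + 70) * t.reg 31
      rw [hm, Nat.mul_succ]
      omega
    refine .seq_wlp hM hM2 (m := 20 * d + 50) (by simp; omega) ?_
    simp [wlp_ld, hm, e1, hlit, h3']
    refine ⟨by omega, by omega, by omega, by omega, ?_⟩
    refine .seq (n := 20 * d + 1) (m := 30) (.loop_wlp hM hM2 (fun t' => s.Same t' ∧ t'.reg 31 = m ∧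
      t'.reg 33 = f m ∧ t'.reg 35 = t.reg 35 ∧ (∀ u < d, t'.arr 11 u = f u) ∧ t'.reg 38 ≤ d ∧
      t'.reg 36 + hits (fun y => ν y < ν (f m)) f (t'.reg 38) =
        hits (fun y => ν y < ν (f m)) f d ∧
      t'.reg 37 + hits (fun y => ν (f m) < ν y) f (t'.reg 38) =
        hits (fun y => ν (f m) < ν y) f d) (fun t' => t'.reg 38) ?_ ?_ ?_ ?_) (by omega)
    · simp [State.same_put, h1]
      exact h4
    · simp
      omega
    · rintro t' ⟨g1, g2, g3, g4, g5, g6, g7, g8⟩ g9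
      obtain ⟨j, hj⟩ := Nat.exists_eq_succ_of_ne_zero g9
      rw [hj] at g6 g7 g8
      rw [Nat.succ_eq_add_one, hits_succ] at g7 g8
      have e3 := g5 j (by omega)
      have e4 := hfN j (by omega)
      have e5 := hcmp (f j) (by omega) (f m) (by omega)
      have e6 := hcmp (f m) (by omega) (f j) (by omega)
      have e7 := hits_le (fun y => ν y < ν (f m)) f d
      have e8 := hits_le (fun y => ν (f m) < ν y) f d
      simp [wlp_ld, hlit, State.same_put, hj, g1, g2, g3, g4, e3, e5, e6]
      and_intros <;> omega
    · rintro t' ⟨g1, g2, g3, g4, g5, g6, g7, g8⟩ g9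
      rw [g9, hits_zero, add_zero] at g7 g8
      have g3' : t'.reg 3 = d := by rw [g1.1 3 (by norm_num), h3]
      refine bestBound_le_of_wlp hM hM2 (by simp) ?_
      have hT : (20 * d + 70) * m + (20 * d + 69) < (20 * d + 70) * (m + 1) := by
        rw [Nat.mul_succ]; omega
      simp [hlit, hite, g3', g7, g8, g2, g3, g4, State.same_put, g1, hT]
      refine ⟨by omega, by split_ifs <;> omega, fun a b => ⟨by omega, ?_⟩, fun a => ?_⟩
      · exact (if_pos ⟨by omega, g5, fun x hx hx' hmed => ⟨m, by omega, rfl, a, b⟩⟩).le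
      · refine (if_pos ⟨by omega, g5, fun x hx hx' hmed => ?_⟩).le
        refine h5 ⟨x, hx, ?_, hmed⟩
        rcases hx'.eq_or_lt with rfl | hx'
        · exact absurd hmed.2 (not_le.2 (a hmed.1))
        · omega
  · simp [State.same_put, State.Same.refl]
    exact ⟨hf, fun u hu hu' => by omega⟩

theorem hits_getD (A : ℕ → Prop) [DecidablePred A] (l : List ℕ) :
    hits A (fun i => l.getD i 0) l.length = l.countP A := by
  induction l using List.reverseRecOn with
  | nil => simp
  | append_singleton l a ih =>
    rw [List.length_append, List.length_singleton, hits_succ, List.countP_append, ← ih]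
    congr 1
    · exact hits_congr fun u hu => List.getD_append _ _ _ _ hu
    · simp

/-- Register `35` gets a random active red point which is likely to be of medium height. -/
def choosePivot : Prog := samplePivots ⨟ medianOfSample

/-- At least a quarter of the entries of `H` is not above `v`, and at least a quarter is not
below `v`. -/
def GoodPivot (ν : ℕ → ℝ) (H : List ℕ) (ℓ v : ℕ) : Prop :=
  ℓ ≤ hits (fun h => ν h ≤ ν v) (fun i => H.getD i 0) H.length ∧
    ℓ ≤ hits (fun h => ν v ≤ ν h) (fun i => H.getD i 0) H.length

theorem hits_mono {A B : ℕ → Prop} (f : ℕ → ℕ) (n : ℕ) (h : ∀ u < n, A (f u) → B (f u)) :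
    hits A f n ≤ hits B f n := by
  refine sum_le_sum fun u hu => ?_
  have := h u (mem_range.1 hu)
  split_ifs <;> first | omega | tauto

/-- Few entries have a property which says that few entries are not above them. -/
theorem hits_hits_lt (ν : ℕ → ℝ) (f : ℕ → ℕ)
    (n : ℕ) {ℓ : ℕ} (hℓ : 0 < ℓ) :
    hits (fun y => hits (fun h => ν h ≤ ν y) f n < ℓ) f n < ℓ := by
  set A : ℕ → Prop := fun y => hits (fun h => ν h ≤ ν y) f n < ℓ with hA
  classical
  by_cases h0 : ((range n).filter fun u => A (f u)).Nonempty
  -- The highest entry with the property: all others with it are counted among the fewer than `ℓ`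
  -- entries which are not above this one.
  · obtain ⟨u, hu, hu'⟩ := exists_max_image _ (fun u => ν (f u)) h0
    obtain ⟨hu1, hu2⟩ := mem_filter.1 hu
    refine lt_of_le_of_lt ?_ hu2
    refine hits_mono _ _ fun x hx hx' => ?_
    exact hu' x (mem_filter.2 ⟨mem_range.2 hx, hx'⟩)
  · have : hits A f n = 0 := by
      by_contra h
      obtain ⟨u, hu, hu'⟩ := exists_of_hits_pos (Nat.pos_of_ne_zero h)
      exact h0 ⟨u, mem_filter.2 ⟨mem_range.2 hu, hu'⟩⟩
    omega

open Classical in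
theorem choosePivot_triple_aux (hM : M ≤ 2 ^ w) {d : ℕ} {H : List ℕ} (h4 : s.reg 4 = H.length)
    (hd : 0 < d) (h3 : s.reg 3 = d) (hH : s.Holds 3 H) (hH0 : H ≠ [])
    (hHM : 64 * H.length + 64 < M)
    (hNM : 64 * N + 64 ≤ M) (hdM : 64 * d + 64 ≤ M) (hHN : ∀ h ∈ H, h < N)
    (hcmp : ∀ a < 2 * N, ∀ b < 2 * N, compareInput input a b = if ν a < ν b then 1 else 0)
    (A B : ℕ → Prop) (p : ℕ → ℕ → ℕ → ℝ≥0∞)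
    (hp : ∀ m a b, ∑ i ∈ range H.length, p m (a + if A (H.getD i 0) then 1 else 0)
      (b + if B (H.getD i 0) then 1 else 0) ≤ H.length * p (m + 1) a b)
    (hF : ∀ s', s.Same s' → ∀ f u, (∀ u < d, f u ∈ H) → u < d → s'.reg 35 = f u →
      IsMedian ν f d u → F s' ≤ p 0 (hits A f d) (hits B f d)) :
    Triple w input choosePivot (300 * d * d) s (p d 0 0) F := by
  have hdd : d ≤ d * d := Nat.le_mul_self d
  refine .seq (samplePivots_triple hM h4 h3 hH hH0 hHM hdM (fun h hh => by
    have := hHN h hh; omega) A B p hp fun s' hs hf => ?_) (m := 200 * d * d)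
    (by rw [mul_assoc, mul_assoc]; omega)
  refine (medianOfSample_triple hM hd (by rw [hs.1 3 (by norm_num), h3]) hNM hdM hcmp
    (fun _ _ => rfl) (fun u hu => hHN _ (hf u hu)) fun s'' hs' hu => ?_).bestBound_le
  obtain ⟨u, hu, hu', hmed⟩ := hu
  exact hF s'' (hs.trans hs') _ u hf hu hu' hmed

/-- A constant potential gives what holds for every outcome of the draws: time and membership in the
active set. It is used where only safety matters. -/
theorem choosePivot_triple_one (hM : M ≤ 2 ^ w) {d : ℕ} {H : List ℕ} (h4 : s.reg 4 = H.length)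
    (hd : 0 < d) (h3 : s.reg 3 = d) (hH : s.Holds 3 H) (hH0 : H ≠ [])
    (hHM : 64 * H.length + 64 < M)
    (hNM : 64 * N + 64 ≤ M) (hdM : 64 * d + 64 ≤ M) (hHN : ∀ h ∈ H, h < N)
    (hcmp : ∀ a < 2 * N, ∀ b < 2 * N, compareInput input a b = if ν a < ν b then 1 else 0)
    (hF : ∀ s', s.Same s' → s'.reg 35 ∈ H → F s' ≤ c) :
    Triple w input choosePivot (300 * d * d) s c F := by
  refine choosePivot_triple_aux (p := fun _ _ _ => c) (A := fun _ => True) (B := fun _ => True)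
    hM h4 hd h3 hH hH0 hHM hNM hdM hHN hcmp (fun m a b => ?_)
    fun s' hs f u hf hu h35 hmed => hF s' hs (h35 ▸ hf u hu)
  simp

open Classical in
-- One step of a Chernoff bound with base `3`: if a hit has probability at most `1 / 4`, the factor
-- `3 ^ hit` has mean at most `1 + 2 / 4`.
theorem sum_three_pow_le (A : ℕ → Prop) (f : ℕ → ℕ) (n a : ℕ)
    (h : 4 * hits A f n ≤ n) :
    ∑ i ∈ range n, (3 : ℝ) ^ (a + if A (f i) then 1 else 0) ≤ n * (3 / 2 * 3 ^ a) := by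
  have h1 : ∀ i, (3 : ℝ) ^ (a + if A (f i) then 1 else 0) =
      3 ^ a * (1 + 2 * ((if A (f i) then 1 else 0 : ℕ) : ℝ)) := by
    intro i
    split_ifs
    · rw [pow_succ]; push_cast; ring
    · simp
  have h2 : (∑ i ∈ range n, ((if A (f i) then 1 else 0 : ℕ) : ℝ)) = hits A f n := by
    rw [hits]
    push_cast
    exact sum_congr rfl fun _ _ => by congr
  simp only [h1]
  rw [← mul_sum, sum_add_distrib, ← mul_sum, h2]
  have h3 : (4 : ℝ) * hits A f n ≤ n := by exact_mod_cast h
  have h4 : (0 : ℝ) < 3 ^ a := by positivity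
  simp only [sum_const, card_range, nsmul_eq_mul, mul_one]
  nlinarith

/-- A median which is too low forces `e` of the `2 * e` samples into the set `A` of entries that are
themselves too low, which has density below `1 / 4`; likewise for too high and `B`. Each of the two
events has probability at most `(3 / 2) ^ (2 * e) / 3 ^ e = (3 / 4) ^ e`. -/
theorem choosePivot_triple (hM : M ≤ 2 ^ w) {e ℓ : ℕ} {H : List ℕ} (h4 : s.reg 4 = H.length)
    (he : 0 < e) (hℓ : 0 < ℓ) (hHℓ : H.length = 4 * ℓ) (h3 : s.reg 3 = 2 * e) (hH : s.Holds 3 H)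
    (hHM : 64 * H.length + 64 < M)
    (hNM : 64 * N + 64 ≤ M) (hdM : 64 * (2 * e) + 64 ≤ M) (hHN : ∀ h ∈ H, h < N)
    (hcmp : ∀ a < 2 * N, ∀ b < 2 * N, compareInput input a b = if ν a < ν b then 1 else 0)
    (hF1 : ∀ s', s.Same s' → s'.reg 35 ∈ H → F s' ≤ 1)
    (hF : ∀ s', s.Same s' → s'.reg 35 ∈ H → GoodPivot ν H ℓ (s'.reg 35) → F s' ≤ c) :
    Triple w input choosePivot (300 * (2 * e) * (2 * e)) s
      (c + ENNReal.ofReal (2 * (3 / 4) ^ e)) F := by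
  classical
  have hH0 : H ≠ [] := by rintro rfl; simp at hHℓ; omega
  set A : ℕ → Prop := fun y => hits (fun h => ν h ≤ ν y) (fun i => H.getD i 0) H.length < ℓ with hA
  set B : ℕ → Prop := fun y => hits (fun h => ν y ≤ ν h) (fun i => H.getD i 0) H.length < ℓ with hB
  have hA4 : 4 * hits A (fun i => H.getD i 0) H.length ≤ H.length := by
    have := hits_hits_lt ν (fun i => H.getD i 0) H.length hℓ
    simp only [← hA] at this
    omega
  have hB4 : 4 * hits B (fun i => H.getD i 0) H.length ≤ H.length := by
    have := hits_hits_lt (fun y => -ν y) (fun i => H.getD i 0) H.length hℓ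
    simp only [neg_le_neg_iff, ← hB] at this
    omega
  let p : ℕ → ℕ → ℕ → ℝ≥0∞ := fun m a b =>
    c + ENNReal.ofReal (((3 / 2) ^ m * (3 ^ a + 3 ^ b)) / 3 ^ e)
  have hp0 : p (2 * e) 0 0 = c + ENNReal.ofReal (2 * (3 / 4) ^ e) := by
    simp only [p]
    congr 2
    rw [pow_mul, pow_zero, mul_comm, mul_div_assoc, ← div_pow]
    norm_num
  rw [← hp0]
  refine choosePivot_triple_aux hM h4 (by omega) h3 hH hH0 hHM hNM hdM hHN hcmp A B p
    (fun m a b => ?_) fun s' hs f u hf hu h35 hmed => ?_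
  · simp only [p]
    rw [sum_add_distrib, mul_add]
    refine add_le_add (by simp) ?_
    rw [← ENNReal.ofReal_sum_of_nonneg (fun i _ => by positivity), ← ENNReal.ofReal_natCast,
      ← ENNReal.ofReal_mul (by positivity)]
    refine ENNReal.ofReal_le_ofReal ?_
    have h1 := sum_three_pow_le A (fun i => H.getD i 0) H.length a hA4
    have h2 := sum_three_pow_le B (fun i => H.getD i 0) H.length b hB4
    rw [← sum_div, ← mul_sum, sum_add_distrib, ← mul_div_assoc]
    refine div_le_div_of_nonneg_right ?_ (by positivity)
    refine (mul_le_mul_of_nonneg_left (add_le_add h1 h2) (by positivity)).trans (le_of_eq ?_)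
    rw [pow_succ]
    ring
  · by_cases hg : GoodPivot ν H ℓ (s'.reg 35)
    · exact (hF s' hs (h35 ▸ hf u hu) hg).trans le_self_add
    · refine (hF1 s' hs (h35 ▸ hf u hu)).trans (le_add_left ?_)
      -- At least half of the sample is not above the median, and whatever is not above a low entry
      -- is low as well.
      have h1 : e ≤ hits A f (2 * e) ∨ e ≤ hits B f (2 * e) := by
        rw [GoodPivot, not_and_or, not_le, not_le, h35] at hg
        rcases hg with hg | hg
        · left
          have g1 := le_hits_add_hits (A := fun y => ν y ≤ ν (f u)) (B := fun y => ν (f u) < ν y)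
            f (2 * e) fun y => le_or_gt _ _
          have g2 : hits (fun y => ν y ≤ ν (f u)) f (2 * e) ≤ hits A f (2 * e) :=
            hits_mono _ _ fun x hx hx' => lt_of_le_of_lt
              (hits_mono (A := fun y => ν y ≤ ν _) _ _ fun y hy (hy' : ν _ ≤ ν _) => hy'.trans hx') hg
          have := hmed.2
          omega
        · right
          have g1 := le_hits_add_hits (A := fun y => ν (f u) ≤ ν y) (B := fun y => ν y < ν (f u))
            f (2 * e) fun y => le_or_gt _ _
          have g2 : hits (fun y => ν (f u) ≤ ν y) f (2 * e) ≤ hits B f (2 * e) :=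
            hits_mono _ _ fun x hx hx' => lt_of_le_of_lt
              (hits_mono (A := fun y => ν _ ≤ ν y) _ _ fun y hy (hy' : ν _ ≤ ν _) => hx'.trans hy') hg
          have := hmed.1
          omega
      rw [← ENNReal.ofReal_one]
      refine ENNReal.ofReal_le_ofReal ?_
      rw [pow_zero, one_mul, le_div_iff₀ (by positivity), one_mul]
      have h3a : (0 : ℝ) < 3 ^ hits A f (2 * e) := by positivity
      have h3b : (0 : ℝ) < 3 ^ hits B f (2 * e) := by positivity
      rcases h1 with h1 | h1
      · have := pow_le_pow_right₀ (show (1 : ℝ) ≤ 3 by norm_num) h1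
        linarith
      · have := pow_le_pow_right₀ (show (1 : ℝ) ≤ 3 by norm_num) h1
        linarith

end

/-! ### Safe and likely invariants of the sweep -/

section

variable {N : ℕ} {ν : ℕ → ℝ}

/-! ### Invariants of the sweep -/

namespace Instance

variable (I : Instance N ν)

/-- The number of blue points from number `x` on which are below the point with position `v`. -/
def below (x v : ℕ) : ℕ := #{b ∈ Ico x I.nb | ν (I.bp b) < ν v}

open Classical in
/-- The red points before position `i` which take part. -/
def reds (i : ℕ) : List ℕ := (List.range i).filter fun i => I.red i

/-- The number of pairs. -/
def total : ℕ := ((I.reds (N - 1)).map fun h => I.below (I.cb h) h).sum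

variable {I}

theorem below_mono {x x' v v' : ℕ} (hx : x' ≤ x) (hv : ν v ≤ ν v') :
    I.below x v ≤ I.below x' v' := by
  refine card_le_card fun b hb => ?_
  simp only [mem_filter, mem_Ico] at hb ⊢
  exact ⟨⟨hx.trans hb.1.1, hb.1.2⟩, hb.2.trans_le hv⟩

theorem mem_reds {i h : ℕ} : h ∈ I.reds i ↔ h < i ∧ I.red h := by
  simp [reds]

theorem reds_succ_of_not {i : ℕ} (h : ¬ I.red i) : I.reds (i + 1) = I.reds i := by
  simp [reds, List.range_succ, h]

theorem reds_succ {i : ℕ} (h : I.red i) : I.reds (i + 1) = I.reds i ++ [i] := by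
  simp [reds, List.range_succ, h]

theorem reds_prefix {i j : ℕ} (h : i ≤ j) : I.reds i <+: I.reds j := by
  refine List.IsPrefix.filter _ ?_
  obtain ⟨k, rfl⟩ := Nat.exists_eq_add_of_le h
  rw [List.range_add]
  exact List.prefix_append _ _

theorem sum_below_le_total {i : ℕ} (hi : i ≤ N - 1) :
    ((I.reds i).map fun h => I.below (I.cb h) h).sum ≤ I.total := by
  obtain ⟨l, hl⟩ := reds_prefix (I := I) hi
  rw [total, ← hl, List.map_append, List.sum_append]
  exact Nat.le_add_right _ _

end Instance

namespace Sweep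

/-- Invariants which hold for every outcome of the random choices. -/
structure Safe (σ : Sweep) (I : Instance N ν) (ℓ₀ i : ℕ) : Prop where
  ℓ_pos : 0 < σ.ℓ
  -- A doubling needs `4 * ℓ` active red points, hence `4 * ℓ ≤ N` before it.
  ℓ_le : σ.ℓ = ℓ₀ ∨ 2 * σ.ℓ ≤ N
  le_ℓ : ℓ₀ ≤ σ.ℓ
  length_H_le : σ.H.length ≤ 4 * σ.ℓ
  length_le : σ.H.length + σ.G.length ≤ i
  H_lt : ∀ h ∈ σ.H, h < i
  G_lt : ∀ e ∈ σ.G, e.1 < i ∧ e.2 ≤ I.nb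
  L_length_le : σ.L.length ≤ i
  L_lt : ∀ l ∈ σ.L, l.1 < i ∧ l.2.1 ≤ I.nb ∧ l.2.2 ≤ σ.G.length

/-- Invariants which are likely to hold. -/
structure Good (σ : Sweep) (I : Instance N ν) (ℓ₀ i : ℕ) : Prop where
  perm : (σ.H ++ σ.G.map fun e => e.1).Perm (I.reds i)
  above : ∀ l ∈ σ.L.getLast?, ∀ h ∈ σ.H, ν l.1 < ν h
  sorted : σ.L.Pairwise fun l l' => ν l.1 ≤ ν l'.1 ∧ l.2.1 ≤ l'.2.1 ∧ l.2.2 ≤ l'.2.2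
  reached : ∀ l ∈ σ.L, ∃ i' < i, l.2.1 = I.cb i'
  -- A finished red point belongs to the last level which was made before or when it was finished;
  -- it was finished no earlier than that level's blue position and lies at or below its threshold.
  group : ∀ (e : ℕ) (he : e < σ.G.length), ∃ (s : ℕ) (hs : s < σ.L.length),
    σ.L[s].2.2 ≤ e ∧ (∀ (s' : ℕ) (hs' : s' < σ.L.length), s < s' → e < σ.L[s'].2.2) ∧
      σ.L[s].2.1 ≤ σ.G[e].2 ∧ ν σ.G[e].1 ≤ ν σ.L[s].1
  range : ∀ e ∈ σ.G, I.cb e.1 ≤ e.2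
  -- At most `4 * ℓ` red points are active while any one blue point is passed. The form with a free
  -- `y` beyond all positions reached allows the sweep line to advance.
  mass : ∀ y, (∀ i' < i, I.cb i' ≤ y) →
    (σ.G.map fun e => e.2 - I.cb e.1).sum + (σ.H.map fun h => y - I.cb h).sum ≤ 4 * σ.ℓ * y
  below_le : ∀ l ∈ σ.L, I.below l.2.1 l.1 ≤ 2 * σ.ℓ
  -- A level adds at most `2 * ℓ` incidences with blue points and finishes at least `ℓ` red points.
  -- Thus the levels have linearly many incidences, which pays for walking through them.
  sum_below_le : (σ.L.map fun l => I.below l.2.1 l.1).sum ≤ 2 * σ.G.length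
  -- A doubled scale is certified by a quadratic number of pairs.
  scale : σ.ℓ = ℓ₀ ∨ σ.ℓ * σ.ℓ ≤ 8 * I.total

variable {σ : Sweep} {I : Instance N ν} {ℓ₀ i : ℕ}

/-- A red point becomes active. -/
def push (σ : Sweep) (h : ℕ) : Sweep := { σ with H := σ.H ++ [h] }

/-- A red point is finished. -/
def emit (σ : Sweep) (h x : ℕ) : Sweep := { σ with G := σ.G ++ [(h, x)] }

/-- The scale is doubled. -/
def grow (σ : Sweep) : Sweep := { σ with ℓ := σ.ℓ * 2 }

/-- A new level is made, and the active red points which are not above it are finished. -/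
def cut (σ : Sweep) (ν : ℕ → ℝ) (v x : ℕ) : Sweep where
  ℓ := σ.ℓ
  -- After a bad pivot too many points may remain; they are then discarded, which spoils the count
  -- but keeps the time bound unconditional. A good pivot never triggers this.
  H := if 3 * σ.ℓ < (σ.H.filter fun h => ν v < ν h).length then [] else
    σ.H.filter fun h => ν v < ν h
  G := σ.G ++ (σ.H.filter fun h => ¬ ν v < ν h).map fun h => (h, x)
  L := σ.L ++ [(v, x, σ.G.length)]

theorem Safe.succ (h : σ.Safe I ℓ₀ i) : σ.Safe I ℓ₀ (i + 1) where
  ℓ_pos := h.ℓ_pos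
  ℓ_le := h.ℓ_le
  le_ℓ := h.le_ℓ
  length_H_le := h.length_H_le
  length_le := h.length_le.trans (Nat.le_succ i)
  H_lt := fun x hx => (h.H_lt x hx).trans (Nat.lt_succ_self i)
  G_lt := fun x hx => ⟨(h.G_lt x hx).1.trans (Nat.lt_succ_self i), (h.G_lt x hx).2⟩
  L_length_le := h.L_length_le.trans (Nat.le_succ i)
  L_lt := fun x hx => ⟨(h.L_lt x hx).1.trans (Nat.lt_succ_self i), (h.L_lt x hx).2⟩

theorem Safe.push (h : σ.Safe I ℓ₀ i) (hl : σ.H.length < 4 * σ.ℓ) :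
    (σ.push i).Safe I ℓ₀ (i + 1) where
  ℓ_pos := h.ℓ_pos
  ℓ_le := h.ℓ_le
  le_ℓ := h.le_ℓ
  length_H_le := by simpa [Sweep.push] using hl
  length_le := by
    have := h.length_le
    simp [Sweep.push]; omega
  H_lt := fun x hx => by
    simp only [Sweep.push, List.mem_append, List.mem_singleton] at hx
    rcases hx with hx | rfl
    · exact h.succ.H_lt x hx
    · exact Nat.lt_succ_self _
  G_lt := h.succ.G_lt
  L_length_le := h.succ.L_length_le
  L_lt := h.succ.L_lt

theorem Safe.emit (h : σ.Safe I ℓ₀ i) (hi : i < N) :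
    (σ.emit i (I.cb i)).Safe I ℓ₀ (i + 1) where
  ℓ_pos := h.ℓ_pos
  ℓ_le := h.ℓ_le
  le_ℓ := h.le_ℓ
  length_H_le := h.length_H_le
  length_le := by
    have := h.length_le
    simp [Sweep.emit]; omega
  H_lt := h.succ.H_lt
  G_lt := fun x hx => by
    simp only [Sweep.emit, List.mem_append, List.mem_singleton] at hx
    rcases hx with hx | rfl
    · exact h.succ.G_lt x hx
    · exact ⟨Nat.lt_succ_self _, I.cb_le i hi⟩
  L_length_le := h.succ.L_length_le
  L_lt := fun x hx => by
    obtain ⟨h1, h2, h3⟩ := h.succ.L_lt x hx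
    exact ⟨h1, h2, by simp [Sweep.emit]; omega⟩

theorem Safe.grow (h : σ.Safe I ℓ₀ i) (hl : 4 * σ.ℓ ≤ N) : σ.grow.Safe I ℓ₀ i where
  ℓ_pos := by have := h.ℓ_pos; simp [Sweep.grow]; omega
  ℓ_le := by right; simp [Sweep.grow]; omega
  le_ℓ := by have := h.le_ℓ; simp [Sweep.grow]; omega
  length_H_le := by have := h.length_H_le; simp [Sweep.grow]; omega
  length_le := h.length_le
  H_lt := h.H_lt
  G_lt := h.G_lt
  L_length_le := h.L_length_le
  L_lt := h.L_lt

theorem length_filter_add (l : List ℕ) (p : ℕ → Prop) [DecidablePred p] :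
    (l.filter fun h => p h).length + (l.filter fun h => ¬ p h).length = l.length := by
  rw [← List.countP_eq_length_filter, ← List.countP_eq_length_filter]
  simpa using (List.length_eq_countP_add_countP (fun h => decide (p h)) (l := l)).symm

theorem Safe.cut (h : σ.Safe I ℓ₀ i) {v x : ℕ} (hv : v ∈ σ.H) (hx : x ≤ I.nb)
    (hL : σ.L.length < i) : (σ.cut ν v x).Safe I ℓ₀ i where
  ℓ_pos := h.ℓ_pos
  ℓ_le := h.ℓ_le
  le_ℓ := h.le_ℓ
  length_H_le := by
    simp only [Sweep.cut]
    split_ifs <;> simp at * <;> omega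
  length_le := by
    have h1 := h.length_le
    have h2 := length_filter_add σ.H fun h => ν v < ν h
    simp only [Sweep.cut, List.length_append, List.length_map]
    split_ifs
    · simp only [List.length_nil]
      omega
    · omega
  H_lt := fun y hy => by
    simp only [Sweep.cut] at hy
    split_ifs at hy
    · simp at hy
    · exact h.H_lt y (List.mem_of_mem_filter hy)
  G_lt := fun y hy => by
    simp only [Sweep.cut, List.mem_append, List.mem_map] at hy
    rcases hy with hy | ⟨y, hy, rfl⟩
    · exact h.G_lt y hy
    · exact ⟨h.H_lt y (List.mem_of_mem_filter hy), hx⟩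
  L_length_le := by simpa [Sweep.cut] using hL
  L_lt := fun y hy => by
    simp only [Sweep.cut, List.mem_append, List.mem_singleton] at hy
    rcases hy with hy | rfl
    · obtain ⟨h1, h2, h3⟩ := h.L_lt y hy
      exact ⟨h1, h2, by simp [Sweep.cut]; omega⟩
    · exact ⟨h.H_lt v hv, hx, by simp [Sweep.cut]⟩

theorem Good.succ (h : σ.Good I ℓ₀ i) (hi : ¬ I.red i) : σ.Good I ℓ₀ (i + 1) where
  perm := by rw [Instance.reds_succ_of_not hi]; exact h.perm
  above := h.above
  sorted := h.sorted
  reached := fun l hl => by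
    obtain ⟨i', hi', e⟩ := h.reached l hl
    exact ⟨i', by omega, e⟩
  group := h.group
  range := h.range
  mass := fun y hy => h.mass y fun i' hi' => hy i' (by omega)
  below_le := h.below_le
  sum_below_le := h.sum_below_le
  scale := h.scale

theorem sum_sub_le (l : List ℕ) (f : ℕ → ℕ) {y z : ℕ} (hyz : y ≤ z) :
    (l.map fun h => z - f h).sum ≤ (l.map fun h => y - f h).sum + l.length * (z - y) := by
  induction l with
  | nil => simp
  | cons a l ih =>
    simp only [List.map_cons, List.sum_cons, List.length_cons, Nat.succ_mul]
    omega

theorem Good.push (h : σ.Good I ℓ₀ i) (hi : I.red i) (hl : σ.H.length < 4 * σ.ℓ)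
    (ha : ∀ l ∈ σ.L.getLast?, ν l.1 < ν i) : (σ.push i).Good I ℓ₀ (i + 1) where
  perm := by
    rw [Instance.reds_succ hi]
    refine List.Perm.trans ?_ (h.perm.append_right [i])
    simp only [Sweep.push, List.append_assoc]
    exact List.Perm.append_left _ List.perm_append_comm
  above := fun l hl y hy => by
    simp only [Sweep.push, List.mem_append, List.mem_singleton] at hy hl
    rcases hy with hy | rfl
    · exact h.above l hl y hy
    · exact ha l hl
  sorted := h.sorted
  reached := fun l hl => by
    obtain ⟨i', hi', e⟩ := h.reached l hl
    exact ⟨i', by omega, e⟩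
  group := h.group
  range := h.range
  mass := fun y hy => by
    -- Use the old bound at the current position; between there and `y` each of the at most `4 * ℓ`
    -- active points contributes `y - I.cb i`.
    have h1 := h.mass (I.cb i) fun i' hi' => I.cb_mono hi'.le
    have h2 := sum_sub_le σ.H I.cb (hy i (Nat.lt_succ_self i))
    simp only [Sweep.push, List.map_append, List.sum_append, List.map_cons, List.map_nil,
      List.sum_cons, List.sum_nil, add_zero]
    obtain ⟨k, hk⟩ := Nat.exists_eq_add_of_le (hy i (Nat.lt_succ_self i))
    rw [hk] at h2 ⊢
    rw [Nat.add_sub_cancel_left] at h2 ⊢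
    have h3 : (σ.H.length + 1) * k ≤ 4 * σ.ℓ * k := Nat.mul_le_mul_right _ hl
    rw [mul_add]
    rw [add_mul, one_mul] at h3
    omega
  below_le := h.below_le
  sum_below_le := h.sum_below_le
  scale := h.scale

/-- The point joins the group of the last level, as it lies at or below the threshold. It is
finished at its own starting position, so it adds no direct candidates. -/
theorem Good.emit (h : σ.Good I ℓ₀ i) (hi : I.red i) {l : ℕ × ℕ × ℕ} (hl : σ.L.getLast? = some l)
    (ha : ν i ≤ ν l.1) (hL : ∀ l ∈ σ.L, l.2.2 ≤ σ.G.length) :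
    (σ.emit i (I.cb i)).Good I ℓ₀ (i + 1) where
  perm := by
    rw [Instance.reds_succ hi]
    refine List.Perm.trans ?_ (h.perm.append_right [i])
    simp [Sweep.emit]
  above := h.above
  sorted := h.sorted
  reached := fun l hl => by
    obtain ⟨i', hi', e⟩ := h.reached l hl
    exact ⟨i', by omega, e⟩
  group := fun e he => by
    simp only [Sweep.emit, List.length_append, List.length_singleton] at he ⊢
    rcases (Nat.lt_succ_iff.1 he).eq_or_lt with rfl | he
    · have h0 : σ.L ≠ [] := by rintro h0; simp [h0] at hl
      have hpos := List.length_pos_of_ne_nil h0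
      have hlast : σ.L[σ.L.length - 1] = l := by
        rw [List.getLast?_eq_getElem?, List.getElem?_eq_getElem (by omega)] at hl
        exact Option.some.inj hl
      refine ⟨σ.L.length - 1, by omega, hL _ (List.getElem_mem _), fun s' hs' h' => by omega,
        ?_, ?_⟩
      · obtain ⟨i', hi', e'⟩ := h.reached _ (List.getElem_mem (show σ.L.length - 1 < _ by omega))
        rw [e']
        simpa using I.cb_mono hi'.le
      · simpa [hlast] using ha
    · obtain ⟨s, hs, h1, h2, h3, h4⟩ := h.group e he
      exact ⟨s, hs, h1, h2, by simpa [List.getElem_append, he] using h3,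
        by simpa [List.getElem_append, he] using h4⟩
  range := fun e he => by
    simp only [Sweep.emit, List.mem_append, List.mem_singleton] at he
    rcases he with he | rfl
    · exact h.range e he
    · exact le_rfl
  mass := fun y hy => by
    have := h.mass y fun i' hi' => hy i' (by omega)
    simpa [Sweep.emit] using this
  below_le := h.below_le
  sum_below_le := h.sum_below_le.trans (by simp [Sweep.emit])
  scale := h.scale

/-- At least `ℓ` active red points lie at or above `v`, and each of them has the at least `ℓ / 2`
remaining blue points below `v` as partners. So `ℓ ^ 2 ≤ 2 * I.total`, which is the scale condition
for `2 * ℓ`. -/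
theorem Good.grow (h : σ.Good I ℓ₀ i) (hi : i ≤ N - 1) {x v : ℕ} (hx : ∀ h ∈ σ.H, I.cb h ≤ x)
    (hv : σ.ℓ ≤ (σ.H.filter fun h => ν v ≤ ν h).length) (hb : σ.ℓ ≤ 2 * I.below x v) :
    σ.grow.Good I ℓ₀ i where
  perm := h.perm
  above := h.above
  sorted := h.sorted
  reached := h.reached
  group := h.group
  range := h.range
  mass := fun y hy => (h.mass y hy).trans (by
    simp only [Sweep.grow]
    exact Nat.mul_le_mul_right _ (by omega))
  below_le := fun l hl => (h.below_le l hl).trans (by simp [Sweep.grow]; omega)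
  sum_below_le := h.sum_below_le
  scale := by
    right
    have h1 : (σ.H.filter fun h => ν v ≤ ν h).length * I.below x v ≤
        ((σ.H.filter fun h => ν v ≤ ν h).map fun h => I.below (I.cb h) h).sum := by
      have := List.card_nsmul_le_sum
        ((σ.H.filter fun h => ν v ≤ ν h).map fun h => I.below (I.cb h) h) (I.below x v) (by
        intro y hy
        obtain ⟨z, hz, rfl⟩ := List.mem_map.1 hy
        obtain ⟨hz1, hz2⟩ := List.mem_filter.1 hz
        exact Instance.below_mono (hx z hz1) (by simpa using hz2))
      simpa using this
    have h2 : ((σ.H.filter fun h => ν v ≤ ν h).map fun h => I.below (I.cb h) h).sum ≤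
        (σ.H.map fun h => I.below (I.cb h) h).sum :=
      List.Sublist.sum_le_sum (List.filter_sublist.map _) (fun _ _ => Nat.zero_le _)
    have h3 : (σ.H.map fun h => I.below (I.cb h) h).sum ≤ I.total := by
      refine le_trans ?_ (Instance.sum_below_le_total hi)
      rw [← (h.perm.map fun h => I.below (I.cb h) h).sum_eq, List.map_append, List.sum_append]
      exact Nat.le_add_right _ _
    have h4 : σ.ℓ * I.below x v ≤ I.total :=
      (Nat.mul_le_mul_right _ hv).trans (h1.trans (h2.trans h3))
    have h5 : σ.ℓ * σ.ℓ ≤ σ.ℓ * (2 * I.below x v) := Nat.mul_le_mul_left _ hb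
    simp only [Sweep.grow]
    nlinarith

/-- At least `ℓ` of the `4 * ℓ` active points are finished, so the rest need not be discarded and
the new incidences are paid for at rate two. The red points finished here form the initial segment
of the new group. -/
theorem Good.cut (h : σ.Good I ℓ₀ i) (hs : σ.Safe I ℓ₀ i) {v i' : ℕ} (hi' : i' < i)
    (hmax : ∀ j < i, I.cb j ≤ I.cb i') (hvH : v ∈ σ.H) (hl : σ.H.length = 4 * σ.ℓ)
    (hv : σ.ℓ ≤ (σ.H.filter fun h => ν h ≤ ν v).length) (hb : I.below (I.cb i') v ≤ 2 * σ.ℓ) :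
    (σ.cut ν v (I.cb i')).Good I ℓ₀ i := by
  have hlen := length_filter_add σ.H fun h => ν v < ν h
  have hneg : (σ.H.filter fun h => ν h ≤ ν v) = σ.H.filter fun h => ¬ ν v < ν h := by
    simp
  rw [hneg] at hv
  have hH : (σ.cut ν v (I.cb i')).H = σ.H.filter fun h => ν v < ν h := by
    simp only [Sweep.cut]
    rw [if_neg (by omega)]
  have hG : (σ.cut ν v (I.cb i')).G.length =
      σ.G.length + (σ.H.filter fun h => ¬ ν v < ν h).length := by
    simp [Sweep.cut]
  have hsum : ∀ f : ℕ → ℕ, ((σ.H.filter fun h => ν v < ν h).map f).sum +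
      ((σ.H.filter fun h => ¬ ν v < ν h).map f).sum = (σ.H.map f).sum := by
    intro f
    have := (List.filter_append_perm (fun h => decide (ν v < ν h)) σ.H).map f
    rw [← this.sum_eq, List.map_append, List.sum_append]
    simp only [decide_not]
  constructor
  · rw [hH]
    refine List.Perm.trans ?_ h.perm
    simp only [Sweep.cut, List.map_append, List.map_map]
    have h1 : (σ.H.filter fun h => ¬ ν v < ν h).map ((fun e : ℕ × ℕ => e.1) ∘
        fun h => (h, I.cb i')) = σ.H.filter fun h => ¬ ν v < ν h := by
      rw [show ((fun e : ℕ × ℕ => e.1) ∘ fun h : ℕ => (h, I.cb i')) = id from rfl, List.map_id]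
    rw [h1]
    have h2 := List.filter_append_perm (fun h => decide (ν v < ν h)) σ.H
    refine List.Perm.trans ?_ (h2.append_right _)
    rw [List.append_assoc]
    refine List.Perm.append_left _ ?_
    refine List.perm_append_comm.trans ?_
    simp only [decide_not]
    exact List.Perm.refl _
  · intro l hl y hy
    rw [hH] at hy
    simp only [Sweep.cut, List.getLast?_append, List.getLast?_singleton, Option.some_or,
      Option.mem_def, Option.some.injEq] at hl
    subst hl
    simpa using (List.mem_filter.1 hy).2
  · simp only [Sweep.cut]
    rw [List.pairwise_append]
    refine ⟨h.sorted, by simp, fun l hl l' hl' => ?_⟩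
    rw [List.mem_singleton] at hl'
    subst hl'
    refine ⟨?_, ?_, (hs.L_lt l hl).2.2⟩
    · have h0 : σ.L ≠ [] := by rintro h0; simp [h0] at hl
      -- The pivot is active and hence above the previous threshold: thresholds increase.
      have h1 := h.above (σ.L.getLast h0) (List.getLast?_eq_some_getLast h0) v hvH
      refine le_trans ?_ h1.le
      have h2 := h.sorted
      rw [← List.dropLast_append_getLast h0] at hl h2
      rcases List.mem_append.1 hl with hl | hl
      · exact ((List.pairwise_append.1 h2).2.2 l hl _ (by simp)).1
      · rw [List.mem_singleton] at hl
        rw [hl]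
    · obtain ⟨j, hj, e⟩ := h.reached l hl
      rw [e]
      exact hmax j hj
  · intro l hl
    simp only [Sweep.cut, List.mem_append, List.mem_singleton] at hl
    rcases hl with hl | rfl
    · exact h.reached l hl
    · exact ⟨i', hi', rfl⟩
  · intro e he
    by_cases he' : e < σ.G.length
    · obtain ⟨s, hs', h1, h2, h3, h4⟩ := h.group e he'
      refine ⟨s, by simp [Sweep.cut]; omega, ?_, fun s' hs'' hss' => ?_, ?_, ?_⟩
      · simpa [Sweep.cut, List.getElem_append, hs'] using h1
      · simp only [Sweep.cut, List.getElem_append]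
        split_ifs with h5
        · exact h2 s' h5 hss'
        · simpa using he'
      · simpa [Sweep.cut, List.getElem_append, hs', he'] using h3
      · simpa [Sweep.cut, List.getElem_append, hs', he'] using h4
    · refine ⟨σ.L.length, by simp [Sweep.cut], ?_, fun s' hs'' hss' => ?_, ?_, ?_⟩
      · simpa [Sweep.cut] using he'
      · simp [Sweep.cut] at hs''; omega
      · simp [Sweep.cut, List.getElem_append, he']
      · have h5 : e - σ.G.length < (σ.H.filter fun h => ¬ ν v < ν h).length := by omega
        have h6 := List.getElem_mem h5
        simpa [Sweep.cut, List.getElem_append, he'] using (List.mem_filter.1 h6).2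
  · intro e he
    simp only [Sweep.cut, List.mem_append, List.mem_map] at he
    rcases he with he | ⟨y, hy, rfl⟩
    · exact h.range e he
    · exact hmax y (hs.H_lt y (List.mem_of_mem_filter hy))
  · intro y hy
    refine le_trans ?_ (h.mass y hy)
    rw [hH, ← hsum fun h => y - I.cb h]
    simp only [Sweep.cut, List.map_append, List.sum_append, List.map_map]
    have : ((σ.H.filter fun h => ¬ ν v < ν h).map
        ((fun e : ℕ × ℕ => e.2 - I.cb e.1) ∘ fun h => (h, I.cb i'))).sum ≤
        ((σ.H.filter fun h => ¬ ν v < ν h).map fun h => y - I.cb h).sum :=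
      List.sum_le_sum fun z _ => Nat.sub_le_sub_right (hy i' hi') _
    omega
  · intro l hl
    simp only [Sweep.cut, List.mem_append, List.mem_singleton] at hl
    rcases hl with hl | rfl
    · exact h.below_le l hl
    · exact hb
  · rw [hG]
    have := h.sum_below_le
    simp only [Sweep.cut, List.map_append, List.sum_append, List.map_cons, List.map_nil,
      List.sum_cons, List.sum_nil, add_zero]
    omega
  · exact h.scale

end Sweep

end

/-! ### Estimating the number of blue points below the pivot -/

section

open Prog Operand

variable {w M : ℕ} {input : List ℝ} {N : ℕ} {ν : ℕ → ℝ} {s : State} {F : State → ℝ≥0∞} {c : ℝ≥0∞}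
variable {I : Instance N ν} {σ : Sweep} {d : ℕ}

/-! ### Elementary operations on the sweep -/

theorem Sweep.Rep.put (h : σ.Rep I d s) {x v : ℕ} (hx : 8 ≤ x) (hx' : x ≠ 10) :
    σ.Rep I d (s.put x v) := by
  have e : ∀ r, r < 8 ∨ r = 10 → (s.put x v).reg r = s.reg r := fun r hr => by
    rw [State.put_reg, if_neg (by omega)]
  obtain ⟨h0, h2, h3, h4, h5, h6, h7, h8, a3, a4, a5, a6, a7, a8⟩ := h
  rw [← e _ (by omega)] at h2 h3 h4 h5 h6 h7
  simp only [← e 10 (by omega)] at h8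
  exact ⟨(Instance.stored_put (by omega)).2 h0, h2, h3, h4, h5, h6, h7, h8, a3, a4, a5, a6, a7, a8⟩

/-- The red point in register `33` becomes active. -/
def pushRed : Prog := st 3 (reg 4) (reg 33) ⨟ add 4 (reg 4) (lit 1)

/-- The red point in register `33` is finished. -/
def finishRed : Prog :=
  ld 34 1 (reg 33) ⨟ sub 34 (reg 11) (reg 34) ⨟ add 7 (reg 7) (reg 34) ⨟
  st 4 (reg 5) (reg 33) ⨟ st 5 (reg 5) (reg 11) ⨟ add 5 (reg 5) (lit 1)

@[simp] theorem cost_pushRed : pushRed.cost = 7 := rfl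
@[simp] theorem cost_finishRed : finishRed.cost = 23 := rfl

theorem wlp_pushRed {cmp : ℕ → ℕ → ℕ} {Q : State → Prop} (hs : σ.Rep I d s)
    (hM : 16 * σ.H.length + 64 ≤ M) (hr : s.reg 33 < M)
    (hQ : ∀ s', (σ.push (s.reg 33)).Rep I d s' → (∀ r, 11 ≤ r → r ≠ 60 → s'.reg r = s.reg r) →
      (∀ k < 16, ∀ i, k ≠ 3 ∨ i ≠ σ.H.length → s'.arr k i = s.arr k i) → Q s') :
    pushRed.wlp M cmp Q s := by
  have h4 := hs.reg4
  have hlit : ∀ n ≤ 63, n < M := fun n hn => by omega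
  simp [pushRed, wlp_st, hlit, h4, hr]
  refine ⟨by omega, by omega, hQ _ ?_ ?_ ?_⟩
  · obtain ⟨h0, h2, h3, h4, h5, h6, h7, h8, a3, a4, a5, a6, a7, a8⟩ :=
      hs.put (x := 60) (v := 16 * σ.H.length + 3) (by norm_num) (by norm_num)
    refine ⟨(Instance.stored_put (by norm_num)).2 ((Instance.stored_sto (by norm_num)
      (by norm_num)).2 h0), h2, h3, ?_, h5, h6, h7, h8,
      a3.concat (by norm_num) _,
      (State.holds_sto_of_ne (by norm_num) (by norm_num) (by norm_num)).2 a4,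
      (State.holds_sto_of_ne (by norm_num) (by norm_num) (by norm_num)).2 a5,
      (State.holds_sto_of_ne (by norm_num) (by norm_num) (by norm_num)).2 a6,
      (State.holds_sto_of_ne (by norm_num) (by norm_num) (by norm_num)).2 a7,
      (State.holds_sto_of_ne (by norm_num) (by norm_num) (by norm_num)).2 a8⟩
    simp [Sweep.push]
  · intro r hr hr'
    simp [hr', show r ≠ 4 by omega]
  · intro k hk i hi
    rw [State.put_arr, State.sto_arr (by norm_num) hk, if_neg (by omega), State.put_arr]

theorem wlp_finishRed {cmp : ℕ → ℕ → ℕ} {Q : State → Prop} (hs : σ.Rep I d s)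
    (hM : 16 * σ.G.length + 64 ≤ M) (hNM : 64 * N + 64 ≤ M) (hr : s.reg 33 < N)
    (hx : s.reg 11 ≤ N)
    (hm : (σ.G.map fun e => e.2 - I.cb e.1).sum + N < M)
    (hQ : ∀ s', (σ.emit (s.reg 33) (s.reg 11)).Rep I d s' →
      (∀ r, 11 ≤ r → r ≠ 34 → r ≠ 60 → s'.reg r = s.reg r) →
      (∀ k < 16, ∀ i, k ≠ 4 → k ≠ 5 → s'.arr k i = s.arr k i) → Q s') :
    finishRed.wlp M cmp Q s := by
  have h5 := hs.reg5
  have h7 := hs.reg7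
  have e1 := hs.stored.arr_one _ hr
  have e2 := I.cb_le _ hr
  have e3 := I.nb_le
  obtain ⟨m, hm'⟩ : ∃ m, (σ.G.map fun e => e.2 - I.cb e.1).sum = m := ⟨_, rfl⟩
  rw [hm'] at hm
  rw [hm'] at h7
  obtain ⟨r, hr'⟩ : ∃ r, s.reg 33 = r := ⟨_, rfl⟩
  obtain ⟨x, hx'⟩ : ∃ x, s.reg 11 = x := ⟨_, rfl⟩
  rw [hr'] at hr hQ e1 e2
  rw [hx'] at hx hQ
  have hlit : ∀ n ≤ 63, n < M := fun n hn => by omega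
  simp [finishRed, wlp_st, wlp_ld, hlit, h5, h7, e1, hr', hx']
  refine ⟨by omega, by omega, by omega, by omega, by omega, by omega, by omega, by omega, by omega,
    hQ _ ?_ ?_ ?_⟩
  · obtain ⟨h0, h2, h3, h4, h5, h6, h7, h8, a3, a4, a5, a6, a7, a8⟩ := hs
    refine ⟨?_, by simpa [Sweep.emit] using h2, by simpa using h3, by simpa [Sweep.emit] using h4,
      ?_, by simpa [Sweep.emit] using h6, ?_, by simpa [Sweep.emit] using h8, ?_, ?_, ?_, ?_, ?_,
      ?_⟩
    · simpa [Instance.stored_put, Instance.stored_sto] using h0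
    · simp [Sweep.emit]
    · simp [Sweep.emit, hm']
    · simpa [Sweep.emit, State.holds_sto_of_ne] using a3
    · simp only [State.holds_put]
      rw [State.holds_sto_of_ne (by norm_num) (by norm_num) (by norm_num)]
      simp only [State.holds_put]
      have := State.Holds.concat (k := 4) (by norm_num) a4 r
      simpa [Sweep.emit, State.Holds, State.sto_arr] using this
    · simp only [State.holds_put]
      have a5' : ((s.put 60 (16 * σ.G.length + 4)).sto 4 σ.G.length r).Holds 5
          (σ.G.map fun e => e.2) := by
        rw [State.holds_sto_of_ne (by norm_num) (by norm_num) (by norm_num)]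
        exact a5
      have := State.Holds.concat (k := 5) (by norm_num) a5' x
      simpa [Sweep.emit, State.Holds, State.sto_arr] using this
    · simpa [Sweep.emit, State.holds_sto_of_ne] using a6
    · simpa [Sweep.emit, State.holds_sto_of_ne] using a7
    · simpa [Sweep.emit, State.holds_sto_of_ne] using a8
  · intro r hr h1 h2
    simp [h1, h2, show r ≠ 5 by omega, show r ≠ 7 by omega]
  · intro k hk i h1 h2
    simp [State.sto_arr, hk, h1, h2]

/-! ### Testing the number of blue points below the pivot -/

open Classical in
-- One step of an exponential moment bound: if a hit has probability `q`, then `exp (a * hit)` has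
-- mean `1 + (exp a - 1) * q ≤ exp ((exp a - 1) * q)`.
theorem sum_exp_hits_le (A : ℕ → Prop) (f : ℕ → ℕ) (n : ℕ) (a r : ℝ) :
    ∑ i ∈ range n, Real.exp (r + a * ((if A (f i) then 1 else 0 : ℕ) : ℝ)) ≤
      n * Real.exp (r + (Real.exp a - 1) * (hits A f n / n)) := by
  have h1 : ∀ i, Real.exp (r + a * ((if A (f i) then 1 else 0 : ℕ) : ℝ)) =
      Real.exp r * (1 + (Real.exp a - 1) * ((if A (f i) then 1 else 0 : ℕ) : ℝ)) := by
    intro i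
    split_ifs
    · rw [Nat.cast_one, mul_one, Real.exp_add]; ring
    · simp
  have h2 : (∑ i ∈ range n, ((if A (f i) then 1 else 0 : ℕ) : ℝ)) = hits A f n := by
    rw [hits]
    push_cast
    exact sum_congr rfl fun _ _ => by congr
  simp only [h1]
  rw [← mul_sum, sum_add_distrib, ← mul_sum, h2, sum_const, card_range, nsmul_eq_mul, mul_one,
    Real.exp_add]
  rcases n.eq_zero_or_pos with rfl | hn
  · simp
  have hn' : (0 : ℝ) < n := by exact_mod_cast hn
  have h3 := Real.add_one_le_exp ((Real.exp a - 1) * (hits A f n / n))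
  calc Real.exp r * (n + (Real.exp a - 1) * hits A f n)
      = n * (Real.exp r * ((Real.exp a - 1) * (hits A f n / n) + 1)) := by field_simp; ring
    _ ≤ _ := by gcongr

/-- Register `39` says whether there are many blue points below the pivot in register `35`. -/
def testLevel : Prog :=
  (set 36 (lit 0) ⨟ sub 37 (reg 1) (reg 11) ⨟ set 38 (reg 2)) ⨟
  loop (reg 38)
    (sub 38 (reg 38) (lit 1) ⨟ .instr (.rand 33 (reg 37)) ⨟
      (add 33 (reg 33) (reg 11) ⨟ ld 33 2 (reg 33) ⨟ cmp 39 (reg 33) (reg 35) ⨟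
        add 36 (reg 36) (reg 39))) ⨟
  (mul 36 (reg 36) (reg 37) ⨟ mul 39 (reg 2) (reg 2) ⨟ lt 39 (reg 39) (reg 36))

open Classical in
-- Here `p m z` bounds the expected cost with `m` draws left and `z` hits so far. The test asks
-- whether the estimate `z * (I.nb - x) / ℓ` exceeds `ℓ`, without division.
theorem testLevel_triple_aux (hM : M ≤ 2 ^ w) (hI : I.Stored s) {ℓ v x : ℕ} (h2 : s.reg 2 = ℓ)
    (h11 : s.reg 11 = x) (h35 : s.reg 35 = v) (hx : x < I.nb) (hv : v < 2 * N)
    (hℓM : 64 * (ℓ + N + 1) * (ℓ + N + 1) ≤ M)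
    (hcmp : ∀ a < 2 * N, ∀ b < 2 * N, compareInput input a b = if ν a < ν b then 1 else 0)
    (p : ℕ → ℕ → ℝ≥0∞)
    (hp : ∀ m z, ∑ b ∈ range (I.nb - x),
      p m (z + if ν (I.bp (x + b)) < ν v then 1 else 0) ≤ (I.nb - x : ℕ) * p (m + 1) z)
    (hF : ∀ s' z, s.Same s' → s'.reg 35 = v → z ≤ ℓ →
      s'.reg 39 = (if ℓ * ℓ < z * (I.nb - x) then 1 else 0) → F s' ≤ p 0 z) :
    Triple w input testLevel (30 * ℓ + 20) s (p ℓ 0) F := by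
  have hnb := I.nb_le
  have hM' : 64 * (ℓ + N + 1) ≤ M := le_trans (Nat.le_mul_of_pos_right _ (by omega)) hℓM
  have hℓℓ : ℓ * ℓ < M := by nlinarith
  have hℓN : ∀ z ≤ ℓ, z * (I.nb - x) < M := fun z hz => by
    have : z * (I.nb - x) ≤ ℓ * N := Nat.mul_le_mul hz (by omega)
    nlinarith
  have hM2 : 2 ≤ M := by omega
  have hlit : ∀ n ≤ 63, n < M := fun n hn => by omega
  have hite : ∀ (p : Prop) [Decidable p], (if p then 1 else 0) < M := fun p _ => by
    split_ifs <;> omega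
  refine .seq_wlp hM hM2 (m := 30 * ℓ + 10) (by simp; omega) ?_
  simp [h2, h11, hI.reg_one, hlit]
  refine ⟨by omega, by omega, ?_⟩
  refine .seq (n := 30 * ℓ + 1) (m := 5) ?_ (by omega)
  have key := Triple.loop (w := w) (input := input) (a := reg 38)
    (p := sub 38 (reg 38) (lit 1) ⨟ .instr (.rand 33 (reg 37)) ⨟
      (add 33 (reg 33) (reg 11) ⨟ ld 33 2 (reg 33) ⨟ cmp 39 (reg 33) (reg 35) ⨟
        add 36 (reg 36) (reg 39)))
    (F := bestBound w input (mul 36 (reg 36) (reg 37) ⨟ mul 39 (reg 2) (reg 2) ⨟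
      lt 39 (reg 39) (reg 36)) 5 F)
    (fun s' => s.Same s' ∧ s'.reg 35 = v ∧ s'.reg 37 = I.nb - x ∧ s'.reg 38 + s'.reg 36 ≤ ℓ)
    (fun s' => 30 * s'.reg 38)
    (fun s' => p (s'.reg 38) (s'.reg 36)) ?_ ?_
    (((s.put 36 0).put 37 (I.nb - x)).put 38 ℓ) ?_
  · simpa using key
  · rintro t ⟨h1, h3, h4, h5⟩ h6
    have h6' : t.reg 38 = 0 := h6
    have h2' : t.reg 2 = ℓ := by rw [h1.1 2 (by norm_num), h2]
    obtain ⟨z, hz⟩ : ∃ z, t.reg 36 = z := ⟨_, rfl⟩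
    rw [hz] at h5
    show bestBound _ _ _ _ _ _ ≤ p (t.reg 38) (t.reg 36)
    rw [h6', hz]
    refine bestBound_le_of_wlp hM hM2 (by simp) ?_
    simp [h4, h2', hz, hℓℓ, hℓN z (by omega), hite]
    refine hF _ z ?_ ?_ (by omega) ?_
    · simp [State.same_put, h1]
    · simp [h3]
    · simp
  · rintro t ⟨h1, h3, h4, h5⟩ h6
    have h6' : t.reg 38 ≠ 0 := h6
    obtain ⟨m, hm⟩ := Nat.exists_eq_succ_of_ne_zero h6'
    obtain ⟨z, hz⟩ : ∃ z, t.reg 36 = z := ⟨_, rfl⟩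
    have h11' : t.reg 11 = x := by rw [h1.1 11 (by norm_num), h11]
    rw [hm, hz] at h5
    refine ⟨25, show 26 ≤ 30 * t.reg 38 by omega, ?_⟩
    refine .seq_wlp hM hM2 (m := 23) (by simp) ?_
    simp only [wlp_sub, fits_reg, fits_lit, val_reg, val_lit, hm, hz]
    refine ⟨trivial, hlit _ (by norm_num), by omega, ?_⟩
    refine .seq (n := 1) (m := 18) (Triple.rand hM ?_ ?_ ?_) (by norm_num)
    · simp [h4, hx]
    · simp [h4]; omega
    · simp only [State.put_reg, Nat.reduceEqDiff, if_false, h4, Nat.succ_eq_add_one,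
        Nat.add_sub_cancel]
      refine le_trans (sum_le_sum fun b hb => ?_) (hp m z)
      rw [mem_range] at hb
      have e1 : t.arr 2 (b + x) = I.bp (x + b) := by
        rw [h1.2 2 (by norm_num), add_comm, hI.arr_two _ (by omega)]
      have e2 := I.bp_lt (x + b) (by omega)
      have e3 := hcmp _ e2 v hv
      refine bestBound_le_of_wlp hM hM2 (by simp) ?_
      simp [wlp_ld, hlit, e1, h11', State.same_put, h1, h3, h4, e3, hz]
      refine ⟨by omega, by omega, by omega, by split_ifs <;> omega, ?_⟩
      rw [if_pos]
      split_ifs <;> omega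
  · simp [State.same_put, State.Same.refl, h35]

theorem testLevel_triple_one (hM : M ≤ 2 ^ w) (hI : I.Stored s) {ℓ v x : ℕ} (h2 : s.reg 2 = ℓ)
    (h11 : s.reg 11 = x) (h35 : s.reg 35 = v) (hx : x < I.nb) (hv : v < 2 * N)
    (hℓM : 64 * (ℓ + N + 1) * (ℓ + N + 1) ≤ M)
    (hcmp : ∀ a < 2 * N, ∀ b < 2 * N, compareInput input a b = if ν a < ν b then 1 else 0)
    (hF : ∀ s', s.Same s' → s'.reg 35 = v → F s' ≤ c) :
    Triple w input testLevel (30 * ℓ + 20) s c F :=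
  testLevel_triple_aux (p := fun _ _ => c) hM hI h2 h11 h35 hx hv hℓM hcmp
    (fun m z => by simp) fun s' z hs h35 _ _ => hF s' hs h35

theorem Instance.below_eq_hits (x v : ℕ) :
    I.below x v = hits (fun b => ν (I.bp b) < ν v) (fun b => x + b) (I.nb - x) := by
  classical
  rw [hits, Instance.below, card_filter, sum_Ico_eq_sum_range]

open Classical in
-- With `D` blue points left, the number of hits is compared to `t = ℓ ^ 2 / D`, and its mean is `ℓ
-- / D` times the true number. Between `ℓ / 2` and `2 * ℓ` both answers are correct. Outside, the
-- mean is off from `t` by a factor of at least two, and an exponential bound with `a = ± log 2`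
-- gives error `exp (-t / 6)`, where `D ≤ N`.
theorem testLevel_triple (hM : M ≤ 2 ^ w) (hI : I.Stored s) {ℓ v x : ℕ} (h2 : s.reg 2 = ℓ)
    (h11 : s.reg 11 = x) (h35 : s.reg 35 = v) (hx : x < I.nb) (hv : v < 2 * N)
    (hℓM : 64 * (ℓ + N + 1) * (ℓ + N + 1) ≤ M)
    (hcmp : ∀ a < 2 * N, ∀ b < 2 * N, compareInput input a b = if ν a < ν b then 1 else 0)
    (hF1 : ∀ s', s.Same s' → s'.reg 35 = v → F s' ≤ 1)
    (hF : ∀ s', s.Same s' → s'.reg 35 = v → (s'.reg 39 ≠ 0 → ℓ ≤ 2 * I.below x v) →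
      (s'.reg 39 = 0 → I.below x v ≤ 2 * ℓ) → F s' ≤ c) :
    Triple w input testLevel (30 * ℓ + 20) s
      (c + ENNReal.ofReal (Real.exp (-((ℓ * ℓ : ℝ) / (6 * N))))) F := by
  have hnb := I.nb_le
  set D := I.nb - x with hD
  set q : ℝ := I.below x v / D with hq
  set t : ℝ := (ℓ * ℓ : ℝ) / D with ht
  have hD0 : (0 : ℝ) < D := by exact_mod_cast (show 0 < D by omega)
  have hDN : (D : ℝ) ≤ N := by exact_mod_cast (show D ≤ N by omega)
  -- The first condition bounds the initial potential; the second says that every wrong answer has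
  -- final potential at least one.
  have key : ∀ a : ℝ, q * (Real.exp a - 1) * ℓ - a * t ≤ -((ℓ * ℓ : ℝ) / (6 * N)) →
      (∀ z : ℕ, (if ℓ * ℓ < z * D then ℓ ≤ 2 * I.below x v else I.below x v ≤ 2 * ℓ) ∨
        0 ≤ a * (z - t)) → Triple w input testLevel (30 * ℓ + 20) s
        (c + ENNReal.ofReal (Real.exp (-((ℓ * ℓ : ℝ) / (6 * N))))) F := by
    intro a h1 h3
    have := testLevel_triple_aux (F := F)
      (p := fun m z => c + ENNReal.ofReal (Real.exp (a * (z - t) + q * (Real.exp a - 1) * m)))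
      hM hI h2 h11 h35 hx hv hℓM hcmp ?_ ?_
    · refine this.mono le_rfl ?_ fun _ => le_rfl
      gcongr
      simp only [Nat.cast_zero]
      linarith
    · intro m z
      rw [sum_add_distrib, mul_add]
      refine add_le_add (by simp) ?_
      rw [← ENNReal.ofReal_sum_of_nonneg (fun i _ => by positivity), ← ENNReal.ofReal_natCast,
        ← ENNReal.ofReal_mul (by positivity)]
      refine ENNReal.ofReal_le_ofReal ?_
      have := sum_exp_hits_le (fun b => ν (I.bp b) < ν v) (fun b => x + b) D a
        (a * (z - t) + q * (Real.exp a - 1) * m)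
      rw [← Instance.below_eq_hits] at this
      refine le_of_eq_of_le (sum_congr rfl fun b hb => ?_) (this.trans (le_of_eq ?_))
      · push_cast
        congr 1
        ring
      · rw [← hq]
        push_cast
        congr 2
        ring
    · intro s' z hs h35' hz h39
      rcases h3 z with h3 | h3
      · refine (hF s' hs h35' ?_ ?_).trans le_self_add
        · intro h
          split_ifs at h3 h39 <;> first | exact h3 | omega
        · intro h
          split_ifs at h3 h39 <;> first | exact h3 | omega
      · refine (hF1 s' hs h35').trans (le_add_left ?_)
        rw [← ENNReal.ofReal_one]
        refine ENNReal.ofReal_le_ofReal ?_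
        rw [Nat.cast_zero, mul_zero, add_zero]
        exact Real.one_le_exp h3
  have hz : ∀ z : ℕ, ℓ * ℓ < z * D → t ≤ z := fun z h => by
    rw [ht, div_le_iff₀ hD0]
    exact_mod_cast h.le
  have hz' : ∀ z : ℕ, ¬ ℓ * ℓ < z * D → z ≤ t := fun z h => by
    rw [ht, le_div_iff₀ hD0]
    exact_mod_cast not_lt.1 h
  have hlog := Real.log_two_gt_d9
  have hlog' := Real.log_two_lt_d9
  have ht0 : (ℓ * ℓ : ℝ) / (6 * N) ≤ t / 6 := by
    rw [ht, div_div, mul_comm (D : ℝ)]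
    gcongr
  have ht1 : 0 ≤ t := by positivity
  by_cases h4 : I.below x v ≤ 2 * ℓ
  · by_cases h5 : ℓ ≤ 2 * I.below x v
    · refine (testLevel_triple_one hM hI h2 h11 h35 hx hv hℓM hcmp fun s' hs h => ?_).mono le_rfl
        le_self_add fun _ => le_rfl
      exact hF s' hs h (fun _ => h5) fun _ => h4
    -- The mean is at most `t / 2`, and `log 2 - 1 / 2 > 1 / 6`.
    · refine key (Real.log 2) ?_ fun z => ?_
      · rw [Real.exp_log (by norm_num)]
        have : q * ℓ ≤ t / 2 := by
          rw [hq, ht, div_mul_eq_mul_div, div_div, mul_comm (D : ℝ), ← div_div]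
          refine div_le_div_of_nonneg_right ?_ hD0.le
          have : (2 * I.below x v : ℝ) ≤ ℓ := by exact_mod_cast (not_le.1 h5).le
          nlinarith
        nlinarith
      · split_ifs with h
        · right
          have := hz z h
          exact mul_nonneg (by linarith) (by linarith)
        · exact .inl h4
  -- The mean is at least `2 * t`, and `1 - log 2 > 1 / 6`.
  · refine key (-Real.log 2) ?_ fun z => ?_
    · rw [Real.exp_neg, Real.exp_log (by norm_num)]
      have : 2 * t ≤ q * ℓ := by
        rw [hq, ht, div_mul_eq_mul_div, ← mul_div_assoc]
        refine div_le_div_of_nonneg_right ?_ hD0.le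
        have : (2 * ℓ : ℝ) ≤ I.below x v := by exact_mod_cast (not_le.1 h4).le
        nlinarith
      nlinarith
    · split_ifs with h
      · left; omega
      · right
        have := hz' z h
        nlinarith

end

/-! ### Splitting the active set at a new threshold -/

section

open Prog Operand

variable {w M : ℕ} {input : List ℝ} {N : ℕ} {ν : ℕ → ℝ} {s : State} {F : State → ℝ≥0∞} {c : ℝ≥0∞}
variable {I : Instance N ν} {σ : Sweep} {d : ℕ}

/-! ### Making a level -/

/-- A new level with the threshold in register `35` is made. -/
def cutLevel : Prog :=
  (st 6 (reg 6) (reg 35) ⨟ st 7 (reg 6) (reg 11) ⨟ st 8 (reg 6) (reg 5) ⨟ add 6 (reg 6) (lit 1) ⨟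
    set 10 (reg 35) ⨟ set 38 (lit 0) ⨟ set 37 (reg 4) ⨟ set 4 (lit 0) ⨟
    lt 36 (reg 38) (reg 37)) ⨟
  loop (reg 36)
    (ld 33 3 (reg 38) ⨟ cmp 39 (reg 10) (reg 33) ⨟ branch (reg 39) pushRed finishRed ⨟
      add 38 (reg 38) (lit 1) ⨟ lt 36 (reg 38) (reg 37)) ⨟
  (mul 39 (reg 2) (lit 3) ⨟ lt 39 (reg 39) (reg 4) ⨟ branch (reg 39) (set 4 (lit 0)) skip)

namespace Sweep

/-- The sweep after the first `j` active red points were treated in the making of a level. -/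
def cutAux (σ : Sweep) (ν : ℕ → ℝ) (v x j : ℕ) : Sweep where
  ℓ := σ.ℓ
  H := (σ.H.take j).filter fun h => ν v < ν h
  G := σ.G ++ ((σ.H.take j).filter fun h => ¬ ν v < ν h).map fun h => (h, x)
  L := σ.L ++ [(v, x, σ.G.length)]

theorem cutAux_succ_push {v x j : ℕ} (hj : j < σ.H.length) (h : ν v < ν (σ.H.getD j 0)) :
    σ.cutAux ν v x (j + 1) = (σ.cutAux ν v x j).push (σ.H.getD j 0) := by
  rw [List.getD_eq_getElem _ _ hj] at h ⊢
  simp [cutAux, Sweep.push, List.take_succ_eq_append_getElem hj, h, -List.take_append_getElem]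

theorem cutAux_succ_emit {v x j : ℕ} (hj : j < σ.H.length) (h : ¬ ν v < ν (σ.H.getD j 0)) :
    σ.cutAux ν v x (j + 1) = (σ.cutAux ν v x j).emit (σ.H.getD j 0) x := by
  rw [List.getD_eq_getElem _ _ hj] at h ⊢
  simp [cutAux, Sweep.emit, List.take_succ_eq_append_getElem hj, not_lt.1 h,
    -List.take_append_getElem]

theorem cutAux_length (v x j : ℕ) (hj : j ≤ σ.H.length) : (σ.cutAux ν v x j).H.length +
    (σ.cutAux ν v x j).G.length = j + σ.G.length := by
  have := length_filter_add (σ.H.take j) fun h => ν v < ν h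
  rw [List.length_take, min_eq_left hj] at this
  simp only [cutAux, List.length_append, List.length_map]
  omega

end Sweep

theorem sum_map_sub_le {G : List (ℕ × ℕ)} {f : ℕ → ℕ} (h : ∀ e ∈ G, e.2 ≤ N)
    (hl : G.length ≤ N) : (G.map fun e => e.2 - f e.1).sum ≤ N * N := by
  refine (List.sum_le_card_nsmul _ N fun y hy => ?_).trans ?_
  · obtain ⟨e, he, rfl⟩ := List.mem_map.1 hy
    exact (Nat.sub_le _ _).trans (h e he)
  · rw [List.length_map, smul_eq_mul]
    exact Nat.mul_le_mul_right _ hl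

theorem cutLevel_triple (hM : M ≤ 2 ^ w) (hs : σ.Rep I d s) {ℓ₀ i v x : ℕ}
    (hσ : σ.Safe I ℓ₀ i) (hi : i ≤ N) (h35 : s.reg 35 = v) (h11 : s.reg 11 = x) (hx : x ≤ I.nb)
    (hv : v < N) (hℓ : σ.ℓ ≤ N) (hNM : 64 * (2 * N + 1) * (2 * N + 1) ≤ M)
    (hcmp : ∀ a < 2 * N, ∀ b < 2 * N, compareInput input a b = if ν a < ν b then 1 else 0)
    (hF : ∀ s', (σ.cut ν v x).Rep I d s' → (∀ r, 11 ≤ r → r < 31 → s'.reg r = s.reg r) →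
      F s' ≤ c) :
    Triple w input cutLevel (60 * σ.H.length + 50) s c F := by
  have hnb := I.nb_le
  have hNM' : 64 * (2 * N + 1) ≤ M := (Nat.le_mul_of_pos_right _ (by omega)).trans hNM
  have hNN : N * N + N < M := by nlinarith
  have hM2 : 2 ≤ M := by omega
  have hlit : ∀ n ≤ 63, n < M := fun n hn => by omega
  have hite : ∀ (p : Prop) [Decidable p], (if p then 1 else 0) < M := fun p _ => by
    split_ifs <;> omega
  obtain ⟨n, hn⟩ : ∃ n, σ.H.length = n := ⟨_, rfl⟩
  have g1 := hσ.length_le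
  have g2 := hσ.L_length_le
  rw [hn] at g1
  have h4 := hs.reg4
  have h5 := hs.reg5
  have h6 := hs.reg6
  rw [hn] at h4 ⊢
  refine .seq_wlp hM hM2 (m := 60 * n + 17) (by simp; omega) ?_
  simp [hlit, hite, wlp_st, h4, h5, h6, h35, h11]
  refine ⟨by omega, by omega, by omega, by omega, by omega, by omega, by omega, by omega, by omega,
    ?_⟩
  -- The active list is compacted in place. No more entries have been written than read, so the
  -- entries from `j` on are still the original ones.
  refine .seq (n := 60 * n + 1) (m := 15) (.loop_wlp hM hM2 (fun t => ∃ j, t.reg 38 = j ∧ j ≤ n ∧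
    (σ.cutAux ν v x j).Rep I d t ∧ t.reg 37 = n ∧ (∀ r, 11 ≤ r → r < 31 → t.reg r = s.reg r) ∧
    t.reg 36 = (if j < n then 1 else 0) ∧ ∀ u, j ≤ u → u < n → t.arr 3 u = σ.H.getD u 0)
    (fun t => n - t.reg 38) ?_ ?_ ?_ ?_) (by omega)
  · refine ⟨0, by simp, by omega, ?_, by simp, fun r hr hr' => ?_, by simp, fun u _ hu => ?_⟩
    · obtain ⟨h0, h2, h3, h4, h5, h6, h7, h8, a3, a4, a5, a6, a7, a8⟩ := hs
      have b6 := State.Holds.concat (k := 6) (by norm_num) a6 v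
      have b7 := State.Holds.concat (k := 7) (by norm_num) a7 x
      have b8 := State.Holds.concat (k := 8) (by norm_num) a8 σ.G.length
      refine ⟨?_, by simpa [Sweep.cutAux] using h2, by simpa using h3, by simp [Sweep.cutAux],
        by simpa [Sweep.cutAux] using h5, by simp [Sweep.cutAux],
        by simpa [Sweep.cutAux] using h7, by simp [Sweep.cutAux], by simp [Sweep.cutAux, State.Holds],
        ?_, ?_, ?_, ?_, ?_⟩
      · simpa [Instance.stored_put, Instance.stored_sto] using h0
      · simpa [Sweep.cutAux, State.holds_sto_of_ne] using a4
      · simpa [Sweep.cutAux, State.holds_sto_of_ne] using a5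
      · simpa [Sweep.cutAux, State.Holds, State.sto_arr] using b6
      · simpa [Sweep.cutAux, State.Holds, State.sto_arr] using b7
      · simpa [Sweep.cutAux, State.Holds, State.sto_arr] using b8
    · have e : ∀ k, k < 11 ∨ 31 ≤ k → r ≠ k := fun k hk => by omega
      simp [e]
    · simpa [State.sto_arr] using hs.arr3 u (by omega)
  · simp
    omega
  · rintro t ⟨j, h38, hj, hrep, h37, hr, h36, h3⟩ h36'
    rw [h36] at h36'
    have hjn : j < n := by
      by_contra h
      simp [h] at h36'
    obtain ⟨y, hy⟩ : ∃ y, σ.H.getD j 0 = y := ⟨_, rfl⟩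
    have e1 := h3 j le_rfl hjn
    rw [hy] at e1
    have e2 : y ∈ σ.H := by
      rw [← hy, List.getD_eq_getElem _ _ (by omega)]
      exact List.getElem_mem _
    have e3 := hσ.H_lt _ e2
    have e4 := hcmp v (by omega) y (by omega)
    have e5 : t.reg 10 = v := hrep.reg10 (v, x, σ.G.length) (by simp [Sweep.cutAux])
    have e6 : t.reg 11 = x := by rw [hr 11 (by norm_num) (by norm_num), h11]
    have e7 := Sweep.cutAux_length (ν := ν) (σ := σ) v x j (by omega)
    have hrep' : ∀ b z, (σ.cutAux ν v x j).Rep I d (((t.put 60 b).put 33 y).put 39 z) :=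
      fun b z => ((hrep.put (by norm_num) (by norm_num)).put (by norm_num)
        (by norm_num)).put (by norm_num) (by norm_num)
    simp only [wlp_seq, wlp_branch, wlp_ld (show 3 < 16 by norm_num), fits_reg, true_and, val_reg,
      h38, e1, wlp_cmp, State.put_reg, Nat.reduceEqDiff, if_false, if_true, e5, e4]
    refine ⟨by omega, by omega, by omega, fun hb => ?_, fun hb => ?_⟩
    · have hb' : ¬ ν v < ν y := by
        intro h
        simp [h] at hb
      refine wlp_finishRed (hrep' _ _) (by omega) (by omega) (by simp; omega)
        (by simp [e6]; omega) ?_ fun s' hs' hr' ha' => ?_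
      · refine lt_of_le_of_lt (Nat.add_le_add_right (sum_map_sub_le (fun e he => ?_)
          (by omega)) _) hNN
        simp only [Sweep.cutAux, List.mem_append, List.mem_map] at he
        rcases he with he | ⟨z, hz, rfl⟩
        · exact (hσ.G_lt e he).2.trans hnb
        · exact hx.trans hnb
      · have f1 := hr' 38 (by norm_num) (by norm_num) (by norm_num)
        have f2 := hr' 37 (by norm_num) (by norm_num) (by norm_num)
        simp [h38, h37] at f1 f2
        simp [f1, f2, hlit, hite]
        refine ⟨by omega, ⟨by omega, ?_, fun r h11 h31 => ?_, fun u hu hu' => ?_⟩, by omega⟩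
        · rw [Sweep.cutAux_succ_emit (by omega) (by rwa [hy]), hy]
          have := (hs'.put (x := 38) (v := j + 1) (by norm_num) (by norm_num)).put (x := 36)
            (v := if j + 1 < n then 1 else 0) (by norm_num) (by norm_num)
          simpa [e6] using this
        · have e : ∀ k, k < 11 ∨ 31 ≤ k → r ≠ k := fun k hk => by omega
          have := hr' r h11 (by omega) (by omega)
          simp [e, this, hr r h11 h31]
        · rw [ha' 3 (by norm_num) u (by norm_num) (by norm_num)]
          simpa using h3 u (by omega) hu'
    · have hb' : ν v < ν y := by
        by_contra h
        simp [h] at hb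
      have e8 : (σ.cutAux ν v x j).H.length ≤ j := by
        simp only [Sweep.cutAux]
        refine (List.length_filter_le _ _).trans ?_
        simp
      refine wlp_pushRed (hrep' _ _) (by omega) (by simp; omega) fun s' hs' hr' ha' => ?_
      have f1 := hr' 38 (by norm_num) (by norm_num)
      have f2 := hr' 37 (by norm_num) (by norm_num)
      simp [h38, h37] at f1 f2
      simp [f1, f2, hlit, hite]
      refine ⟨by omega, ⟨by omega, ?_, fun r h11 h31 => ?_, fun u hu hu' => ?_⟩, by omega⟩
      · rw [Sweep.cutAux_succ_push (by omega) (by rwa [hy]), hy]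
        have := (hs'.put (x := 38) (v := j + 1) (by norm_num) (by norm_num)).put (x := 36)
          (v := if j + 1 < n then 1 else 0) (by norm_num) (by norm_num)
        simpa using this
      · have e : ∀ k, k < 11 ∨ 31 ≤ k → r ≠ k := fun k hk => by omega
        have := hr' r h11 (by omega)
        simp [e, this, hr r h11 h31]
      · rw [ha' 3 (by norm_num) u (by omega)]
        simpa using h3 u (by omega) hu'
  · rintro t ⟨j, h38, hj, hrep, h37, hr, h36, h3⟩ h36'
    rw [h36] at h36'
    have hjn : j = n := by
      by_contra h
      rw [if_pos (by omega)] at h36'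
      omega
    subst hjn
    rw [← hn] at hrep
    have hr' : ∀ r, 11 ≤ r → r < 31 → ∀ k b, k < 11 ∨ 31 ≤ k → (t.put k b).reg r = s.reg r :=
      fun r h11 h31 k b hk => by
        rw [State.put_reg, if_neg (by omega)]
        exact hr r h11 h31
    have h2 := hrep.reg2
    have h4 := hrep.reg4
    simp only [Sweep.cutAux, List.take_length] at h2 h4
    refine bestBound_le_of_wlp hM hM2 (by simp) ?_
    simp [h2, h4, hlit, hite]
    refine ⟨by omega, fun h => hF _ ?_ ?_, fun h => hF _ ?_ ?_⟩
    · have e : σ.cut ν v x = σ.cutAux ν v x σ.H.length := by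
        simp only [Sweep.cut, Sweep.cutAux, List.take_length]
        rw [if_neg (by omega)]
      rw [e]
      exact hrep.put (by norm_num) (by norm_num)
    · exact fun r h11 h31 => hr' r h11 h31 _ _ (by norm_num)
    · obtain ⟨h0, h2, h3, h4, h5, h6, h7, h8, a3, a4, a5, a6, a7, a8⟩ := hrep.put (x := 39)
        (v := 1) (by norm_num) (by norm_num)
      simp only [Sweep.cutAux, List.take_length] at h2 h5 h6 h7 h8 a4 a5 a6 a7 a8
      have eH : (σ.cut ν v x).H = [] := by
        simp only [Sweep.cut]
        rw [if_pos (by omega)]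
      refine ⟨?_, by simpa [Sweep.cut] using h2, by simpa using h3, by simp [eH],
        by simpa [Sweep.cut] using h5, by simpa [Sweep.cut] using h6,
        by simpa [Sweep.cut] using h7, by simpa [Sweep.cut] using h8, by simp [eH, State.Holds],
        by simpa [Sweep.cut] using a4, by simpa [Sweep.cut] using a5,
        by simpa [Sweep.cut] using a6, by simpa [Sweep.cut] using a7, by simpa [Sweep.cut] using a8⟩
      simpa [Instance.stored_put] using h0
    · intro r h11 h31
      have e : ∀ k, k < 11 ∨ 31 ≤ k → r ≠ k := fun k hk => by omega
      simp [e, hr r h11 h31]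

end

/-! ### One attempt: a new level or a doubled scale; treating one red point -/

section

open Prog Operand

variable {w M : ℕ} {input : List ℝ} {N : ℕ} {ν : ℕ → ℝ} {s : State} {F : State → ℝ≥0∞} {c : ℝ≥0∞}
variable {I : Instance N ν} {σ : Sweep} {d : ℕ}

/-! ### The sweep -/

/-- The active red points are reduced by making a level, or the scale is doubled. -/
def attempt : Prog :=
  choosePivot ⨟ testLevel ⨟ branch (reg 39) (mul 2 (reg 2) (lit 2)) cutLevel

theorem Sweep.Rep.grow (h : σ.Rep I d s) : σ.grow.Rep I d (s.put 2 (σ.ℓ * 2)) := by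
  obtain ⟨h0, h2, h3, h4, h5, h6, h7, h8, a3, a4, a5, a6, a7, a8⟩ := h
  exact ⟨(Instance.stored_put (by norm_num)).2 h0, by simp [Sweep.grow], by simpa using h3,
    by simpa [Sweep.grow] using h4, by simpa [Sweep.grow] using h5,
    by simpa [Sweep.grow] using h6, by simpa [Sweep.grow] using h7,
    by simpa [Sweep.grow] using h8, a3, a4, a5, a6, a7, a8⟩

/-- The probability that an attempt fails. -/
def attemptError (N e ℓ₀ : ℕ) : ℝ≥0∞ :=
  ENNReal.ofReal (2 * (3 / 4) ^ e) + ENNReal.ofReal (Real.exp (-((ℓ₀ * ℓ₀ : ℝ) / (6 * N))))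

/-- Unconditional, thanks to the discarding; the amortized time of the sweep rests on it. -/
theorem Sweep.cut_length_le (v x : ℕ) : (σ.cut ν v x).H.length ≤ 3 * (σ.cut ν v x).ℓ := by
  simp only [Sweep.cut]
  split_ifs
  · simp
  · omega

theorem growOrCut_triple (hM : M ≤ 2 ^ w) (hs : σ.Rep I d s) {ℓ₀ i v x : ℕ}
    (hσ : σ.Safe I ℓ₀ i) (hi : i ≤ N) (hL : σ.L.length < i) (hl : σ.H.length = 4 * σ.ℓ)
    (h35 : s.reg 35 = v) (h11 : s.reg 11 = x) (hx : x ≤ I.nb) (hv : v ∈ σ.H)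
    (hNM : 64 * (2 * N + 1) * (2 * N + 1) ≤ M)
    (hcmp : ∀ a < 2 * N, ∀ b < 2 * N, compareInput input a b = if ν a < ν b then 1 else 0)
    (hgrow : s.reg 39 ≠ 0 → ∀ s', σ.grow.Rep I d s' → σ.grow.Safe I ℓ₀ i →
      (∀ r, 11 ≤ r → r < 31 → s'.reg r = s.reg r) → F s' ≤ c)
    (hcut : s.reg 39 = 0 → ∀ s', (σ.cut ν v x).Rep I d s' → (σ.cut ν v x).Safe I ℓ₀ i →
      (∀ r, 11 ≤ r → r < 31 → s'.reg r = s.reg r) → F s' ≤ c) :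
    Triple w input (branch (reg 39) (mul 2 (reg 2) (lit 2)) cutLevel) (240 * σ.ℓ + 51) s c F := by
  have hNM' : 64 * (2 * N + 1) ≤ M := (Nat.le_mul_of_pos_right _ (by omega)).trans hNM
  have h1 := hσ.length_le
  have hℓN : 4 * σ.ℓ ≤ N := by omega
  have hvi := hσ.H_lt v hv
  refine .branch (n := 240 * σ.ℓ + 50) (fun h => ?_) fun h => ?_
  · refine (cutLevel_triple hM hs hσ hi h35 h11 hx (by omega) (by omega) hNM hcmp
      fun s' hs' hr => hcut h s' hs' (hσ.cut hv hx hL) hr).time_mono (by omega)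
  · refine (Triple.of_wlp hM (by omega) ?_).time_mono (n := 1) (by omega)
    simp [hs.reg2]
    refine ⟨by omega, by omega, hgrow h _ hs.grow (hσ.grow hℓN) fun r h11 h31 => ?_⟩
    simp [show r ≠ 2 by omega]

/-- Time and safety, whatever the random choices are. The median search is quadratic in the sample
size `2 * e`, hence linear in the scale by `heℓ`. -/
theorem attempt_triple_one (hM : M ≤ 2 ^ w) {e : ℕ} (he : 0 < e) (hs : σ.Rep I (2 * e) s)
    {ℓ₀ i x : ℕ}
    (hσ : σ.Safe I ℓ₀ i) (hi : i ≤ N) (hL : σ.L.length < i) (hl : σ.H.length = 4 * σ.ℓ)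
    (heℓ : 2 * e * (2 * e) ≤ ℓ₀) (h11 : s.reg 11 = x) (hx : x < I.nb)
    (hNM : 64 * (2 * N + 1) * (2 * N + 1) ≤ M)
    (hcmp : ∀ a < 2 * N, ∀ b < 2 * N, compareInput input a b = if ν a < ν b then 1 else 0)
    (hF : ∀ s' (σ' : Sweep), σ'.Rep I (2 * e) s' → σ'.Safe I ℓ₀ i → σ'.H.length ≤ 3 * σ'.ℓ →
      (∀ r, 11 ≤ r → r < 31 → s'.reg r = s.reg r) → F s' ≤ c) :
    Triple w input attempt (700 * σ.ℓ) s c F := by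
  have hNM' : 64 * (2 * N + 1) ≤ M := (Nat.le_mul_of_pos_right _ (by omega)).trans hNM
  have hℓ := hσ.ℓ_pos
  have hℓ₀ := hσ.le_ℓ
  have h1 := hσ.length_le
  have hNM'' : 64 * (σ.ℓ + N + 1) * (σ.ℓ + N + 1) ≤ M :=
    (Nat.mul_le_mul (by omega) (by omega)).trans hNM
  have hee : 2 * e ≤ 2 * e * (2 * e) := Nat.le_mul_self _
  refine .seq (choosePivot_triple_one hM hs.reg4 (by omega) hs.reg3 hs.arr3
    (by rintro h; simp [h] at hl; omega) (by omega) (N := N) (ν := ν) (by omega) (by omega)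
    (fun h hh => (hσ.H_lt h hh).trans_le hi) hcmp fun s1 hs1 hv => ?_)
    (n := 300 * (2 * e) * (2 * e)) (m := 270 * σ.ℓ + 72) (by rw [mul_assoc]; omega)
  have hs1' := hs.of_same hs1
  have h11' : s1.reg 11 = x := by rw [hs1.1 _ (by norm_num), h11]
  refine Triple.bestBound_le (.seq (testLevel_triple_one hM hs1'.stored hs1'.reg2 h11' rfl hx
    (by have := hσ.H_lt _ hv; omega) hNM'' hcmp fun s2 hs2 h35 => ?_) (n := 30 * σ.ℓ + 20)
    (m := 240 * σ.ℓ + 51) (by omega))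
  refine (growOrCut_triple hM (hs1'.of_same hs2) hσ hi hL hl h35
    (by rw [hs2.1 _ (by norm_num), h11']) hx.le hv hNM hcmp (fun _ s' hs' hσ' hr => ?_)
    fun _ s' hs' hσ' hr => ?_).bestBound_le
  · exact hF s' _ hs' hσ' (by simp [Sweep.grow]; omega) fun r h h' => by
      rw [hr r h h', hs2.1 r h', hs1.1 r h']
  · exact hF s' _ hs' hσ' (Sweep.cut_length_le _ _) fun r h h' => by
      rw [hr r h h', hs2.1 r h', hs1.1 r h']

theorem attempt_triple (hM : M ≤ 2 ^ w) {e : ℕ} (he : 0 < e) (hs : σ.Rep I (2 * e) s)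
    {ℓ₀ i i' : ℕ}
    (hσ : σ.Safe I ℓ₀ i) (hi : i ≤ N - 1) (hL : σ.L.length < i) (hl : σ.H.length = 4 * σ.ℓ)
    (heℓ : 2 * e * (2 * e) ≤ ℓ₀) (h11 : s.reg 11 = I.cb i') (hx : I.cb i' < I.nb)
    (hi' : i' < i) (hmax : ∀ j < i, I.cb j ≤ I.cb i')
    (hNM : 64 * (2 * N + 1) * (2 * N + 1) ≤ M)
    (hcmp : ∀ a < 2 * N, ∀ b < 2 * N, compareInput input a b = if ν a < ν b then 1 else 0)
    (hF1 : ∀ s' (σ' : Sweep), σ'.Rep I (2 * e) s' → σ'.Safe I ℓ₀ i → σ'.H.length ≤ 3 * σ'.ℓ →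
      (∀ r, 11 ≤ r → r < 31 → s'.reg r = s.reg r) → F s' ≤ 1)
    (hg : σ.Good I ℓ₀ i)
    (hF : ∀ s' (σ' : Sweep), σ'.Rep I (2 * e) s' → σ'.Safe I ℓ₀ i → σ'.H.length ≤ 3 * σ'.ℓ →
      (∀ r, 11 ≤ r → r < 31 → s'.reg r = s.reg r) → σ'.Good I ℓ₀ i → F s' ≤ c) :
    Triple w input attempt (700 * σ.ℓ) s (c + attemptError N e ℓ₀) F := by
  classical
  have hNM' : 64 * (2 * N + 1) ≤ M := (Nat.le_mul_of_pos_right _ (by omega)).trans hNM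
  have hℓ := hσ.ℓ_pos
  have hℓ₀ := hσ.le_ℓ
  have h1 := hσ.length_le
  have hNM'' : 64 * (σ.ℓ + N + 1) * (σ.ℓ + N + 1) ≤ M :=
    (Nat.mul_le_mul (by omega) (by omega)).trans hNM
  have hee : 2 * e ≤ 2 * e * (2 * e) := Nat.le_mul_self _
  -- The scale only grows, so the error of the test is largest at `ℓ₀`.
  have herr : ENNReal.ofReal (Real.exp (-((σ.ℓ * σ.ℓ : ℝ) / (6 * N)))) ≤
      ENNReal.ofReal (Real.exp (-((ℓ₀ * ℓ₀ : ℝ) / (6 * N)))) := by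
    gcongr
  rw [attemptError, add_comm (ENNReal.ofReal (2 * _)), ← add_assoc]
  refine .seq (choosePivot_triple hM hs.reg4 he hℓ hl hs.reg3 hs.arr3 (by omega) (N := N) (ν := ν)
    (by omega) (by omega)
    (fun h hh => (hσ.H_lt h hh).trans_le (by omega)) hcmp (fun s1 hs1 hv => ?_)
    fun s1 hs1 hv hpiv => ?_)
    (n := 300 * (2 * e) * (2 * e)) (m := 270 * σ.ℓ + 72) (by rw [mul_assoc]; omega)
  · have hs1' := hs.of_same hs1
    have h11' : s1.reg 11 = I.cb i' := by rw [hs1.1 _ (by norm_num), h11]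
    refine Triple.bestBound_le (.seq (testLevel_triple_one hM hs1'.stored hs1'.reg2 h11' rfl hx
      (by have := hσ.H_lt _ hv; omega) hNM'' hcmp fun s2 hs2 h35 => ?_) (n := 30 * σ.ℓ + 20)
      (m := 240 * σ.ℓ + 51) (by omega))
    refine (growOrCut_triple hM (hs1'.of_same hs2) hσ (by omega) hL hl h35
      (by rw [hs2.1 _ (by norm_num), h11']) hx.le hv hNM hcmp (fun _ s' hs' hσ' hr => ?_)
      fun _ s' hs' hσ' hr => ?_).bestBound_le
    · exact hF1 s' _ hs' hσ' (by simp [Sweep.grow]; omega) fun r h h' => by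
        rw [hr r h h', hs2.1 r h', hs1.1 r h']
    · exact hF1 s' _ hs' hσ' (Sweep.cut_length_le _ _) fun r h h' => by
        rw [hr r h h', hs2.1 r h', hs1.1 r h']
  · have hs1' := hs.of_same hs1
    have h11' : s1.reg 11 = I.cb i' := by rw [hs1.1 _ (by norm_num), h11]
    rw [GoodPivot, hits_getD, hits_getD, List.countP_eq_length_filter,
      List.countP_eq_length_filter] at hpiv
    refine (Triple.mono (.seq (testLevel_triple (c := c) hM hs1'.stored hs1'.reg2 h11' rfl hx
      (by have := hσ.H_lt _ hv; omega) hNM'' hcmp (fun s2 hs2 h35 => ?_)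
      fun s2 hs2 h35 ht1 ht0 => ?_) (n := 30 * σ.ℓ + 20)
      (m := 240 * σ.ℓ + 51) (by omega)) le_rfl (add_le_add_right herr _)
      fun _ => le_rfl).bestBound_le
    · refine (growOrCut_triple hM (hs1'.of_same hs2) hσ (by omega) hL hl h35
        (by rw [hs2.1 _ (by norm_num), h11']) hx.le hv hNM hcmp (fun _ s' hs' hσ' hr => ?_)
        fun _ s' hs' hσ' hr => ?_).bestBound_le
      · exact hF1 s' _ hs' hσ' (by simp [Sweep.grow]; omega) fun r h h' => by
          rw [hr r h h', hs2.1 r h', hs1.1 r h']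
      · exact hF1 s' _ hs' hσ' (Sweep.cut_length_le _ _) fun r h h' => by
          rw [hr r h h', hs2.1 r h', hs1.1 r h']
    · refine (growOrCut_triple hM (hs1'.of_same hs2) hσ (by omega) hL hl h35
        (by rw [hs2.1 _ (by norm_num), h11']) hx.le hv hNM hcmp (fun h39 s' hs' hσ' hr => ?_)
        fun h39 s' hs' hσ' hr => ?_).bestBound_le
      · exact hF s' _ hs' hσ' (by simp [Sweep.grow]; omega) (fun r h h' => by
          rw [hr r h h', hs2.1 r h', hs1.1 r h'])
          (hg.grow hi (fun h hh => hmax h (hσ.H_lt h hh)) hpiv.2 (ht1 h39))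
      · exact hF s' _ hs' hσ' (Sweep.cut_length_le _ _) (fun r h h' => by
          rw [hr r h h', hs2.1 r h', hs1.1 r h'])
          (hg.cut hσ hi' hmax hv hl hpiv.1 (ht0 h39))

/-- The next red point is made active or finished; register `36` says whether there are now too
many active red points. -/
def nextRed : Prog :=
  ld 23 0 (reg 20) ⨟ set 36 (lit 0) ⨟ branch (reg 23)
    (ld 11 1 (reg 20) ⨟ set 33 (reg 20) ⨟ set 39 (lit 1) ⨟
      branch (reg 6) (cmp 39 (reg 10) (reg 20)) skip ⨟
      branch (reg 39) (pushRed ⨟ mul 36 (reg 2) (lit 4) ⨟ eq 36 (reg 4) (reg 36)) finishRed)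
    skip

theorem nextRed_wlp {cmp : ℕ → ℕ → ℕ} (hs : σ.Rep I d s) {ℓ₀ i : ℕ}
    (hσ : σ.Safe I ℓ₀ i) (hi : i < N - 1) (hl : σ.H.length < 4 * σ.ℓ) (hℓ : σ.ℓ ≤ N)
    (h20 : s.reg 20 = i)
    (hNM : 64 * (2 * N + 1) * (2 * N + 1) ≤ M)
    (hcmp : ∀ a < 2 * N, ∀ b < 2 * N, cmp a b = if ν a < ν b then 1 else 0)
    {Q : State → Prop}
    (hQ : ∀ s' (σ' : Sweep), σ'.Rep I d s' → σ'.Safe I ℓ₀ (i + 1) → σ'.ℓ = σ.ℓ →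
      σ'.H.length ≤ σ.H.length + 1 → σ'.L = σ.L →
      (σ.Good I ℓ₀ i → σ'.Good I ℓ₀ (i + 1)) → s'.reg 20 = i → s'.reg 21 = s.reg 21 →
      (s'.reg 36 ≠ 0 → σ'.H.length = 4 * σ'.ℓ ∧ I.red i ∧ s'.reg 11 = I.cb i) →
      (s'.reg 36 = 0 → σ'.H.length < 4 * σ'.ℓ) → Q s') :
    nextRed.wlp M cmp Q s := by
  classical
  have hNM' : 64 * (2 * N + 1) ≤ M := (Nat.le_mul_of_pos_right _ (by omega)).trans hNM
  have hNN : N * N + N < M := by nlinarith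
  have hlit : ∀ n ≤ 63, n < M := fun n hn => by omega
  have hite : ∀ (p : Prop) [Decidable p], (if p then 1 else 0) < M := fun p _ => by
    split_ifs <;> omega
  have e0 := hs.stored.arr_zero i hi
  have e1 := hs.stored.arr_one i (by omega)
  have e2 := I.cb_le i (by omega)
  have e3 := I.nb_le
  have e6 := hs.reg6
  have g1 := hσ.length_le
  simp only [nextRed, wlp_seq, wlp_ld (show 0 < 16 by norm_num), wlp_ld (show 1 < 16 by norm_num),
    wlp_branch, wlp_set, wlp_skip, fits_reg, fits_lit, val_reg, val_lit, State.put_reg,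
    State.put_arr, Nat.reduceEqDiff, if_true, if_false, h20, e0, e1, e6]
  refine ⟨trivial, by omega, by omega, hite _, by omega, by omega, by omega, trivial, fun h => ?_,
    fun h => ?_⟩
  · have hred : ¬ I.red i := by
      intro hr
      simp [hr] at h
    refine hQ _ σ (((hs.put (by norm_num) (by norm_num)).put (by norm_num) (by norm_num)).put
      (by norm_num) (by norm_num)) hσ.succ rfl (by omega) rfl (fun hg => hg.succ hred) ?_ ?_ ?_ ?_
    · simpa using h20
    · simp
    · simp
    · simpa using hl
  · have hred : I.red i := by
      by_contra hr
      simp [hr] at h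
    set s1 := ((((((s.put 60 (16 * i + 0)).put 23 (if I.red i then 1 else 0)).put 36 0).put 60
      (16 * i + 1)).put 11 (I.cb i)).put 33 i).put 39 1 with hs1
    have hs1rep : ∀ z, σ.Rep I d (s1.put 39 z) := fun z =>
      (((((((hs.put (by norm_num) (by norm_num)).put (by norm_num)
        (by norm_num)).put (by norm_num) (by norm_num)).put (by norm_num) (by norm_num)).put
        (by norm_num) (by norm_num)).put (by norm_num) (by norm_num)).put (by norm_num)
        (by norm_num)).put (by norm_num) (by norm_num)
    -- `z` tells whether the red point is above the current threshold; it keeps its default value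
    -- `1` while there is no level.
    have hsplit : ∀ z, (z ≠ 0 → ∀ l ∈ σ.L.getLast?, ν l.1 < ν i) →
        (z = 0 → ∃ l, σ.L.getLast? = some l ∧ ν i ≤ ν l.1) →
        ((branch (reg 39) (pushRed ⨟ mul 36 (reg 2) (lit 4) ⨟ eq 36 (reg 4) (reg 36))
          finishRed).wlp M cmp Q (s1.put 39 z)) := by
      intro z hz1 hz0
      rw [wlp_branch]
      refine ⟨trivial, fun hz => ?_, fun hz => ?_⟩
      · simp at hz
        obtain ⟨l, hl1, hl2⟩ := hz0 hz
        refine wlp_finishRed (hs1rep z) (by omega) (by omega) (by simp [hs1]; omega)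
          (by simp [hs1]; omega) (lt_of_le_of_lt (Nat.add_le_add_right (sum_map_sub_le (fun e he =>
            (hσ.G_lt e he).2.trans e3) (by omega)) _) hNN) fun s' hs' hr ha => ?_
        have f1 := hr 36 (by norm_num) (by norm_num) (by norm_num)
        have f2 := hr 20 (by norm_num) (by norm_num) (by norm_num)
        have f3 := hr 21 (by norm_num) (by norm_num) (by norm_num)
        simp [hs1, h20] at f1 f2 f3
        have e4 : (s1.put 39 z).reg 33 = i := by simp [hs1]
        have e5 : (s1.put 39 z).reg 11 = I.cb i := by simp [hs1]
        rw [e4, e5] at hs'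
        refine hQ s' _ hs' (hσ.emit (by omega)) rfl (by simp [Sweep.emit]) rfl (fun hg =>
          hg.emit hred hl1 hl2 fun l hl => (hσ.L_lt l hl).2.2) f2 f3 (fun h => absurd f1 h)
          fun _ => by simpa [Sweep.emit] using hl
      · simp at hz
        rw [wlp_seq]
        refine wlp_pushRed (hs1rep z) (by omega) (by simp [hs1]; omega) fun s' hs' hr ha => ?_
        have f2 := hr 20 (by norm_num) (by norm_num)
        have f3 := hr 21 (by norm_num) (by norm_num)
        have f4 := hr 11 (by norm_num) (by norm_num)
        simp [hs1, h20] at f2 f3 f4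
        have e4 : (s1.put 39 z).reg 33 = i := by simp [hs1]
        rw [e4] at hs'
        have h2' := hs'.reg2
        have h4' := hs'.reg4
        simp [Sweep.push] at h2' h4'
        simp [h2', h4', hlit, hite]
        refine ⟨by omega, hQ _ _ (hs'.put (by norm_num) (by norm_num)) (hσ.push hl) rfl
          (by simp [Sweep.push]) rfl (fun hg => hg.push hred hl (hz1 hz)) ?_ ?_ ?_ ?_⟩
        · simp [f2]
        · simp [f3]
        · simp [Sweep.push, hred, f4]
          omega
        · simp [Sweep.push]
          omega
    refine ⟨trivial, by omega, by omega, by omega, trivial, by omega, by omega, by omega, by omega,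
      by omega, trivial, fun hL => ?_, fun hL => ?_⟩
    · have := hsplit 1 (fun _ l hl => ?_) fun h => absurd h (by norm_num)
      · simpa [hs1] using this
      · rw [List.length_eq_zero_iff.1 hL] at hl
        simp at hl
    · have hL0 : σ.L ≠ [] := by rintro h; simp [h] at hL
      set l := σ.L.getLast hL0 with hldef
      have hl1 : σ.L.getLast? = some l := List.getLast?_eq_some_getLast hL0
      have h10 : s.reg 10 = l.1 := hs.reg10 l hl1
      have hl2 := (hσ.L_lt l (List.getLast_mem hL0)).1
      have hc : cmp (s.reg 10) (s.reg 20) = if ν l.1 < ν i then 1 else 0 := by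
        rw [h10, h20, hcmp l.1 (by omega) i (by omega)]
      have := hsplit (cmp (s.reg 10) (s.reg 20)) (fun h l' hl' => ?_) fun h => ⟨l, hl1, ?_⟩
      · simpa [hs1] using this
      · rw [hc] at h
        rw [hl1, Option.mem_def, Option.some.injEq] at hl'
        subst hl'
        by_contra h'
        simp [h'] at h
      · rw [hc] at h
        by_contra h'
        simp [not_le.1 h'] at h

end

/-! ### The loop of the sweep: amortized time and union bound -/

section

open Prog Operand

/-- The program is deterministic, so every property of its outcome is decided in advance. Thereby
the time allotted to a sweep step can depend on whether an attempt will follow. -/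
theorem Prog.wlp_or {M : ℕ} {cmp : ℕ → ℕ → ℕ} {p : Prog} {T Q : State → Prop} :
    ∀ s, p.wlp M cmp T s → p.wlp M cmp (fun s => T s ∧ Q s) s ∨
      p.wlp M cmp (fun s => T s ∧ ¬ Q s) s := by
  induction p generalizing T Q with
  | skip => intro s h; by_cases hq : Q s <;> simp_all [Prog.wlp]
  | instr i => intro s; cases i <;> simp only [Prog.wlp] <;> grind
  | seq p q ihp ihq =>
    intro s h
    rcases ihp (Q := q.wlp M cmp (fun s => T s ∧ Q s)) s h with h | h
    · exact .inl (Prog.wlp_mono (p := p) (fun _ h => h.2) s h)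
    · exact .inr (Prog.wlp_mono (p := p) (fun s h => (ihq s h.1).resolve_left h.2) s h)
  | branch a p q ihp ihq =>
    rintro s ⟨h, h0, h1⟩
    by_cases ha : a.val s = 0
    · rcases ihq (Q := Q) s (h0 ha) with h' | h'
      · exact .inl ⟨h, fun _ => h', fun h => absurd ha h⟩
      · exact .inr ⟨h, fun _ => h', fun h => absurd ha h⟩
    · rcases ihp (Q := Q) s (h1 ha) with h' | h'
      · exact .inl ⟨h, fun h => absurd h ha, fun _ => h'⟩
      · exact .inr ⟨h, fun h => absurd h ha, fun _ => h'⟩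
  | loop a p => simp [Prog.wlp]

variable {w M : ℕ} {input : List ℝ} {N : ℕ} {ν : ℕ → ℝ} {s : State} {F : State → ℝ≥0∞} {c : ℝ≥0∞}
variable {I : Instance N ν} {σ : Sweep} {d : ℕ}

theorem Triple.min {p : Prog} {n : ℕ} {c' : ℝ≥0∞} (h : Triple w input p n s c F)
    (h' : Triple w input p n s c' F) : Triple w input p n s (min c c') F :=
  fun k t Φ hk => le_min (h k t Φ hk) (h' k t Φ hk)

/-- One step of the sweep. -/
def sweepStep : Prog :=
  nextRed ⨟ branch (reg 36) attempt skip ⨟ (add 20 (reg 20) (lit 1) ⨟ lt 22 (reg 20) (reg 21))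

/-- The sweep over the red points. -/
def sweep : Prog :=
  (set 4 (lit 0) ⨟ set 5 (lit 0) ⨟ set 6 (lit 0) ⨟ set 7 (lit 0) ⨟ set 20 (lit 0) ⨟
    sub 21 (reg 0) (lit 1) ⨟ lt 22 (reg 20) (reg 21)) ⨟
  loop (reg 22) sweepStep

/-- The sweep is stored and safe, and position `i` comes next. -/
structure Sweep.At (σ : Sweep) (I : Instance N ν) (d ℓ₀ i : ℕ) (s : State) : Prop where
  rep : σ.Rep I d s
  safe : σ.Safe I ℓ₀ i
  length_lt : σ.H.length < 4 * σ.ℓ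
  reg20 : s.reg 20 = i
  reg21 : s.reg 21 = N - 1

theorem Sweep.Safe.ℓ_le_N {ℓ₀ i : ℕ} (h : σ.Safe I ℓ₀ i) (hℓ : ℓ₀ ≤ N) : σ.ℓ ≤ N := by
  rcases h.ℓ_le with h | h <;> omega

/-- The time is amortized with the potential `700 * (|H| - 3 * ℓ)`: an attempt costs `700 * ℓ`,
happens only at `|H| = 4 * ℓ` and leaves `|H| ≤ 3 * ℓ`. Here `n` is the time of the step and `m`
bounds the new potential. The first triple holds always, the second one adds the error of an attempt
if the sweep was good. -/
theorem sweepStep_triple (hM : M ≤ 2 ^ w) {ℓ₀ i : ℕ} (hs : σ.At I d ℓ₀ i s)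
    (hi : i < N - 1) (hℓ : ℓ₀ ≤ N) {δ : ℝ≥0∞}
    (hδ : 4 * ℓ₀ ≤ N → ∃ e, 0 < e ∧ d = 2 * e ∧ d * d ≤ ℓ₀ ∧ attemptError N e ℓ₀ ≤ δ)
    (hNM : 64 * (2 * N + 1) * (2 * N + 1) ≤ M)
    (hcmp : ∀ a < 2 * N, ∀ b < 2 * N, compareInput input a b = if ν a < ν b then 1 else 0) :
    ∃ n m, n + m + 1 ≤ 800 + 700 * (s.reg 4 - 3 * s.reg 2) ∧
      ∀ F, (∀ s' (σ' : Sweep), σ'.At I d ℓ₀ (i + 1) s' →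
        s'.reg 22 = (if i + 1 < N - 1 then 1 else 0) → 700 * (s'.reg 4 - 3 * s'.reg 2) ≤ m →
        F s' ≤ 1) → Triple w input sweepStep n s 1 F ∧ ∀ c, σ.Good I ℓ₀ i →
        (∀ s' (σ' : Sweep), σ'.At I d ℓ₀ (i + 1) s' → σ'.Good I ℓ₀ (i + 1) →
        s'.reg 22 = (if i + 1 < N - 1 then 1 else 0) → 700 * (s'.reg 4 - 3 * s'.reg 2) ≤ m →
        F s' ≤ c) → Triple w input sweepStep n s (c + δ) F := by
  classical
  obtain ⟨hrep, hsafe, hl, h20, h21⟩ := hs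
  have hNM' : 64 * (2 * N + 1) ≤ M := (Nat.le_mul_of_pos_right _ (by omega)).trans hNM
  have hM2 : 2 ≤ M := by omega
  have hlit : ∀ n ≤ 63, n < M := fun n hn => by omega
  have hite : ∀ (p : Prop) [Decidable p], (if p then 1 else 0) < M := fun p _ => by
    split_ifs <;> omega
  have hcost : nextRed.cost ≤ 80 := by simp [nextRed]
  have hT := nextRed_wlp (Q := fun s' => ∃ σ' : Sweep, σ'.Rep I d s' ∧ σ'.Safe I ℓ₀ (i + 1) ∧
      σ'.ℓ = σ.ℓ ∧ σ'.H.length ≤ σ.H.length + 1 ∧ σ'.L = σ.L ∧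
      (σ.Good I ℓ₀ i → σ'.Good I ℓ₀ (i + 1)) ∧ s'.reg 20 = i ∧ s'.reg 21 = s.reg 21 ∧
      (s'.reg 36 ≠ 0 → σ'.H.length = 4 * σ'.ℓ ∧ I.red i ∧ s'.reg 11 = I.cb i) ∧
      (s'.reg 36 = 0 → σ'.H.length < 4 * σ'.ℓ)) hrep hsafe hi hl (hsafe.ℓ_le_N hℓ) h20 hNM hcmp
      fun s' σ' h1 h2 h3 h4 h5 h6 h7 h8 h9 h10 => ⟨σ', h1, h2, h3, h4, h5, h6, h7, h8, h9, h10⟩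
  have hend : ∀ {F : State → ℝ≥0∞} {c : ℝ≥0∞} {s' : State} {σ' : Sweep}, σ'.Rep I d s' →
      σ'.Safe I ℓ₀ (i + 1) → σ'.H.length < 4 * σ'.ℓ → s'.reg 20 = i → s'.reg 21 = N - 1 →
      (∀ s', σ'.At I d ℓ₀ (i + 1) s' → s'.reg 22 = (if i + 1 < N - 1 then 1 else 0) → F s' ≤ c) →
      bestBound w input (add 20 (reg 20) (lit 1) ⨟ lt 22 (reg 20) (reg 21)) 3 F s' ≤ c := by
    intro F c s' σ' h1 h2 h3 h4 h5 h6
    refine bestBound_le_of_wlp hM hM2 (by simp) ?_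
    simp [h4, h5, hlit, hite]
    refine ⟨by omega, h6 _ ⟨(h1.put (by norm_num) (by norm_num)).put (by norm_num) (by norm_num),
      h2, h3, ?_, ?_⟩ ?_⟩
    · simp
    · simp [h5]
    · simp
  have h2' := hrep.reg2
  have h4' := hrep.reg4
  have hpos := hsafe.ℓ_pos
  rcases Prog.wlp_or (Q := fun s' => s'.reg 36 = 0) s hT with hT | hT
  · refine ⟨90, 700 * (σ.H.length + 1 - 3 * σ.ℓ), by omega, fun F hF => ?_⟩
    have key : ∀ c, (∀ s' (σ' : Sweep), σ'.At I d ℓ₀ (i + 1) s' →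
        (σ.Good I ℓ₀ i → σ'.Good I ℓ₀ (i + 1)) →
        s'.reg 22 = (if i + 1 < N - 1 then 1 else 0) →
        700 * (s'.reg 4 - 3 * s'.reg 2) ≤ 700 * (σ.H.length + 1 - 3 * σ.ℓ) → F s' ≤ c) →
        Triple w input sweepStep 90 s c F := by
      intro c hc
      refine .seq_wlp hM hM2 (m := 6) (by omega) (Prog.wlp_mono ?_ s hT)
      rintro s' ⟨⟨σ', h1, h2, h3, h4, h5, h6, h7, h8, h9, h10⟩, h36⟩
      refine .seq (n := 2) (m := 3) (.branch (n := 1) (fun _ => .skip ?_) fun h => absurd h36 h)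
        le_rfl
      refine hend h1 h2 (h10 h36) h7 (by rw [h8, h21]) fun s'' hs'' h22 =>
        hc s'' σ' hs'' h6 h22 ?_
      rw [hs''.rep.reg2, hs''.rep.reg4, h3]
      omega
    exact ⟨key 1 fun s' σ' h1 _ h3 h4 => hF s' σ' h1 h3 h4, fun c hg hc =>
      (key c fun s' σ' h1 h2 h3 h4 => hc s' σ' h1 (h2 hg) h3 h4).mono le_rfl le_self_add
        fun _ => le_rfl⟩
  · obtain ⟨s0, ⟨σ0, h01, h02, h03, h04, h05, h06, h07, h08, h09, -⟩, h0⟩ :=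
      Prog.wlp_nonempty s hT
    have hlen := (h09 h0).1
    have hb := I.cb_lt i (h09 h0).2.1 hi
    -- A full active set has at least `4 * ℓ₀` of the at most `N` red points. So if `4 * ℓ₀ > N` no
    -- attempt ever happens and `hδ` is empty.
    have h4N : 4 * ℓ₀ ≤ N := by
      have h1 := h02.le_ℓ
      have h2 := h02.length_le
      omega
    obtain ⟨e, he, rfl, hdℓ, hδe⟩ := hδ h4N
    have hL := hsafe.L_length_le
    refine ⟨700 * σ.ℓ + 90, 0, by omega, fun F hF => ?_⟩
    have hend' : ∀ {c : ℝ≥0∞} {s' s'' : State} {σ' : Sweep}, s'.reg 20 = i → s'.reg 21 = s.reg 21 →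
        σ'.Rep I (2 * e) s'' → σ'.Safe I ℓ₀ (i + 1) → σ'.H.length ≤ 3 * σ'.ℓ →
        (∀ r, 11 ≤ r → r < 31 → s''.reg r = s'.reg r) →
        (∀ s', σ'.At I (2 * e) ℓ₀ (i + 1) s' → s'.reg 22 = (if i + 1 < N - 1 then 1 else 0) →
          700 * (s'.reg 4 - 3 * s'.reg 2) ≤ 0 → F s' ≤ c) →
        bestBound w input (add 20 (reg 20) (lit 1) ⨟ lt 22 (reg 20) (reg 21)) 3 F s'' ≤ c := by
      intro c s' s'' σ' h1 h2 h3 h4 h5 h6 h7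
      have hp := h4.ℓ_pos
      refine hend h3 h4 (by omega) (by rw [h6 _ (by norm_num) (by norm_num), h1])
        (by rw [h6 _ (by norm_num) (by norm_num), h2, h21]) fun s3 hs3 h22 => h7 s3 hs3 h22 ?_
      rw [hs3.rep.reg2, hs3.rep.reg4]
      omega
    refine ⟨?_, fun c hg hc => ?_⟩
    · refine .seq_wlp hM hM2 (m := 700 * σ.ℓ + 5) (by omega) (Prog.wlp_mono ?_ s hT)
      rintro s' ⟨⟨σ', h1, h2, h3, h4, h5, h6, h7, h8, h9, h10⟩, h36⟩
      obtain ⟨h11, h12, h13⟩ := h9 h36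
      refine .seq (n := 700 * σ.ℓ + 1) (m := 3) (.branch (fun h => absurd h h36) fun _ => ?_)
        (by omega)
      rw [← h3]
      refine attempt_triple_one hM he h1 h2 (by omega) (by rw [h5]; omega) h11 hdℓ h13 hb hNM hcmp
        fun s'' σ'' h1 h2 h3 h4 => hend' h7 h8 h1 h2 h3 h4 fun s3 hs3 => hF s3 σ'' hs3
    · refine .seq_wlp hM hM2 (m := 700 * σ.ℓ + 5) (by omega) (Prog.wlp_mono ?_ s hT)
      rintro s' ⟨⟨σ', h1, h2, h3, h4, h5, h6, h7, h8, h9, h10⟩, h36⟩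
      obtain ⟨h11, h12, h13⟩ := h9 h36
      refine .seq (n := 700 * σ.ℓ + 1) (m := 3) (.branch (fun h => absurd h h36) fun _ => ?_)
        (by omega)
      rw [← h3]
      refine (attempt_triple (c := c) hM he h1 h2 (by omega) (by rw [h5]; omega) h11 hdℓ h13 hb
        (Nat.lt_succ_self i) (fun j hj => I.cb_mono (by omega)) hNM hcmp
        (fun s'' σ'' h1 h2 h3 h4 => hend' h7 h8 h1 h2 h3 h4 fun s3 hs3 => hF s3 σ'' hs3) (h6 hg)
        fun s'' σ'' h1 h2 h3 h4 h5 => hend' h7 h8 h1 h2 h3 h4 fun s3 hs3 => hc s3 σ'' hs3 h5).mono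
        le_rfl (by gcongr) fun _ => le_rfl

/-- Union bound: each red point adds at most `δ` to the probability that the likely invariants get
lost. -/
theorem sweep_triple (hM : M ≤ 2 ^ w) (hI : I.Stored s) {ℓ₀ : ℕ} (h2 : s.reg 2 = ℓ₀)
    (h3 : s.reg 3 = d) (hℓ0 : 0 < ℓ₀) (hℓ : ℓ₀ ≤ N) {δ : ℝ≥0∞}
    (hδ : 4 * ℓ₀ ≤ N → ∃ e, 0 < e ∧ d = 2 * e ∧ d * d ≤ ℓ₀ ∧ attemptError N e ℓ₀ ≤ δ)
    (hNM : 64 * (2 * N + 1) * (2 * N + 1) ≤ M)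
    (hcmp : ∀ a < 2 * N, ∀ b < 2 * N, compareInput input a b = if ν a < ν b then 1 else 0)
    (hF1 : ∀ s' (σ : Sweep), σ.Rep I d s' → σ.Safe I ℓ₀ (N - 1) → F s' ≤ 1)
    (hF : ∀ s' (σ : Sweep), σ.Rep I d s' → σ.Safe I ℓ₀ (N - 1) → σ.Good I ℓ₀ (N - 1) → F s' ≤ c) :
    Triple w input sweep (800 * N + 20) s (c + N * δ) F := by
  classical
  have hNM' : 64 * (2 * N + 1) ≤ M := (Nat.le_mul_of_pos_right _ (by omega)).trans hNM
  have hM2 : 2 ≤ M := by omega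
  have hlit : ∀ n ≤ 63, n < M := fun n hn => by omega
  have hite : ∀ (p : Prop) [Decidable p], (if p then 1 else 0) < M := fun p _ => by
    split_ifs <;> omega
  refine .seq_wlp hM hM2 (m := 800 * (N - 1) + 1) (by simp; omega) ?_
  simp [hlit, hite, hI.reg_zero]
  refine ⟨by omega, ?_⟩
  set s1 := ((((((s.put 4 0).put 5 0).put 6 0).put 7 0).put 20 0).put 21 (N - 1)).put 22
    (if 1 < N then 1 else 0) with hs1
  have h1 : (⟨ℓ₀, [], [], []⟩ : Sweep).At I d ℓ₀ 0 s1 := by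
    constructor
    · refine ⟨by simpa [hs1, Instance.stored_put] using hI, by simp [hs1, h2], by simp [hs1, h3],
        ?_, ?_, ?_, ?_, ?_, ?_, ?_, ?_, ?_, ?_, ?_⟩ <;> simp [hs1, State.Holds]
    · exact ⟨hℓ0, .inl rfl, le_rfl, by simp, by simp, by simp, by simp, by simp, by simp⟩
    · simpa using hℓ0
    · simp [hs1]
    · simp [hs1]
  have hg1 : (⟨ℓ₀, [], [], []⟩ : Sweep).Good I ℓ₀ 0 := by
    constructor <;> simp [Instance.reds]
  have key := Triple.loop (w := w) (input := input) (a := reg 22) (p := sweepStep) (F := F)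
    (fun t => t.reg 20 ≤ N - 1 ∧ (∃ σ : Sweep, σ.At I d ℓ₀ (t.reg 20) t) ∧
      t.reg 22 = if t.reg 20 < N - 1 then 1 else 0)
    (fun t => 800 * (N - 1 - t.reg 20) + 700 * (t.reg 4 - 3 * t.reg 2))
    -- Once the likely invariants are lost, only the trivial bound `1` remains; the number of red
    -- points still to come counts the possible failures.
    (fun t => if ∃ σ : Sweep, σ.At I d ℓ₀ (t.reg 20) t ∧ σ.Good I ℓ₀ (t.reg 20) then
      min 1 (c + (N - 1 - t.reg 20 : ℕ) * δ) else 1) ?_ ?_ s1 ?_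
  · refine key.mono ?_ ?_ fun _ => le_rfl
    · simp [hs1]
    · rw [if_pos]
      · refine (min_le_right _ _).trans ?_
        gcongr
        omega
      · exact ⟨_, by simpa [hs1] using h1, by simpa [hs1] using hg1⟩
  · rintro t ⟨g1, ⟨σ, hσ⟩, g2⟩ h22
    have h22' : t.reg 22 = 0 := h22
    have g3 : t.reg 20 = N - 1 := by
      by_contra h
      rw [if_pos (by omega)] at g2
      omega
    rw [g3] at hσ ⊢
    split_ifs with h
    · obtain ⟨σ', hσ', hg'⟩ := h
      refine le_min (hF1 t σ hσ.rep hσ.safe) ?_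
      exact (hF t σ' hσ'.rep hσ'.safe hg').trans le_self_add
    · exact hF1 t σ hσ.rep hσ.safe
  · rintro t ⟨g1, ⟨σ, hσ⟩, g2⟩ h22
    have h22' : t.reg 22 ≠ 0 := h22
    have g3 : t.reg 20 < N - 1 := by
      by_contra h
      rw [if_neg h] at g2
      omega
    obtain ⟨i, hi⟩ : ∃ i, t.reg 20 = i := ⟨_, rfl⟩
    rw [hi] at hσ g1 g2 g3
    have post : ∀ {c' : ℝ≥0∞} {s' : State} {σ' : Sweep} {n m : ℕ},
        n + m + 1 ≤ 800 + 700 * (t.reg 4 - 3 * t.reg 2) → σ'.At I d ℓ₀ (i + 1) s' →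
        s'.reg 22 = (if i + 1 < N - 1 then 1 else 0) → 700 * (s'.reg 4 - 3 * s'.reg 2) ≤ m →
        (if ∃ σ : Sweep, σ.At I d ℓ₀ (i + 1) s' ∧ σ.Good I ℓ₀ (i + 1) then
          min 1 (c + (N - 1 - (i + 1) : ℕ) * δ) else 1) ≤ c' →
        (if (s'.reg 20 ≤ N - 1 ∧ (∃ σ : Sweep, σ.At I d ℓ₀ (s'.reg 20) s') ∧
          s'.reg 22 = if s'.reg 20 < N - 1 then 1 else 0) ∧
          800 * (N - 1 - s'.reg 20) + 700 * (s'.reg 4 - 3 * s'.reg 2) + n + 1 ≤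
          800 * (N - 1 - t.reg 20) + 700 * (t.reg 4 - 3 * t.reg 2) then
          (if ∃ σ : Sweep, σ.At I d ℓ₀ (s'.reg 20) s' ∧ σ.Good I ℓ₀ (s'.reg 20) then
      min 1 (c + (N - 1 - s'.reg 20 : ℕ) * δ) else 1) else ⊤) ≤ c' := by
      intro c' s' σ' n m f1 f2 f3 f4 f5
      rw [f2.reg20, hi, if_pos ⟨⟨by omega, ⟨σ', f2⟩, f3⟩, by omega⟩]
      exact f5
    have hle1 : ∀ s', (if ∃ σ : Sweep, σ.At I d ℓ₀ (i + 1) s' ∧ σ.Good I ℓ₀ (i + 1) then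
          min 1 (c + (N - 1 - (i + 1) : ℕ) * δ) else 1) ≤ 1 := fun s' => by
      split_ifs
      · exact min_le_left _ _
      · exact le_rfl
    by_cases hg : ∃ σ : Sweep, σ.At I d ℓ₀ i t ∧ σ.Good I ℓ₀ i
    · obtain ⟨σ', hσ', hg'⟩ := hg
      obtain ⟨n, m, hnm, h⟩ := sweepStep_triple hM hσ' g3 hℓ hδ hNM hcmp
      refine ⟨n, ?_, ?_⟩
      · rw [hi]
        omega
      simp only [hi]
      rw [if_pos ⟨σ', hσ', hg'⟩]
      obtain ⟨ha, hb⟩ := h (fun s' => if (s'.reg 20 ≤ N - 1 ∧ (∃ σ : Sweep, σ.At I d ℓ₀ (s'.reg 20) s') ∧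
          s'.reg 22 = if s'.reg 20 < N - 1 then 1 else 0) ∧
          800 * (N - 1 - s'.reg 20) + 700 * (s'.reg 4 - 3 * s'.reg 2) + n + 1 ≤
          800 * (N - 1 - t.reg 20) + 700 * (t.reg 4 - 3 * t.reg 2) then
          (if ∃ σ : Sweep, σ.At I d ℓ₀ (s'.reg 20) s' ∧ σ.Good I ℓ₀ (s'.reg 20) then
      min 1 (c + (N - 1 - s'.reg 20 : ℕ) * δ) else 1) else ⊤)
        fun s' σ'' f1 f2 f3 => post hnm f1 f2 f3 (hle1 s')
      rw [hi] at ha hb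
      refine ha.min ((hb (c + (N - 1 - (i + 1) : ℕ) * δ) hg' fun s' σ'' f1 f0 f2 f3 => ?_).mono
        le_rfl ?_ fun _ => le_rfl)
      · rw [← hi]
        refine post hnm f1 f2 f3 ?_
        rw [if_pos ⟨σ'', f1, f0⟩, hi]
        exact min_le_right _ _
      · rw [show N - 1 - i = N - 1 - (i + 1) + 1 by omega]
        push_cast
        rw [add_mul, one_mul, add_assoc]
    · obtain ⟨n, m, hnm, h⟩ := sweepStep_triple hM hσ g3 hℓ hδ hNM hcmp
      refine ⟨n, ?_, ?_⟩
      · rw [hi]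
        omega
      simp only [hi]
      rw [if_neg hg]
      refine (h _ fun s' σ'' f1 f2 f3 => ?_).1
      rw [← hi]
      exact post hnm f1 f2 f3 (hle1 s')
  · refine ⟨by simp [hs1], ⟨_, by simpa [hs1] using h1⟩, ?_⟩
    simp [hs1]

end

/-! ### Output of the sweep: finished red points and levels -/

section

open Prog Operand

variable {w M : ℕ} {input : List ℝ} {N : ℕ} {ν : ℕ → ℝ} {s : State} {F : State → ℝ≥0∞} {c : ℝ≥0∞}
variable {I : Instance N ν} {σ : Sweep} {d : ℕ}

/-! ### The result of the sweep -/

/-- Red points and levels. Red point `GP e` is to be paired with the blue points from number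
`I.cb (GP e)` to number `GX e` directly. The pairs with the remaining blue points are found with the
help of the levels: level `t` is concerned with the red points from number `LG t` to number
`LG (t + 1)` and with the blue points from number `LX t` on which are below the point `LV t`. -/
structure Family (I : Instance N ν) where
  g : ℕ
  nL : ℕ
  GP : ℕ → ℕ
  GX : ℕ → ℕ
  LV : ℕ → ℕ
  LX : ℕ → ℕ
  LG : ℕ → ℕ
  g_le : g ≤ N
  nL_le : nL ≤ N
  GP_lt : ∀ e < g, GP e < N
  GX_le : ∀ e < g, GX e ≤ I.nb
  LV_lt : ∀ t < nL, LV t < N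
  LX_le : ∀ t < nL, LX t ≤ I.nb
  LG_le : ∀ t ≤ nL, LG t ≤ g

/-- The properties which are likely to hold. -/
structure Family.Good (A : Family I) (ℓ : ℕ) : Prop where
  total_eq : I.total = ∑ e ∈ range A.g, I.below (I.cb (A.GP e)) (A.GP e)
  g_eq : A.g = (I.reds (N - 1)).length
  range : ∀ e < A.g, I.cb (A.GP e) ≤ A.GX e
  cover : ∀ e < A.g, ∀ b < I.nb, A.GX e ≤ b → ν (I.bp b) < ν (A.GP e) →
    ∃ t < A.nL, A.LG t ≤ e ∧ e < A.LG (t + 1) ∧ A.LX t ≤ b ∧ ν (I.bp b) < ν (A.LV t)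
  LX_mono : ∀ t t', t ≤ t' → t' < A.nL → A.LX t ≤ A.LX t'
  LV_mono : ∀ t t', t ≤ t' → t' < A.nL → ν (A.LV t) ≤ ν (A.LV t')
  LG_mono : ∀ t t', t ≤ t' → t' ≤ A.nL → A.LG t ≤ A.LG t'
  mass : ∑ e ∈ Finset.range A.g, (A.GX e - I.cb (A.GP e)) ≤ 4 * ℓ * I.nb
  below_le : ∀ t < A.nL, I.below (A.LX t) (A.LV t) ≤ 2 * ℓ
  sum_below_le : ∑ t ∈ Finset.range A.nL, I.below (A.LX t) (A.LV t) ≤ 2 * A.g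

/-- The family is stored in registers `5`, `6`, `7` and arrays `4` to `8`. -/
structure Family.Stored (A : Family I) (s : State) : Prop where
  stored : I.Stored s
  reg5 : s.reg 5 = A.g
  reg6 : s.reg 6 = A.nL
  reg7 : s.reg 7 = ∑ e ∈ range A.g, (A.GX e - I.cb (A.GP e))
  arr4 : ∀ e < A.g, s.arr 4 e = A.GP e
  arr5 : ∀ e < A.g, s.arr 5 e = A.GX e
  arr6 : ∀ t < A.nL, s.arr 6 t = A.LV t
  arr7 : ∀ t < A.nL, s.arr 7 t = A.LX t
  arr8 : ∀ t ≤ A.nL, s.arr 8 t = A.LG t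

theorem sum_map_eq_sum_range {α : Type*} (l : List α) (a : α) (f : α → ℕ) :
    (l.map f).sum = ∑ i ∈ range l.length, f (l.getD i a) := by
  induction l using List.reverseRecOn with
  | nil => simp
  | append_singleton l b ih =>
    rw [List.length_append, List.length_singleton, sum_range_succ, List.map_append,
      List.sum_append, ih]
    congr 1
    · exact sum_congr rfl fun i hi => by rw [List.getD_append _ _ _ _ (mem_range.1 hi)]
    · simp

namespace Sweep

/-- The finished red points, after the first `j` active ones were finished. -/
def flushAux (σ : Sweep) (x j : ℕ) : Sweep :=
  { σ with G := σ.G ++ (σ.H.take j).map fun h => (h, x) }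

theorem flushAux_succ {x j : ℕ} (hj : j < σ.H.length) :
    σ.flushAux x (j + 1) = (σ.flushAux x j).emit (σ.H.getD j 0) x := by
  rw [List.getD_eq_getElem _ _ hj]
  simp [flushAux, Sweep.emit, List.take_succ_eq_append_getElem hj, -List.take_append_getElem]

theorem flushAux_length (x j : ℕ) (hj : j ≤ σ.H.length) :
    (σ.flushAux x j).G.length = σ.G.length + j := by
  simp [flushAux, hj]

/-- The red points and levels which result from the sweep. -/
def family (σ : Sweep) (I : Instance N ν) {ℓ₀ : ℕ} (hσ : σ.Safe I ℓ₀ (N - 1)) : Family I where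
  g := σ.G.length + σ.H.length
  nL := σ.L.length
  GP := fun e => ((σ.G ++ σ.H.map fun h => (h, I.nb)).getD e (0, 0)).1
  GX := fun e => ((σ.G ++ σ.H.map fun h => (h, I.nb)).getD e (0, 0)).2
  LV := fun t => (σ.L.getD t (0, 0, 0)).1
  LX := fun t => (σ.L.getD t (0, 0, 0)).2.1
  -- The value at the end of the list closes the last group. Red points flushed after the sweep come
  -- later and belong to no level.
  LG := fun t => if t < σ.L.length then (σ.L.getD t (0, 0, 0)).2.2 else σ.G.length
  g_le := by have := hσ.length_le; omega
  nL_le := hσ.L_length_le.trans (Nat.sub_le _ _)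
  GP_lt := fun e he => by
    have he' : e < (σ.G ++ σ.H.map fun h => (h, I.nb)).length := by simpa using he
    rw [List.getD_eq_getElem _ _ he']
    have := List.getElem_mem he'
    generalize (σ.G ++ σ.H.map fun h => (h, I.nb))[e] = x at *
    simp only [List.mem_append, List.mem_map] at this
    rcases this with h | ⟨y, h, rfl⟩
    · have := (hσ.G_lt x h).1
      omega
    · have := hσ.H_lt y h
      simp
      omega
  GX_le := fun e he => by
    have he' : e < (σ.G ++ σ.H.map fun h => (h, I.nb)).length := by simpa using he
    rw [List.getD_eq_getElem _ _ he']
    have := List.getElem_mem he'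
    generalize (σ.G ++ σ.H.map fun h => (h, I.nb))[e] = x at *
    simp only [List.mem_append, List.mem_map] at this
    rcases this with h | ⟨y, h, rfl⟩
    · exact (hσ.G_lt x h).2
    · exact le_rfl
  LV_lt := fun t ht => by
    rw [List.getD_eq_getElem _ _ ht]
    have := (hσ.L_lt _ (List.getElem_mem ht)).1
    omega
  LX_le := fun t ht => by
    rw [List.getD_eq_getElem _ _ ht]
    exact (hσ.L_lt _ (List.getElem_mem ht)).2.1
  LG_le := fun t _ => by
    split_ifs with h
    · rw [List.getD_eq_getElem _ _ h]
      have := (hσ.L_lt _ (List.getElem_mem h)).2.2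
      omega
    · omega

theorem family_good {ℓ₀ : ℕ} (hσ : σ.Safe I ℓ₀ (N - 1)) (hg : σ.Good I ℓ₀ (N - 1)) :
    (σ.family I hσ).Good σ.ℓ where
  total_eq := by
    rw [Instance.total, ← (hg.perm.map _).sum_eq]
    have := sum_map_eq_sum_range (σ.G ++ σ.H.map fun h => (h, I.nb)) (0, 0)
      fun e => I.below (I.cb e.1) e.1
    simp only [List.length_append, List.length_map] at this
    rw [family, ← this]
    simp [add_comm, Function.comp_def]
  g_eq := by
    rw [← hg.perm.length_eq]
    simp [family, add_comm]
  range := fun e he => by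
    have he' : e < (σ.G ++ σ.H.map fun h => (h, I.nb)).length := by simpa [family] using he
    simp only [family]
    rw [List.getD_eq_getElem _ _ he']
    have := List.getElem_mem he'
    generalize (σ.G ++ σ.H.map fun h => (h, I.nb))[e] = x at *
    simp only [List.mem_append, List.mem_map] at this
    rcases this with h | ⟨y, h, rfl⟩
    · exact hg.range x h
    · exact I.cb_le y (by have := hσ.H_lt y h; omega)
  cover := fun e he b hb hx hν => by
    have he' : e < (σ.G ++ σ.H.map fun h => (h, I.nb)).length := by simpa [family] using he
    simp only [family] at hx hν ⊢
    by_cases heG : e < σ.G.length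
    · rw [List.getD_append _ _ _ _ heG, List.getD_eq_getElem _ _ heG] at hx hν
      obtain ⟨t, ht, h1, h2, h3, h4⟩ := hg.group e heG
      refine ⟨t, ht, ?_, ?_, ?_, ?_⟩
      · rwa [if_pos ht, List.getD_eq_getElem _ _ ht]
      · split_ifs with h5
        · rw [List.getD_eq_getElem _ _ h5]
          exact h2 _ h5 (Nat.lt_succ_self t)
        · exact heG
      · rw [List.getD_eq_getElem _ _ ht]
        exact h3.trans hx
      · rw [List.getD_eq_getElem _ _ ht]
        exact hν.trans_le h4
    -- A red point active to the end has all its blue points as direct candidates, so none is left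
    -- for the levels.
    · rw [List.getD_eq_getElem _ _ he', List.getElem_append_right (by omega)] at hx
      simp at hx
      omega
  LX_mono := fun t t' h h' => by
    simp only [family] at h' ⊢
    rcases h.eq_or_lt with rfl | h
    · exact le_rfl
    · rw [List.getD_eq_getElem _ _ h', List.getD_eq_getElem _ _ (h.trans h')]
      exact (List.pairwise_iff_getElem.1 hg.sorted t t' (h.trans h') h' h).2.1
  LV_mono := fun t t' h h' => by
    simp only [family] at h' ⊢
    rcases h.eq_or_lt with rfl | h
    · exact le_rfl
    · rw [List.getD_eq_getElem _ _ h', List.getD_eq_getElem _ _ (h.trans h')]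
      exact (List.pairwise_iff_getElem.1 hg.sorted t t' (h.trans h') h' h).1
  LG_mono := fun t t' h h' => by
    simp only [family] at h' ⊢
    rcases h.eq_or_lt with rfl | h
    · exact le_rfl
    · have ht : t < σ.L.length := by omega
      rw [if_pos ht, List.getD_eq_getElem _ _ ht]
      split_ifs with ht'
      · rw [List.getD_eq_getElem _ _ ht']
        exact (List.pairwise_iff_getElem.1 hg.sorted t t' ht ht' h).2.2
      · exact (hσ.L_lt _ (List.getElem_mem ht)).2.2
  mass := by
    have h1 := hg.mass I.nb fun i' hi' => I.cb_le i' (by omega)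
    have h2 := sum_map_eq_sum_range (σ.G ++ σ.H.map fun h => (h, I.nb)) (0, 0)
      fun e => e.2 - I.cb e.1
    simp only [List.length_append, List.length_map] at h2
    simp only [family]
    rw [← h2]
    simpa [Function.comp_def] using h1
  below_le := fun t ht => by
    simp only [family] at ht ⊢
    rw [List.getD_eq_getElem _ _ ht]
    exact hg.below_le _ (List.getElem_mem ht)
  sum_below_le := by
    have h1 := hg.sum_below_le
    rw [sum_map_eq_sum_range σ.L (0, 0, 0)] at h1
    simp only [family]
    omega

end Sweep

/-- The remaining active red points are finished. -/
def flush : Prog :=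
  (st 8 (reg 6) (reg 5) ⨟ set 11 (reg 1) ⨟ set 38 (lit 0) ⨟ lt 22 (reg 38) (reg 4)) ⨟
  loop (reg 22)
    (ld 33 3 (reg 38) ⨟ finishRed ⨟ add 38 (reg 38) (lit 1) ⨟ lt 22 (reg 38) (reg 4))

theorem flush_triple (hM : M ≤ 2 ^ w) {ℓ₀ : ℕ} (hs : σ.Rep I d s)
    (hσ : σ.Safe I ℓ₀ (N - 1)) (hNM : 64 * (2 * N + 1) * (2 * N + 1) ≤ M)
    (hF : ∀ s', (σ.family I hσ).Stored s' → F s' ≤ c) :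
    Triple w input flush (60 * N + 20) s c F := by
  have hnb := I.nb_le
  have hNM' : 64 * (2 * N + 1) ≤ M := (Nat.le_mul_of_pos_right _ (by omega)).trans hNM
  have hNN : N * N + N < M := by nlinarith
  have hM2 : 2 ≤ M := by omega
  have hlit : ∀ n ≤ 63, n < M := fun n hn => by omega
  have hite : ∀ (p : Prop) [Decidable p], (if p then 1 else 0) < M := fun p _ => by
    split_ifs <;> omega
  obtain ⟨n, hn⟩ : ∃ n, σ.H.length = n := ⟨_, rfl⟩
  have g1 := hσ.length_le
  have g2 := hσ.L_length_le
  rw [hn] at g1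
  have h4 := hs.reg4
  have h5 := hs.reg5
  have h6 := hs.reg6
  have h1 := hs.stored.reg_one
  rw [hn] at h4
  refine .seq_wlp hM hM2 (m := 60 * n + 1) (by simp; omega) ?_
  simp [hlit, hite, wlp_st, h1, h4, h5, h6]
  refine ⟨by omega, by omega, by omega, ?_⟩
  refine .loop_wlp hM hM2 (fun t => ∃ j, t.reg 38 = j ∧ j ≤ n ∧
    (σ.flushAux I.nb j).Rep I d t ∧ t.reg 11 = I.nb ∧
    t.reg 22 = (if j < n then 1 else 0) ∧ t.arr 8 σ.L.length = σ.G.length)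
    (fun t => n - t.reg 38) ?_ ?_ ?_ ?_
  · refine ⟨0, by simp, by omega, ?_, by simp, by simp, by simp [State.sto_arr]⟩
    obtain ⟨h0, h2, h3, h4, h5, h6, h7, h8, a3, a4, a5, a6, a7, a8⟩ := hs
    have b8 := State.Holds.concat (k := 8) (by norm_num) a8 σ.G.length
    have a8' : (s.sto 8 σ.L.length σ.G.length).Holds 8 (σ.L.map fun l => l.2.2) := by
      intro i hi
      rw [List.length_map] at hi
      rw [State.sto_arr (by norm_num) (by norm_num), if_neg (by omega)]
      exact a8 i (by simpa using hi)
    refine ⟨?_, by simpa [Sweep.flushAux] using h2, by simpa using h3,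
      by simpa [Sweep.flushAux] using h4,
      by simpa [Sweep.flushAux] using h5, by simpa [Sweep.flushAux] using h6,
      by simpa [Sweep.flushAux] using h7, by simpa [Sweep.flushAux] using h8, ?_, ?_, ?_, ?_, ?_, ?_⟩
    · simpa [Instance.stored_put, Instance.stored_sto] using h0
    · simpa [Sweep.flushAux, State.holds_sto_of_ne] using a3
    · simpa [Sweep.flushAux, State.holds_sto_of_ne] using a4
    · simpa [Sweep.flushAux, State.holds_sto_of_ne] using a5
    · simpa [Sweep.flushAux, State.holds_sto_of_ne] using a6
    · simpa [Sweep.flushAux, State.holds_sto_of_ne] using a7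
    · simpa [Sweep.flushAux, State.Holds, State.sto_arr] using a8'
  · simp
    omega
  · rintro t ⟨j, h38, hj, hrep, h11, h22, h8⟩ h22'
    rw [h22] at h22'
    have hjn : j < n := by
      by_contra h
      simp [h] at h22'
    obtain ⟨y, hy⟩ : ∃ y, σ.H.getD j 0 = y := ⟨_, rfl⟩
    have e1 : t.arr 3 j = σ.H.getD j 0 := hrep.arr3 j (by simp [Sweep.flushAux]; omega)
    have e0 : t.reg 4 = n := hrep.reg4.trans hn
    rw [hy] at e1
    have e2 : y ∈ σ.H := by
      rw [← hy, List.getD_eq_getElem _ _ (by omega)]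
      exact List.getElem_mem _
    have e3 := hσ.H_lt _ e2
    have e4 := Sweep.flushAux_length (σ := σ) I.nb j (by omega)
    have hrep' : ∀ b, (σ.flushAux I.nb j).Rep I d ((t.put 60 b).put 33 y) :=
      fun b => (hrep.put (by norm_num) (by norm_num)).put (by norm_num) (by norm_num)
    simp only [wlp_seq, wlp_ld (show 3 < 16 by norm_num), fits_reg, true_and, val_reg,
      h38, e1]
    refine ⟨by omega, by omega, by omega, ?_⟩
    refine wlp_finishRed (hrep' _) (by omega) (by omega) (by simp; omega)
      (by simp [h11]; omega) ?_ fun s' hs' hr' ha' => ?_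
    · refine lt_of_le_of_lt (Nat.add_le_add_right (sum_map_sub_le (fun e he => ?_)
        (by omega)) _) hNN
      simp only [Sweep.flushAux, List.mem_append, List.mem_map] at he
      rcases he with he | ⟨z, hz, rfl⟩
      · exact (hσ.G_lt e he).2.trans hnb
      · exact hnb
    · have f1 := hr' 38 (by norm_num) (by norm_num) (by norm_num)
      have f2 := hr' 11 (by norm_num) (by norm_num) (by norm_num)
      have f3 : s'.reg 4 = n := hs'.reg4.trans (by simpa [Sweep.emit, Sweep.flushAux] using hn)
      have f4 := ha' 8 (by norm_num) σ.L.length (by norm_num) (by norm_num)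
      simp [h38, h11, h8] at f1 f2 f4
      simp [f1, f2, f3, f4, hlit, hite]
      refine ⟨by omega, ⟨by omega, ?_⟩, by omega⟩
      rw [Sweep.flushAux_succ (by omega), hy]
      have := (hs'.put (x := 38) (v := j + 1) (by norm_num) (by norm_num)).put (x := 22)
        (v := if j + 1 < n then 1 else 0) (by norm_num) (by norm_num)
      simpa [h11] using this
  · rintro t ⟨j, h38, hj, hrep, h11, h22, h8⟩ h22'
    rw [h22] at h22'
    have hjn : j = n := by
      by_contra h
      rw [if_pos (by omega)] at h22'
      omega
    subst hjn
    rw [← hn] at hrep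
    have hG : (σ.flushAux I.nb σ.H.length).G = σ.G ++ σ.H.map fun h => (h, I.nb) := by
      simp [Sweep.flushAux]
    have hlen : (σ.G ++ σ.H.map fun h => (h, I.nb)).length = σ.G.length + σ.H.length := by simp
    have h7 := hrep.reg7
    have a4 := hrep.arr4
    have a5 := hrep.arr5
    rw [hG] at h7 a4 a5
    rw [sum_map_eq_sum_range _ (0, 0), hlen] at h7
    have hget : ∀ {α : Type} (l : List α) (f : α → ℕ) (x : α) (e : ℕ), e < l.length →
        (l.map f).getD e 0 = f (l.getD e x) := by
      intro α l f x e he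
      rw [List.getD_eq_getElem _ _ (by simpa using he), List.getD_eq_getElem _ _ he,
        List.getElem_map]
    refine hF t ⟨hrep.stored, ?_, hrep.reg6, h7, fun e he => ?_, fun e he => ?_, fun e he => ?_,
      fun e he => ?_, fun e he => ?_⟩
    · rw [hrep.reg5, hG, hlen, Sweep.family]
    · have he' : e < (σ.G ++ σ.H.map fun h => (h, I.nb)).length := by rw [hlen]; exact he
      rw [a4 e (by simpa using he'), hget _ _ (0, 0) _ he', Sweep.family]
    · have he' : e < (σ.G ++ σ.H.map fun h => (h, I.nb)).length := by rw [hlen]; exact he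
      rw [a5 e (by simpa using he'), hget _ _ (0, 0) _ he', Sweep.family]
    · have he' : e < σ.L.length := he
      exact (hrep.arr6 e (by simpa [Sweep.flushAux] using he')).trans
        (hget σ.L _ (0, 0, 0) _ he')
    · have he' : e < σ.L.length := he
      exact (hrep.arr7 e (by simpa [Sweep.flushAux] using he')).trans
        (hget σ.L _ (0, 0, 0) _ he')
    · have he' : e ≤ σ.L.length := he
      simp only [Sweep.family]
      split_ifs with h
      · exact (hrep.arr8 e (by simpa [Sweep.flushAux] using h)).trans
          (hget σ.L _ (0, 0, 0) _ h)
      · rw [← h8]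
        congr
        omega

end

/-! ### For each blue point, an interval of finished red points -/

section

open Prog Operand

variable {w M : ℕ} {input : List ℝ} {N : ℕ} {ν : ℕ → ℝ} {s : State} {F : State → ℝ≥0∞} {c : ℝ≥0∞}
variable {I : Instance N ν} {A : Family I}

/-! ### Assigning intervals of red points to the blue points -/

open Classical in
/-- The levels which are concerned with blue point number `b`. -/
def Family.levels (A : Family I) (b : ℕ) : Finset ℕ :=
  {t ∈ range A.nL | A.LX t ≤ b ∧ ν (I.bp b) < ν (A.LV t)}

/-- Double counting of the incidences between levels and blue points. -/
theorem Family.sum_card_levels_mul (A : Family I) (f : ℕ → ℕ) :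
    ∑ b ∈ range I.nb, ∑ t ∈ A.levels b, f t =
      ∑ t ∈ range A.nL, I.below (A.LX t) (A.LV t) * f t := by
  classical
  simp only [Family.levels, sum_filter, Instance.below]
  rw [sum_comm]
  refine sum_congr rfl fun t _ => ?_
  rw [← sum_filter, sum_const, smul_eq_mul]
  congr 2
  ext b
  simp
  tauto

theorem sub_le_sum_Ico (f : ℕ → ℕ) {a b : ℕ} (h : a ≤ b) :
    f b - f a ≤ ∑ t ∈ Ico a b, (f (t + 1) - f t) := by
  induction b, h using Nat.le_induction with
  | base => simp
  | succ b h ih =>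
    rw [sum_Ico_succ_top h]
    omega

/-- The interval contains the numbers of all red points which are paired with blue point number `b`
with the help of the levels. -/
def Family.Covers (A : Family I) (b lo hi : ℕ) : Prop :=
  ∀ e < A.g, A.GX e ≤ b → ν (I.bp b) < ν (A.GP e) → lo ≤ e ∧ e < hi

theorem Family.Ico_subset_levels {b lo hi : ℕ} (hhi : hi ≤ A.nL) (h1 : ∀ t < hi, A.LX t ≤ b)
    (h2 : ∀ t, lo ≤ t → t < hi → ν (I.bp b) < ν (A.LV t)) : Ico lo hi ⊆ A.levels b := by
  classical
  intro t ht
  obtain ⟨h3, h4⟩ := mem_Ico.1 ht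
  exact mem_filter.2 ⟨mem_range.2 (h4.trans_le hhi), h1 t h4, h2 t h3 h4⟩

theorem Family.sub_le_sum_levels {b lo hi : ℕ} (hlo : lo ≤ hi) (hhi : hi ≤ A.nL)
    (h1 : ∀ t < hi, A.LX t ≤ b) (h2 : ∀ t, lo ≤ t → t < hi → ν (I.bp b) < ν (A.LV t)) :
    A.LG hi - A.LG lo ≤ ∑ t ∈ A.levels b, (A.LG (t + 1) - A.LG t) :=
  (sub_le_sum_Ico A.LG hlo).trans
    (sum_le_sum_of_subset (Family.Ico_subset_levels hhi h1 h2))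

/-- Starting positions and thresholds increase along the levels. So the relevant levels are those
from some number on, by height, and before some number, by position. The two negated tests say that
`lo` and `hi` enclose this range. -/
theorem Family.Good.covers {ℓ : ℕ} (h : A.Good ℓ) {b lo hi : ℕ} (hb : b < I.nb) (hlo : lo ≤ hi)
    (hhi : hi ≤ A.nL) (h1 : ¬ (hi < A.nL ∧ A.LX hi ≤ b))
    (h2 : ¬ (lo ≠ 0 ∧ ν (I.bp b) < ν (A.LV (lo - 1)))) : A.Covers b (A.LG lo) (A.LG hi) := by
  intro e he hx hν
  obtain ⟨t, ht, g1, g2, g3, g4⟩ := h.cover e he b hb hx hν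
  have h3 : t < hi := by
    by_contra h3
    exact h1 ⟨by omega, (h.LX_mono hi t (by omega) ht).trans g3⟩
  have h4 : lo ≤ t := by
    by_contra h4
    exact h2 ⟨by omega, g4.trans_le (h.LV_mono t (lo - 1) (by omega) (by omega))⟩
  exact ⟨(h.LG_mono lo t h4 ht.le).trans g1, g2.trans_le (h.LG_mono (t + 1) hi h3 hhi)⟩

/-- Each level concerns at most `2 * ℓ` blue points, and the lengths of the groups telescope to at
most `A.g`. -/
theorem Family.Good.sum_levels_le {ℓ : ℕ} (h : A.Good ℓ) :
    ∑ b ∈ Finset.range I.nb, ∑ t ∈ A.levels b, (A.LG (t + 1) - A.LG t) ≤ 2 * ℓ * A.g := by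
  have hsum : ∀ n ≤ A.nL, ∑ t ∈ Finset.range n, (A.LG (t + 1) - A.LG t) = A.LG n - A.LG 0 := by
    intro n hn
    induction n with
    | zero => simp
    | succ n ih =>
      rw [sum_range_succ, ih (by omega)]
      have := h.LG_mono 0 n (by omega) (by omega)
      have := h.LG_mono n (n + 1) (by omega) hn
      omega
  rw [A.sum_card_levels_mul]
  calc _ ≤ ∑ t ∈ Finset.range A.nL, 2 * ℓ * (A.LG (t + 1) - A.LG t) :=
        sum_le_sum fun t ht => Nat.mul_le_mul_right _ (h.below_le t (mem_range.1 ht))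
    _ ≤ _ := by
        rw [← mul_sum, hsum _ le_rfl]
        exact Nat.mul_le_mul_left _ ((Nat.sub_le _ _).trans (A.LG_le _ le_rfl))

/-- Register `39` says whether the next level has to be taken into account. -/
def upTest : Prog :=
  lt 39 (reg 21) (reg 6) ⨟
  branch (reg 39) (ld 34 7 (reg 21) ⨟ lt 34 (reg 20) (reg 34) ⨟ sub 39 (lit 1) (reg 34)) skip

/-- Register `39` says whether the previous level is relevant. -/
def downTest : Prog :=
  set 39 (lit 0) ⨟
  branch (reg 24) (sub 35 (reg 24) (lit 1) ⨟ ld 36 6 (reg 35) ⨟ ld 37 2 (reg 20) ⨟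
    cmp 39 (reg 37) (reg 36)) skip

/-- The interval of the current blue point is stored. -/
def storeInterval : Prog :=
  ld 36 8 (reg 24) ⨟ ld 37 8 (reg 21) ⨟ st 9 (reg 20) (reg 36) ⨟
  st 10 (reg 20) (reg 37) ⨟ sub 36 (reg 37) (reg 36) ⨟ add 7 (reg 7) (reg 36) ⨟
  add 20 (reg 20) (lit 1) ⨟ set 24 (reg 21)

/-- One step of `assignIntervals`. -/
def assignStep : Prog :=
  sub 23 (reg 23) (lit 1) ⨟ upTest ⨟
  branch (reg 39) (add 21 (reg 21) (lit 1) ⨟ set 24 (reg 21))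
    (downTest ⨟ branch (reg 39) (set 24 (reg 35)) storeInterval) ⨟
  lt 22 (reg 20) (reg 1) ⨟ lt 33 (lit 0) (reg 23) ⨟ mul 22 (reg 22) (reg 33)

/-- Arrays `9` and `10` get the ends of the intervals. Register `23` is a bound for the number of
steps which remain. -/
def assignIntervals : Prog :=
  (set 20 (lit 0) ⨟ set 21 (lit 0) ⨟ set 24 (lit 0) ⨟ mul 23 (reg 0) (lit 8) ⨟
    lt 22 (lit 0) (reg 1)) ⨟
  loop (reg 22) assignStep

/-- The invariants of `assignIntervals`. -/
structure Family.Assigning (A : Family I) (s t : State) (b hi lo fuel : ℕ) : Prop where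
  reg0 : t.reg 0 = N
  reg1 : t.reg 1 = I.nb
  reg5 : t.reg 5 = A.g
  reg6 : t.reg 6 = A.nL
  reg20 : t.reg 20 = b
  reg21 : t.reg 21 = hi
  reg24 : t.reg 24 = lo
  reg23 : t.reg 23 = fuel
  arr : ∀ k < 9, ∀ i, t.arr k i = s.arr k i
  b_le : b ≤ I.nb
  lo_le : lo ≤ hi
  hi_le : hi ≤ A.nL
  fuel_le : fuel ≤ 8 * N
  arr_le : ∀ b' < b, t.arr 9 b' ≤ A.g ∧ t.arr 10 b' ≤ A.g
  reg7 : t.reg 7 = ∑ e ∈ range A.g, (A.GX e - I.cb (A.GP e)) +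
    ∑ b' ∈ range b, (t.arr 10 b' - t.arr 9 b')
  LX_le : ∀ u < hi, A.LX u ≤ b
  -- For each blue point `hi` is raised first; `lo` is lowered only when `hi` is final.
  stopped : lo < hi → ¬ (hi < A.nL ∧ A.LX hi ≤ b)
  lt_LV : ∀ u, lo ≤ u → u < hi → ν (I.bp b) < ν (A.LV u)
  covers : ∀ ℓ, A.Good ℓ → ∀ b' < b, A.Covers b' (t.arr 9 b') (t.arr 10 b')
  sub_le : ∀ b' < b, t.arr 10 b' - t.arr 9 b' ≤ ∑ u ∈ A.levels b', (A.LG (u + 1) - A.LG u)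
  -- Every step raises `hi`, lowers `lo` or advances `b`. The fuel makes the loop linear even when
  -- the likely invariants fail.
  fuel_bound : 8 * N ≤ fuel + b + hi + ∑ b' ∈ range b, #(A.levels b') + (hi - lo)

theorem sum_sub_le_mul {f g : ℕ → ℕ} {n m : ℕ} (h : ∀ e < n, f e ≤ m) :
    ∑ e ∈ range n, (f e - g e) ≤ n * m := by
  refine (sum_le_card_nsmul _ _ m fun e he => (Nat.sub_le _ _).trans (h e (mem_range.1 he))).trans ?_
  simp

open Classical in
theorem upTest_wlp {co : ℕ → ℕ → ℕ} {Q : State → Prop} {t : State} {b hi : ℕ} (hM : 64 ≤ M)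
    (h6 : t.reg 6 = A.nL) (h20 : t.reg 20 = b) (h21 : t.reg 21 = hi) (hhi : 16 * hi + 64 ≤ M)
    (hA : ∀ u < A.nL, t.arr 7 u = A.LX u) (hLM : ∀ u < A.nL, A.LX u < M)
    (hQ : ∀ t', (∀ r < 31, t'.reg r = t.reg r) → t'.arr = t.arr →
      (t'.reg 39 = if hi < A.nL ∧ A.LX hi ≤ b then 1 else 0) → Q t') : upTest.wlp M co Q t := by
  have hlit : ∀ n ≤ 63, n < M := fun n hn => by omega
  have hite : ∀ (p : Prop) [Decidable p], (if p then 1 else 0) < M := fun p _ => by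
    split_ifs <;> omega
  by_cases h : hi < A.nL
  · have h1 := hA hi h
    have h2 := hLM hi h
    simp [upTest, wlp_ld, hlit, hite, h6, h20, h21, h, h1]
    refine ⟨by omega, h2, by split_ifs <;> omega, hQ _ (fun r hr => ?_) rfl ?_⟩
    · have e : ∀ k, 31 ≤ k → r ≠ k := fun k hk => by omega
      simp [e]
    · simp only [State.put_reg, if_true, h, true_and]
      split_ifs <;> omega
  · simp [upTest, hlit, h6, h21, h]
    refine hQ _ (fun r hr => ?_) rfl ?_
    · simp [show r ≠ 39 by omega]
    · simp [h]

open Classical in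
theorem downTest_wlp {co : ℕ → ℕ → ℕ} {Q : State → Prop} {t : State} {b lo : ℕ}
    (h20 : t.reg 20 = b) (h24 : t.reg 24 = lo) (hlo : 16 * lo + 64 ≤ M)
    (hlo' : lo ≤ A.nL) (hA6 : ∀ u < A.nL, t.arr 6 u = A.LV u) (hA2 : t.arr 2 b = I.bp b)
    (hb : b < I.nb) (hbM : 16 * b + 64 ≤ M) (hNM : 2 * N ≤ M)
    (hcmp : ∀ a < 2 * N, ∀ b < 2 * N, co a b = if ν a < ν b then 1 else 0)
    (hQ : ∀ t', (∀ r < 31, t'.reg r = t.reg r) → t'.arr = t.arr → (lo ≠ 0 → t'.reg 35 = lo - 1) →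
      (t'.reg 39 = if lo ≠ 0 ∧ ν (I.bp b) < ν (A.LV (lo - 1)) then 1 else 0) → Q t') :
    downTest.wlp M co Q t := by
  have hlit : ∀ n ≤ 63, n < M := fun n hn => by omega
  have hbp := I.bp_lt b hb
  by_cases h : lo = 0
  · simp [downTest, hlit, h24, h]
    refine hQ _ (fun r hr => ?_) rfl (fun h' => absurd h h') ?_
    · simp [show r ≠ 39 by omega]
    · simp [h]
  · have h1 := hA6 (lo - 1) (by omega)
    have h2 := A.LV_lt (lo - 1) (by omega)
    have h3 := hcmp _ hbp (A.LV (lo - 1)) (by omega)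
    simp [downTest, wlp_ld, hlit, h20, h24, h, h1, hA2, h3]
    refine ⟨by omega, by omega, by omega, by omega, by omega,
      hQ _ (fun r hr => ?_) rfl (fun _ => ?_) ?_⟩
    · have e : ∀ k, 31 ≤ k → r ≠ k := fun k hk => by omega
      simp [e]
    · simp
    · simp [h]

theorem storeInterval_wlp {co : ℕ → ℕ → ℕ} {Q : State → Prop} {t : State} {b lo hi tot : ℕ}
    (h20 : t.reg 20 = b) (h24 : t.reg 24 = lo) (h21 : t.reg 21 = hi)
    (hlo : lo ≤ hi) (hhi : hi ≤ A.nL) (hAM : 16 * A.nL + 64 ≤ M)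
    (hA8 : ∀ u ≤ A.nL, t.arr 8 u = A.LG u) (hgM : A.g < M) (hbM : 16 * b + 64 ≤ M)
    (h7 : t.reg 7 = tot) (htot : tot + A.g < M)
    (hQ : ∀ t', (∀ r < 31, r ≠ 7 → r ≠ 20 → r ≠ 24 → t'.reg r = t.reg r) → t'.reg 20 = b + 1 →
      t'.reg 24 = hi → t'.reg 7 = tot + (A.LG hi - A.LG lo) →
      (∀ k < 16, ∀ u, t'.arr k u = if k = 10 ∧ u = b then A.LG hi else
        if k = 9 ∧ u = b then A.LG lo else t.arr k u) → Q t') :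
    storeInterval.wlp M co Q t := by
  have hlit : ∀ n ≤ 63, n < M := fun n hn => by omega
  have e1 := hA8 lo (hlo.trans hhi)
  have e2 := hA8 hi hhi
  have e3 := A.LG_le lo (hlo.trans hhi)
  have e4 := A.LG_le hi hhi
  simp [storeInterval, wlp_ld, wlp_st, hlit, h20, h24, h21, e1, e2, h7]
  refine ⟨by omega, by omega, by omega, by omega, by omega, by omega, by omega, by omega, by omega,
    by omega, by omega, by omega, hQ _ (fun r hr h1 h2 h3 => ?_) ?_ ?_ ?_ fun k hk u => ?_⟩
  · have e : ∀ k, 31 ≤ k → r ≠ k := fun k hk => by omega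
    simp [e, h1, h2, h3]
  · simp
  · simp
  · simp
  · simp [State.sto_arr, hk]

theorem assignStep_wlp {co : ℕ → ℕ → ℕ} (hA : A.Stored s) {t : State} {b hi lo fuel : ℕ}
    (h : A.Assigning s t b hi lo fuel) (hb : b < I.nb) (hfuel : 0 < fuel)
    (hNM : 64 * (2 * N + 1) * (2 * N + 1) ≤ M)
    (hcmp : ∀ a < 2 * N, ∀ b < 2 * N, co a b = if ν a < ν b then 1 else 0) {Q : State → Prop}
    (hQ : ∀ t' b' hi' lo', A.Assigning s t' b' hi' lo' (fuel - 1) →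
      t'.reg 22 = (if b' < I.nb ∧ 1 < fuel then 1 else 0) → Q t') :
    assignStep.wlp M co Q t := by
  have hnb := I.nb_le
  have hNM' : 64 * (2 * N + 1) ≤ M := (Nat.le_mul_of_pos_right _ (by omega)).trans hNM
  have hNN : 2 * (N * N) + N < M := by nlinarith
  have hlit : ∀ n ≤ 63, n < M := fun n hn => by omega
  have hite : ∀ (p : Prop) [Decidable p], (if p then 1 else 0) < M := fun p _ => by
    split_ifs <;> omega
  have hmul : ∀ (p q : Prop) [Decidable p] [Decidable q],
      (if p then 1 else 0) * (if q then 1 else 0) = if p ∧ q then 1 else 0 := fun p q _ _ => by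
    split_ifs <;> simp_all
  have hA7 : ∀ u < A.nL, t.arr 7 u = A.LX u := fun u hu => by
    rw [h.arr 7 (by norm_num), hA.arr7 u hu]
  have hA6 : ∀ u < A.nL, t.arr 6 u = A.LV u := fun u hu => by
    rw [h.arr 6 (by norm_num), hA.arr6 u hu]
  have hA8 : ∀ u ≤ A.nL, t.arr 8 u = A.LG u := fun u hu => by
    rw [h.arr 8 (by norm_num), hA.arr8 u hu]
  have hA2 : t.arr 2 b = I.bp b := by rw [h.arr 2 (by norm_num), hA.stored.arr_two b hb]
  have hbp := I.bp_lt b hb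
  have hnL := A.nL_le
  have hg := A.g_le
  obtain ⟨r0, r1, r5, r6, r20, r21, r24, r23, arr, b_le, lo_le, hi_le, fuel_le, arr_le, r7, LX_le,
    stopped, lt_LV, covers, sub_le, fuel_bound⟩ := h
  obtain ⟨tot, htot⟩ : ∃ tot, ∑ e ∈ range A.g, (A.GX e - I.cb (A.GP e)) +
    ∑ b' ∈ range b, (t.arr 10 b' - t.arr 9 b') = tot := ⟨_, rfl⟩
  have htotM : tot ≤ N * N + b * N := by
    rw [← htot]
    refine add_le_add ((sum_sub_le_mul fun e he => (A.GX_le e he).trans hnb).trans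
      (Nat.mul_le_mul_right _ hg)) (sum_sub_le_mul fun e he => ((arr_le e he).2).trans hg)
  have hbN : b * N + N ≤ N * N := by
    have := Nat.mul_le_mul_right N (show b + 1 ≤ N by omega)
    linarith
  have hLX : ∀ u < A.nL, A.LX u < M := fun u hu => by
    have := A.LX_le u hu
    omega
  have hguard : ∀ t', t'.reg 1 = I.nb → t'.reg 23 = fuel - 1 → ∀ b' hi' lo',
      (A.Assigning s (((t'.put 22 (if t'.reg 20 < I.nb then 1 else 0)).put 33
        (if 0 < fuel - 1 then 1 else 0)).put 22 (if t'.reg 20 < I.nb ∧ 0 < fuel - 1 then 1 else 0))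
        b' hi' lo' (fuel - 1)) →
      (lt 22 (reg 20) (reg 1) ⨟ lt 33 (lit 0) (reg 23) ⨟ mul 22 (reg 22) (reg 33)).wlp M co Q t' := by
    intro t' h1 h23 b' hi' lo' h
    have h20 := h.reg20
    simp at h20
    simp only [wlp_seq, wlp_lt, wlp_mul, fits_reg, fits_lit, val_reg, val_lit, State.put_reg,
      Nat.reduceEqDiff, if_true, if_false, h1, h23, hmul]
    refine ⟨trivial, trivial, hite _, by omega, trivial, hite _, trivial, trivial, hite _,
      hQ _ b' hi' lo' h ?_⟩
    simp only [State.put_reg, if_true, h20]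
    exact if_congr (by omega) rfl rfl
  simp only [assignStep, wlp_seq, wlp_sub]
  refine ⟨trivial, hlit _ (by norm_num), by simp [r23]; omega, ?_⟩
  refine upTest_wlp (A := A) (b := b) (hi := hi) (by omega) (by simpa using r6) (by simpa using r20)
    (by simpa using r21) (by omega) hA7 hLX fun t1 hr1 ha1 h39 => ?_
  have hr1' : ∀ r < 31, t1.reg r = if r = 23 then fuel - 1 else t.reg r := fun r hr => by
    rw [hr1 r hr]
    simp [r23]
  rw [State.put_arr] at ha1
  rw [wlp_seq, wlp_branch]
  refine ⟨trivial, fun hz => ?_, fun hz => ?_⟩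
  · rw [val_reg, h39] at hz
    have hup : ¬ (hi < A.nL ∧ A.LX hi ≤ b) := by
      intro h
      simp [h] at hz
    rw [wlp_seq]
    refine downTest_wlp (A := A) (b := b) (lo := lo) (by simp [hr1', r20])
      (by simp [hr1', r24]) (by omega) (by omega) (by rw [ha1]; exact hA6) (by rw [ha1]; exact hA2)
      hb (by omega) (by omega) hcmp fun t2 hr2 ha2 h35 h39 => ?_
    rw [ha1] at ha2
    rw [wlp_branch]
    refine ⟨trivial, fun hz => ?_, fun hz => ?_⟩
    · rw [val_reg, h39] at hz
      have hdown : ¬ (lo ≠ 0 ∧ ν (I.bp b) < ν (A.LV (lo - 1))) := by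
        intro h
        simp [h] at hz
      refine storeInterval_wlp (A := A) (b := b) (lo := lo) (hi := hi) (tot := tot)
        (by simp [hr2, hr1', r20]) (by simp [hr2, hr1', r24]) (by simp [hr2, hr1', r21]) lo_le hi_le
        (by omega) (by rw [ha2]; exact hA8) (by omega) (by omega)
        (by simp [hr2, hr1', r7, htot]) (by nlinarith) fun t3 hr3 h20 h24 h7 ha3 => ?_
      rw [ha2] at ha3
      have q : ∀ r < 31, r ≠ 7 → r ≠ 20 → r ≠ 24 → r ≠ 23 → t3.reg r = t.reg r :=
        fun r hr h1 h2 h3 h4 => by rw [hr3 r hr h1 h2 h3, hr2 r hr, hr1' r hr, if_neg h4]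
      have q23 : t3.reg 23 = fuel - 1 := by
        rw [hr3 23 (by norm_num) (by norm_num) (by norm_num) (by norm_num), hr2 23 (by norm_num),
          hr1' 23 (by norm_num), if_pos rfl]
      have ha9 : ∀ b' < b, t3.arr 9 b' = t.arr 9 b' := fun b' hb' => by
        rw [ha3 9 (by norm_num), if_neg (by omega), if_neg (by omega)]
      have ha10 : ∀ b' < b, t3.arr 10 b' = t.arr 10 b' := fun b' hb' => by
        rw [ha3 10 (by norm_num), if_neg (by omega), if_neg (by omega)]
      have hb9 : t3.arr 9 b = A.LG lo := by
        rw [ha3 9 (by norm_num), if_neg (by omega), if_pos ⟨rfl, rfl⟩]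
      have hb10 : t3.arr 10 b = A.LG hi := by
        rw [ha3 10 (by norm_num), if_pos ⟨rfl, rfl⟩]
      -- Resetting `lo` to `hi` gives up `hi - lo`, which is made good by the incidences of this
      -- blue point.
      have hcard : hi - lo ≤ #(A.levels b) := by
        rw [← Nat.card_Ico]
        exact card_le_card (Family.Ico_subset_levels hi_le LX_le lt_LV)
      refine hguard t3 (by rw [q _ (by norm_num) (by norm_num) (by norm_num) (by norm_num)
        (by norm_num), r1]) q23 (b + 1) hi hi ⟨by simp [q, r0], by simp [q, r1], by simp [q, r5],
        by simp [q, r6], by simp [h20], by simp [q, r21], by simp [h24], by simp [q23],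
        fun k hk u => ?_, hb, le_rfl, hi_le, by omega, fun b' hb' => ?_, ?_, fun u hu => ?_,
        fun h => absurd h (lt_irrefl _), fun u h h' => by omega, fun ℓ hℓ b' hb' => ?_,
        fun b' hb' => ?_, ?_⟩
      · simp only [State.put_arr]
        rw [ha3 k (by omega), if_neg (by omega), if_neg (by omega), arr k hk]
      · simp only [State.put_arr]
        rcases Nat.lt_succ_iff_lt_or_eq.1 hb' with hb' | rfl
        · rw [ha9 b' hb', ha10 b' hb']
          exact arr_le b' hb'
        · rw [hb9, hb10]
          exact ⟨A.LG_le _ (by omega), A.LG_le _ hi_le⟩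
      · simp only [State.put_arr]
        have hsum : ∑ b' ∈ range b, (t3.arr 10 b' - t3.arr 9 b') =
            ∑ b' ∈ range b, (t.arr 10 b' - t.arr 9 b') := sum_congr rfl fun b' hb' => by
          rw [ha9 b' (mem_range.1 hb'), ha10 b' (mem_range.1 hb')]
        rw [sum_range_succ, hb9, hb10, ← add_assoc, hsum, htot]
        simpa using h7
      · have := LX_le u hu
        omega
      · simp only [State.put_arr]
        rcases Nat.lt_succ_iff_lt_or_eq.1 hb' with hb' | rfl
        · rw [ha9 b' hb', ha10 b' hb']
          exact covers ℓ hℓ b' hb'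
        · rw [hb9, hb10]
          exact hℓ.covers hb lo_le hi_le hup hdown
      · simp only [State.put_arr]
        rcases Nat.lt_succ_iff_lt_or_eq.1 hb' with hb' | rfl
        · rw [ha9 b' hb', ha10 b' hb']
          exact sub_le b' hb'
        · rw [hb9, hb10]
          exact Family.sub_le_sum_levels lo_le hi_le LX_le lt_LV
      · rw [sum_range_succ]
        omega
    · rw [val_reg, h39] at hz
      have hdown : lo ≠ 0 ∧ ν (I.bp b) < ν (A.LV (lo - 1)) := by
        by_contra h
        rw [if_neg h] at hz
        exact hz rfl
      have q : ∀ r < 31, r ≠ 23 → t2.reg r = t.reg r :=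
        fun r hr h4 => by rw [hr2 r hr, hr1' r hr, if_neg h4]
      have q23 : t2.reg 23 = fuel - 1 := by
        rw [hr2 23 (by norm_num), hr1' 23 (by norm_num), if_pos rfl]
      simp only [wlp_set, fits_reg, val_reg, h35 hdown.1]
      refine ⟨trivial, by omega, by omega, ?_⟩
      refine hguard _ (by simp [q, r1]) (by simp [q23]) b hi (lo - 1) ⟨by simp [q, r0],
        by simp [q, r1], by simp [q, r5],
        by simp [q, r6], by simp [q, r20], by simp [q, r21], by simp, by simp [q23],
        fun k hk u => ?_, b_le, by omega, hi_le, by omega, ?_, ?_, LX_le,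
        fun h => hup, fun u h h' => ?_, ?_, ?_, by omega⟩
      · simp only [State.put_arr, ha2]
        exact arr k hk u
      · simp only [State.put_arr, ha2]
        exact arr_le
      · simp only [State.put_arr, ha2]
        simpa [q] using r7
      · rcases h.eq_or_lt with rfl | h
        · exact hdown.2
        · exact lt_LV u (by omega) h'
      · simp only [State.put_arr, ha2]
        exact covers
      · simp only [State.put_arr, ha2]
        exact sub_le
  · rw [val_reg, h39] at hz
    have hup : hi < A.nL ∧ A.LX hi ≤ b := by
      by_contra h
      rw [if_neg h] at hz
      exact hz rfl
    -- Raising takes place only while `lo = hi`, so nothing is lost when both move on.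
    have h5 : ¬ lo < hi := fun h => stopped h hup
    have q : ∀ r < 31, r ≠ 23 → t1.reg r = t.reg r :=
      fun r hr h4 => by rw [hr1' r hr, if_neg h4]
    have q23 : t1.reg 23 = fuel - 1 := by
      rw [hr1' 23 (by norm_num), if_pos rfl]
    simp only [wlp_seq, wlp_add, wlp_set, fits_reg, fits_lit, val_reg, val_lit, State.put_reg,
      if_true, q 21 (by norm_num) (by norm_num), r21]
    refine ⟨trivial, by omega, by omega, trivial, by omega, by omega, ?_⟩
    refine hguard _ (by simp [q, r1]) (by simp [q23]) b (hi + 1) (hi + 1) ⟨by simp [q, r0],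
      by simp [q, r1], by simp [q, r5],
      by simp [q, r6], by simp [q, r20], by simp, by simp, by simp [q23],
      fun k hk u => ?_, b_le, le_rfl, hup.1, by omega, ?_, ?_, fun u hu => ?_,
      fun h => absurd h (lt_irrefl _), fun u h h' => by omega, ?_, ?_, by omega⟩
    · simp only [State.put_arr, ha1]
      exact arr k hk u
    · simp only [State.put_arr, ha1]
      exact arr_le
    · simp only [State.put_arr, ha1]
      simpa [q] using r7
    · rcases Nat.lt_succ_iff_lt_or_eq.1 hu with hu | rfl
      · exact LX_le u hu
      · exact hup.2
    · simp only [State.put_arr, ha1]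
      exact covers
    · simp only [State.put_arr, ha1]
      exact sub_le

/-- The blue points before number `m` have intervals, which are stored in arrays `9` and `10`. -/
structure Family.Assigned (A : Family I) (m : ℕ) (lo hi : ℕ → ℕ) (t : State) : Prop where
  m_le : m ≤ I.nb
  hi_le : ∀ b < m, lo b ≤ A.g ∧ hi b ≤ A.g
  reg0 : t.reg 0 = N
  reg5 : t.reg 5 = A.g
  reg20 : t.reg 20 = m
  reg7 : t.reg 7 = ∑ e ∈ range A.g, (A.GX e - I.cb (A.GP e)) + ∑ b ∈ range m, (hi b - lo b)
  arr1 : ∀ i < N, t.arr 1 i = I.cb i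
  arr2 : ∀ b < I.nb, t.arr 2 b = I.bp b
  arr4 : ∀ e < A.g, t.arr 4 e = A.GP e
  arr5 : ∀ e < A.g, t.arr 5 e = A.GX e
  arr9 : ∀ b < m, t.arr 9 b = lo b
  arr10 : ∀ b < m, t.arr 10 b = hi b

/-- The properties of the intervals which are likely to hold. -/
structure Family.Covered (A : Family I) (ℓ m : ℕ) (lo hi : ℕ → ℕ) : Prop where
  good : A.Good ℓ
  m_eq : m = I.nb
  covers : ∀ b < m, A.Covers b (lo b) (hi b)
  sum_le : ∑ b ∈ range m, (hi b - lo b) ≤ 2 * ℓ * A.g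

theorem assignIntervals_triple (hM : M ≤ 2 ^ w) (hA : A.Stored s)
    (hNM : 64 * (2 * N + 1) * (2 * N + 1) ≤ M)
    (hcmp : ∀ a < 2 * N, ∀ b < 2 * N, compareInput input a b = if ν a < ν b then 1 else 0)
    (hF : ∀ t m lo hi, A.Assigned m lo hi t → (∀ ℓ, A.Good ℓ → A.Covered ℓ m lo hi) → F t ≤ c) :
    Triple w input assignIntervals (1000 * N + 20) s c F := by
  have hnb := I.nb_le
  have hNM' : 64 * (2 * N + 1) ≤ M := (Nat.le_mul_of_pos_right _ (by omega)).trans hNM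
  have hM2 : 2 ≤ M := by omega
  have hlit : ∀ n ≤ 63, n < M := fun n hn => by omega
  have hite : ∀ (p : Prop) [Decidable p], (if p then 1 else 0) < M := fun p _ => by
    split_ifs <;> omega
  have hcost : assignStep.cost ≤ 120 := by
    simp [assignStep, upTest, downTest, storeInterval]
  refine .seq_wlp hM hM2 (m := 1000 * N + 1) (by simp; omega) ?_
  simp [hlit, hite, hA.stored.reg_zero, hA.stored.reg_one]
  refine ⟨by omega, ?_⟩
  refine .loop_wlp hM hM2 (fun t => ∃ b hi lo, A.Assigning s t b hi lo (t.reg 23) ∧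
    t.reg 22 = if b < I.nb ∧ 0 < t.reg 23 then 1 else 0) (fun t => t.reg 23) ?_ ?_ ?_ ?_
  · refine ⟨0, 0, 0, ⟨by simp [hA.stored.reg_zero], by simp [hA.stored.reg_one], by simp [hA.reg5],
      by simp [hA.reg6], by simp, by simp, by simp, by simp, fun k _ i => by simp, by simp, le_rfl,
      by simp, by simp; omega, by simp, by simp [hA.reg7], by simp, by simp, by simp, by simp,
      by simp, by simp; omega⟩, ?_⟩
    simp
    refine if_congr ?_ rfl rfl
    omega
  · simp
    nlinarith
  · rintro t ⟨b, hi, lo, h, h22⟩ h22'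
    rw [h22] at h22'
    have hb : b < I.nb ∧ 0 < t.reg 23 := by
      by_contra h
      rw [if_neg h] at h22'
      exact h22' rfl
    refine assignStep_wlp hA h hb.1 hb.2 hNM hcmp fun t' b' hi' lo' h' h22'' => ?_
    have e := h'.reg23
    rw [← e] at h'
    exact ⟨⟨b', hi', lo', h', by rw [h22'', e]; exact if_congr (by omega) rfl rfl⟩, by omega⟩
  · rintro t ⟨b, hi, lo, h, h22⟩ h22'
    rw [h22] at h22'
    have hb : ¬ (b < I.nb ∧ 0 < t.reg 23) := by
      intro h
      rw [if_pos h] at h22'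
      exact one_ne_zero h22'
    refine hF t b (t.arr 9) (t.arr 10) ⟨h.b_le, h.arr_le, h.reg0, h.reg5, h.reg20, h.reg7,
      fun i hi => ?_, fun i hi => ?_, fun i hi => ?_, fun i hi => ?_, fun _ _ => rfl,
      fun _ _ => rfl⟩ fun ℓ hℓ => ?_
    · rw [h.arr 1 (by norm_num), hA.stored.arr_one i hi]
    · rw [h.arr 2 (by norm_num), hA.stored.arr_two i hi]
    · rw [h.arr 4 (by norm_num), hA.arr4 i hi]
    · rw [h.arr 5 (by norm_num), hA.arr5 i hi]
    · have hb' : b = I.nb := by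
        -- Stopping early would mean that the fuel `8 * N` is used up, but good levels allow at most
        -- `N + N + 2 * N + N` steps.
        by_contra hne
        have h1 := h.b_le
        have h2 : t.reg 23 = 0 := by omega
        have h3 := h.fuel_bound
        have h4 := hℓ.sum_below_le
        have h5 := A.sum_card_levels_mul fun _ => 1
        simp only [sum_const, smul_eq_mul, mul_one] at h5
        have h6 : ∑ b' ∈ Finset.range b, #(A.levels b') ≤ ∑ b' ∈ Finset.range I.nb, #(A.levels b') :=
          sum_le_sum_of_subset (range_subset_range.2 h1)
        have h7 := A.nL_le
        have h8 := A.g_le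
        have h9 := h.hi_le
        omega
      refine ⟨hℓ, hb', h.covers ℓ hℓ, ?_⟩
      refine (sum_le_sum fun b' hb' => h.sub_le b' (mem_range.1 hb')).trans ?_
      rw [hb']
      exact hℓ.sum_levels_le

end

/-! ### Stratified sampling under a supermartingale potential -/

section

open Prog Operand

variable {w M : ℕ} {input : List ℝ} {N : ℕ} {ν : ℕ → ℝ} {s : State} {F : State → ℝ≥0∞} {c : ℝ≥0∞}
variable {I : Instance N ν} {A : Family I}

/-! ### Counting by sampling from chunks -/

/-- The states agree in the registers below `20`, apart from register `9`, and in the memory. -/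
def State.Keep (s t : State) : Prop := (∀ r < 20, r ≠ 9 → t.reg r = s.reg r) ∧ t.arr = s.arr

theorem State.Keep.refl (s : State) : s.Keep s := ⟨fun _ _ _ => rfl, rfl⟩

theorem State.Keep.trans {s t u : State} (h : s.Keep t) (h' : t.Keep u) : s.Keep u :=
  ⟨fun r hr hr' => (h'.1 r hr hr').trans (h.1 r hr hr'), h'.2.trans h.2⟩

open Classical in
/-- The number of elements of the interval with a property. -/
def intervalCount (T : ℕ → Prop) (lo hi : ℕ) : ℕ := #{u ∈ Ico lo hi | T u}

open Classical in
theorem intervalCount_eq_add (T : ℕ → Prop) (lo hi W : ℕ) : intervalCount T lo hi =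
    intervalCount T (lo + W) hi + #{v ∈ range W | lo + v < hi ∧ T (lo + v)} := by
  have h : #{v ∈ range W | lo + v < hi ∧ T (lo + v)} =
      #{u ∈ Ico lo (lo + W) | u < hi ∧ T u} := by
    rw [card_filter, card_filter, sum_Ico_eq_sum_range, Nat.add_sub_cancel_left]
  rw [h, intervalCount, intervalCount, ← card_union_of_disjoint]
  · congr 1
    ext u
    simp only [mem_union, mem_filter, mem_Ico]
    by_cases hT : T u <;> simp [hT]
    omega
  · rw [disjoint_left]
    intro u h1 h2
    simp only [mem_filter, mem_Ico] at h1 h2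
    omega

/-- `p a r` bounds the probability of a wrong result if the current value of the counter is `a` and
`r` objects have not been looked at. -/
def IsPotential (W : ℕ) (p : ℕ → ℕ → ℝ≥0∞) : Prop :=
  ∀ d ≤ W, ∀ a r, (W - d : ℕ) * p a r + d * p (a + 1) r ≤ W * p a (r + d)

open Classical in
theorem IsPotential.sum_le {W : ℕ} {p : ℕ → ℕ → ℝ≥0∞} (hp : IsPotential W p) (T : ℕ → Prop)
    (a r : ℕ) : ∑ v ∈ range W, p (a + if T v then 1 else 0) r ≤
      W * p a (r + #{v ∈ range W | T v}) := by
  have h1 : ∀ v, p (a + if T v then 1 else 0) r = if T v then p (a + 1) r else p a r := fun v => by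
    split_ifs <;> rfl
  have h2 : #{v ∈ range W | ¬ T v} = W - #{v ∈ range W | T v} := by
    have := card_filter_add_card_filter_not (s := range W) T
    rw [card_range] at this
    exact Nat.eq_sub_of_add_eq' this
  have h3 : #{v ∈ range W | T v} ≤ W := (card_filter_le _ _).trans (card_range W).le
  simp only [h1]
  rw [sum_ite, sum_const, sum_const, h2, nsmul_eq_mul, nsmul_eq_mul, add_comm]
  exact hp _ h3 a r

/-- The current chunk is treated, after a random number was drawn. -/
def chunkStep (test : Prog) : Prog :=
  add 25 (reg 25) (reg 21) ⨟ lt 39 (reg 25) (reg 22) ⨟ branch (reg 39) test skip ⨟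
  add 21 (reg 21) (reg 8) ⨟ lt 23 (reg 21) (reg 22)

/-- The interval from register `21` to register `22` is divided into chunks of the length in
register `8`, and a random element of each chunk is tested. -/
def chunkLoop (test : Prog) : Prog :=
  loop (reg 23) (.instr (.rand 25 (reg 8)) ⨟ chunkStep test)

open Classical in
/-- The program counts the random element in register `25` if it has the property. -/
def IsTest (M : ℕ) (co : ℕ → ℕ → ℕ) (test : Prog) (s : State) (T : ℕ → Prop) (lo hi : ℕ) : Prop :=
  ∀ t u Q, s.Keep t → t.reg 20 = s.reg 20 → t.reg 24 = s.reg 24 → t.reg 25 = u →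
    lo ≤ u → u < hi → t.reg 9 + 1 < M →
    (∀ t', (∀ r < 30, r ≠ 9 → t'.reg r = t.reg r) → t'.arr = t.arr →
      t'.reg 9 = t.reg 9 + (if T u then 1 else 0) → Q t') → test.wlp M co Q t

open Classical in
theorem chunkStep_wlp (hM2 : 64 ≤ M) {test : Prog} {co : ℕ → ℕ → ℕ} {t : State}
    {W a l lo hi v : ℕ} {T : ℕ → Prop} (hWM : W + hi < M) (haM : a + 1 < M)
    (htest : IsTest M co test s T lo hi) (hst : s.Keep t) (h20 : t.reg 20 = s.reg 20)
    (h24 : t.reg 24 = s.reg 24) (h8 : t.reg 8 = W) (h9 : t.reg 9 = a) (h21 : t.reg 21 = l)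
    (h22 : t.reg 22 = hi) (h25 : t.reg 25 = v) (hv : v < W) (hlo : lo ≤ l) (hl : l < hi)
    {Q : State → Prop} (hQ : ∀ t', s.Keep t' → t'.reg 20 = s.reg 20 → t'.reg 24 = s.reg 24 →
      t'.reg 26 = t.reg 26 → t'.reg 22 = hi →
      t'.reg 9 = a + (if l + v < hi ∧ T (l + v) then 1 else 0) →
      t'.reg 21 = l + W → t'.reg 23 = (if l + W < hi then 1 else 0) → Q t') :
    (chunkStep test).wlp M co Q t := by
  have hite : ∀ (p : Prop) [Decidable p], (if p then 1 else 0) < M := fun p _ => by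
    split_ifs <;> omega
  have hend : ∀ t', s.Keep t' → t'.reg 20 = s.reg 20 → t'.reg 24 = s.reg 24 →
      t'.reg 26 = t.reg 26 → t'.reg 22 = hi → t'.reg 8 = W → t'.reg 21 = l →
      t'.reg 9 = a + (if l + v < hi ∧ T (l + v) then 1 else 0) →
      (add 21 (reg 21) (reg 8) ⨟ lt 23 (reg 21) (reg 22)).wlp M co Q t' := by
    intro t' g1 g2 g3 g4 g5 g6 g7 g8
    simp [g6, g7, g5, hite]
    refine ⟨by omega, hQ _ ⟨fun r hr hr' => ?_, g1.2⟩ ?_ ?_ ?_ ?_ ?_ ?_ ?_⟩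
    · simp [show r ≠ 21 by omega, show r ≠ 23 by omega, g1.1 r hr hr']
    all_goals simp [g2, g3, g4, g5, g8]
  simp only [chunkStep, wlp_seq, wlp_add, wlp_lt, wlp_branch, fits_reg, val_reg, true_and,
    State.put_reg, Nat.reduceEqDiff, if_true, if_false, h25, h21, h22, wlp_skip]
  have hput : ∀ x y, s.Keep ((t.put 25 x).put 39 y) ∧
      ((t.put 25 x).put 39 y).reg 20 = s.reg 20 ∧ ((t.put 25 x).put 39 y).reg 24 = s.reg 24 ∧
      ((t.put 25 x).put 39 y).reg 26 = t.reg 26 := by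
    intro x y
    refine ⟨⟨fun r hr hr' => ?_, hst.2⟩, by simp [h20], by simp [h24], by simp⟩
    simp [show r ≠ 25 by omega, show r ≠ 39 by omega, hst.1 r hr hr']
  obtain ⟨q1, q2, q3, q4⟩ := hput (v + l) (if v + l < hi then 1 else 0)
  refine ⟨by omega, hite _, fun h => ?_, fun h => ?_⟩
  · have h' : ¬ l + v < hi := by
      intro h'
      rw [if_pos (by omega)] at h
      omega
    have := hend _ q1 q2 q3 q4 (by simp [h22]) (by simp [h8]) (by simp [h21]) (by simp [h9, h'])
    simpa [h21, h22] using this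
  · have h' : v + l < hi := by
      by_contra h'
      rw [if_neg h'] at h
      exact h rfl
    refine htest _ (v + l) _ q1 q2 q3 (by simp) (by omega) h' (by simp [h9, haM])
      fun t' g1 g2 g3 => ?_
    have := hend t' (q1.trans ⟨fun r hr hr' => g1 r (by omega) hr', g2⟩)
      (by rw [g1 20 (by norm_num) (by norm_num), q2]) (by rw [g1 24 (by norm_num) (by norm_num), q3])
      (by rw [g1 26 (by norm_num) (by norm_num), q4])
      (by rw [g1 22 (by norm_num) (by norm_num)]; simp [h22])
      (by rw [g1 8 (by norm_num) (by norm_num)]; simp [h8])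
      (by rw [g1 21 (by norm_num) (by norm_num)]; simp [h21])
      (by rw [g3]; simp [h9, h', add_comm l])
    simpa using this

/-- When a chunk is treated, its objects leave the second argument of `p`, and a success increases
the first; `IsPotential` says that `p` does not grow on average. `R` counts the objects outside the
interval. -/
theorem chunkLoop_triple (hM : M ≤ 2 ^ w) (hM2 : 64 ≤ M) {test : Prog} {W R a lo hi : ℕ}
    {p : ℕ → ℕ → ℝ≥0∞} (hp : IsPotential W p) {T : ℕ → Prop} (hW : 0 < W) (hWM : W + hi < M)
    (h8 : s.reg 8 = W) (h9 : s.reg 9 = a) (h21 : s.reg 21 = lo) (h22 : s.reg 22 = hi)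
    (h23 : s.reg 23 = if lo < hi then 1 else 0) (haM : a + (hi - lo) < M) (hcost : test.cost ≤ 30)
    (htest : IsTest M (compareInput input) test s T lo hi)
    (hF : ∀ t, s.Keep t → t.reg 20 = s.reg 20 → t.reg 26 = s.reg 26 → t.reg 9 ≤ a + (hi - lo) →
      F t ≤ p (t.reg 9) R) :
    Triple w input (chunkLoop test) (50 * ((hi - lo + W - 1) / W) + 1) s
      (p a (R + intervalCount T lo hi)) F := by
  classical
  have key := Triple.loop (w := w) (input := input) (a := reg 23)
    (p := .instr (.rand 25 (reg 8)) ⨟ chunkStep test) (F := F)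
    (fun t => s.Keep t ∧ t.reg 20 = s.reg 20 ∧ t.reg 24 = s.reg 24 ∧ t.reg 26 = s.reg 26 ∧
      t.reg 22 = hi ∧ lo ≤ t.reg 21 ∧ t.reg 23 = (if t.reg 21 < hi then 1 else 0) ∧
      t.reg 9 + (hi - t.reg 21) ≤ a + (hi - lo))
    (fun t => 50 * ((hi - t.reg 21 + W - 1) / W))
    (fun t => p (t.reg 9) (R + intervalCount T (t.reg 21) hi)) ?_ ?_ s ?_
  · rwa [h21, h9] at key
  · rintro t ⟨h1, h2, h3, h4, h5, h6, h7, h8'⟩ h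
    have h' : t.reg 23 = 0 := h
    rw [h'] at h7
    have h10 : ¬ t.reg 21 < hi := by
      intro h
      rw [if_pos h] at h7
      omega
    have h11 : intervalCount T (t.reg 21) hi = 0 := by
      rw [intervalCount, Ico_eq_empty h10]
      simp
    rw [h11]
    exact hF t h1 h2 h4 (by omega)
  · rintro t ⟨h1, h2, h3, h4, h5, h6, h7, h8'⟩ h
    have h' : t.reg 23 ≠ 0 := h
    have h10 : t.reg 21 < hi := by
      by_contra h
      rw [if_neg h] at h7
      exact h' h7
    have e8 : t.reg 8 = W := by rw [h1.1 8 (by norm_num) (by norm_num), h8]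
    obtain ⟨l, hl⟩ : ∃ l, t.reg 21 = l := ⟨_, rfl⟩
    obtain ⟨a', ha'⟩ : ∃ a', t.reg 9 = a' := ⟨_, rfl⟩
    rw [hl] at h6 h7 h8' h10
    rw [ha'] at h8'
    -- Also for an incomplete last chunk, where the subtraction is truncated: a draw beyond `hi` is
    -- simply not counted, so that each element is tested with probability `1 / W`.
    have htime : (hi - (l + W) + W - 1) / W + 1 ≤ (hi - l + W - 1) / W := by
      rw [← Nat.add_div_right _ hW]
      by_cases hc : l + W ≤ hi
      · exact Nat.div_le_div_right (by omega)
      · rw [show hi - (l + W) + W - 1 + W = W + (W - 1) by omega]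
        rw [Nat.add_div_left _ hW, Nat.div_eq_of_lt (show W - 1 < W by omega)]
        rw [Nat.le_div_iff_mul_le hW]
        omega
    refine ⟨49, ?_, ?_⟩
    · rw [hl]
      exact (by norm_num : 49 + 1 ≤ 50 * 1).trans
        (Nat.mul_le_mul_left 50 (le_trans (Nat.le_add_left 1 _) htime))
    have htime' : 50 * ((hi - (l + W) + W - 1) / W) + 50 ≤ 50 * ((hi - l + W - 1) / W) := by
      have := Nat.mul_le_mul_left 50 htime
      rwa [mul_add] at this
    rw [hl, ha']
    refine .seq (n := 1) (m := 47) (Triple.rand hM (by rw [e8]; exact hW) (by rw [e8]; omega) ?_)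
      le_rfl
    rw [e8, intervalCount_eq_add T l hi W, ← add_assoc]
    refine le_trans (sum_le_sum fun v hv => ?_) (le_of_le_of_eq
      (hp.sum_le (fun v => l + v < hi ∧ T (l + v)) a' (R + intervalCount T (l + W) hi))
      (by congr!))
    rw [mem_range] at hv
    refine bestBound_le_of_wlp hM (by omega) (by simp [chunkStep]; omega) ?_
    refine chunkStep_wlp hM2 hWM (by omega : a' + 1 < M) htest (t := t.put 25 v) (l := l) (W := W)
      (v := v)
      ⟨fun r hr hr' => by rw [State.put_reg, if_neg (by omega), h1.1 r hr hr'], h1.2⟩ (by simp [h2])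
      (by simp [h3]) (by simp [e8]) (by simp [ha']) (by simp [hl]) (by simp [h5]) (by simp) hv h6
      h10 fun t' g1 g2 g3 g4 g5 g6 g7 g8 => ?_
    have g4' : t'.reg 26 = s.reg 26 := by
      rw [g4]
      simpa using h4
    rw [if_pos]
    · rw [g6, g7]
      exact le_of_eq (by congr!)
    · rw [g7]
      refine ⟨⟨g1, g2, g3, g4', g5, by omega, g8, ?_⟩, by omega⟩
      rw [g6]
      split_ifs <;> omega
  · exact ⟨.refl s, rfl, rfl, rfl, h22, h21.ge, by rw [h21, h23], by rw [h9, h21]⟩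

/-- The chunk loop is run for all indices below the content of register `y`. -/
def forChunks (y : ℕ) (setup test : Prog) : Prog :=
  (set 20 (lit 0) ⨟ lt 26 (reg 20) (reg y)) ⨟
  loop (reg 26) ((setup ⨟ lt 23 (reg 21) (reg 22)) ⨟ chunkLoop test ⨟
    (add 20 (reg 20) (lit 1) ⨟ lt 26 (reg 20) (reg y)))

/-- `R` holds the objects of later phases, so that the red and the blue phase run under a single
potential. -/
theorem forChunks_triple (hM : M ≤ 2 ^ w) (hM2 : 64 ≤ M) {y n : ℕ} {setup test : Prog} {W R a : ℕ}
    {lo hi D : ℕ → ℕ} {p : ℕ → ℕ → ℝ≥0∞} (hp : IsPotential W p) {T : ℕ → ℕ → Prop} (hW : 0 < W)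
    (hy : y < 20) (hy9 : y ≠ 9) (hn : s.reg y = n) (hnM : n < M)
    (hWM : ∀ j < n, W + hi j < M)
    (h8 : s.reg 8 = W) (h9 : s.reg 9 = a) (haM : a + ∑ j ∈ range n, (hi j - lo j) < M)
    (hcost : test.cost ≤ 30) (hcost' : setup.cost ≤ 30)
    (hsetup : ∀ t, s.Keep t → ∀ j < n, t.reg 20 = j → ∀ Q, (∀ t', t.Keep t' → t'.reg 9 = t.reg 9 →
      t'.reg 20 = j → t'.reg 21 = lo j → t'.reg 22 = hi j → t'.reg 24 = D j → Q t') →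
      setup.wlp M (compareInput input) Q t)
    (htest : ∀ t, s.Keep t → ∀ j < n, t.reg 20 = j → t.reg 24 = D j →
      IsTest M (compareInput input) test t (T j) (lo j) (hi j))
    (hF : ∀ t, s.Keep t → t.reg 9 ≤ a + ∑ j ∈ range n, (hi j - lo j) → F t ≤ p (t.reg 9) R) :
    Triple w input (forChunks y setup test)
      (50 * ∑ j ∈ range n, ((hi j - lo j + W - 1) / W) + 100 * n + 10) s
      (p a (R + ∑ j ∈ range n, intervalCount (T j) (lo j) (hi j))) F := by
  classical
  have hM2' : 2 ≤ M := by omega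
  have hlit : ∀ n ≤ 63, n < M := fun n hn => by omega
  have hite : ∀ (p : Prop) [Decidable p], (if p then 1 else 0) < M := fun p _ => by
    split_ifs <;> omega
  refine .seq_wlp hM hM2' (m := 50 * ∑ j ∈ range n, ((hi j - lo j + W - 1) / W) + 100 * n + 1)
    (by simp; omega) ?_
  simp [hlit, hite, show y ≠ 20 by omega, hn]
  have key := Triple.loop (w := w) (input := input) (a := reg 26)
    (p := (setup ⨟ lt 23 (reg 21) (reg 22)) ⨟ chunkLoop test ⨟
    (add 20 (reg 20) (lit 1) ⨟ lt 26 (reg 20) (reg y))) (F := F)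
    (fun t => s.Keep t ∧ t.reg 20 ≤ n ∧ t.reg 26 = (if t.reg 20 < n then 1 else 0) ∧
      t.reg 9 + ∑ j ∈ Ico (t.reg 20) n, (hi j - lo j) ≤ a + ∑ j ∈ range n, (hi j - lo j))
    (fun t => 50 * ∑ j ∈ Ico (t.reg 20) n, ((hi j - lo j + W - 1) / W) + 100 * (n - t.reg 20))
    (fun t => p (t.reg 9) (R + ∑ j ∈ Ico (t.reg 20) n, intervalCount (T j) (lo j) (hi j))) ?_ ?_
    ((s.put 20 0).put 26 (if 0 < n then 1 else 0)) ?_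
  · simpa [h9] using key
  · rintro t ⟨h1, h2, h3, h4⟩ h
    have h' : t.reg 26 = 0 := h
    rw [h'] at h3
    have h5 : t.reg 20 = n := by
      by_contra h
      rw [if_pos (by omega)] at h3
      omega
    simp only [h5, Ico_self, sum_empty, add_zero] at h4 ⊢
    exact hF t h1 h4
  · rintro t ⟨h1, h2, h3, h4⟩ h
    have h' : t.reg 26 ≠ 0 := h
    have h5 : t.reg 20 < n := by
      by_contra h
      rw [if_neg h] at h3
      exact h' h3
    obtain ⟨j, hj⟩ : ∃ j, t.reg 20 = j := ⟨_, rfl⟩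
    obtain ⟨a', ha'⟩ : ∃ a', t.reg 9 = a' := ⟨_, rfl⟩
    rw [hj] at h2 h5 h4
    rw [ha'] at h4
    have hsplit : ∀ f : ℕ → ℕ, ∑ j ∈ Ico j n, f j = f j + ∑ j ∈ Ico (j + 1) n, f j :=
      fun f => sum_eq_sum_Ico_succ_bot h5 f
    rw [hsplit] at h4
    simp only [hj, ha']
    rw [hsplit, hsplit]
    obtain ⟨q, hq⟩ : ∃ q, (hi j - lo j + W - 1) / W = q := ⟨_, rfl⟩
    rw [hq]
    refine ⟨50 * q + 50, by omega, ?_⟩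
    refine .seq_wlp hM hM2' (m := 50 * q + 10) (by simp; omega) ?_
    rw [wlp_seq]
    refine hsetup t h1 j h5 hj _ fun t1 g1 g2 g3 g4 g5 g6 => ?_
    simp only [wlp_lt, fits_reg, true_and, val_reg, g4, g5]
    refine ⟨hite _, ?_⟩
    set t2 := t1.put 23 (if lo j < hi j then 1 else 0) with ht2
    have k2 : t1.Keep t2 :=
      ⟨fun r hr hr' => by rw [ht2, State.put_reg, if_neg (by omega)], rfl⟩
    have k3 := h1.trans (g1.trans k2)
    have e20 : t2.reg 20 = j := by simp [ht2, g3]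
    refine .seq (n := 50 * q + 1) (m := 3) ?_ (by omega)
    have hchunk := chunkLoop_triple (w := w) (input := input) (test := test) (s := t2) (a := a')
      (R := R + ∑ j ∈ Ico (j + 1) n, intervalCount (T j) (lo j) (hi j)) (lo := lo j) (hi := hi j)
      (T := T j) (F := bestBound w input (add 20 (reg 20) (lit 1) ⨟ lt 26 (reg 20) (reg y)) 3
        fun s' => if (s.Keep s' ∧ s'.reg 20 ≤ n ∧ s'.reg 26 = (if s'.reg 20 < n then 1 else 0) ∧
      s'.reg 9 + ∑ j ∈ Ico (s'.reg 20) n, (hi j - lo j) ≤ a + ∑ j ∈ range n, (hi j - lo j)) ∧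
      50 * ∑ j ∈ Ico (s'.reg 20) n, ((hi j - lo j + W - 1) / W) + 100 * (n - s'.reg 20) +
        (50 * q + 50) + 1 ≤ 50 * (q + ∑ j ∈ Ico (j + 1) n, ((hi j - lo j + W - 1) / W)) +
        100 * (n - j) then p (s'.reg 9) (R + ∑ j ∈ Ico (s'.reg 20) n,
          intervalCount (T j) (lo j) (hi j)) else ⊤) hM hM2 hp hW (hWM j h5)
      (by rw [k3.1 8 (by norm_num) (by norm_num), h8]) (by simp [ht2, g2, ha']) (by simp [ht2, g4])
      (by simp [ht2, g5]) (by simp [ht2]) (by omega) hcost (htest t2 k3 j h5 e20 (by simp [ht2, g6]))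
      ?_
    · rw [hq, add_assoc, add_comm (∑ j ∈ Ico (j + 1) n, intervalCount (T j) (lo j) (hi j))] at hchunk
      exact hchunk
    · intro t3 f1 f2 f3 f4
      have k4 := k3.trans f1
      have ey : t3.reg y = n := by rw [k4.1 y hy hy9, hn]
      obtain ⟨a3, ha3⟩ : ∃ a3, t3.reg 9 = a3 := ⟨_, rfl⟩
      rw [ha3] at f4 ⊢
      refine bestBound_le_of_wlp hM hM2' (by simp) ?_
      simp only [wlp_seq, wlp_add, wlp_lt, fits_reg, fits_lit, val_reg, val_lit, State.put_reg,
        if_true, f2, e20, if_neg (show y ≠ 20 by omega), ey]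
      refine ⟨trivial, by omega, by omega, trivial, trivial, hite _, ?_⟩
      simp only [Nat.reduceEqDiff, if_false, ha3]
      rw [if_pos]
      refine ⟨⟨k4.trans ⟨fun r hr hr' => ?_, rfl⟩, h5, trivial, by omega⟩, by omega⟩
      rw [State.put_reg, State.put_reg, if_neg (by omega), if_neg (by omega)]
  · refine ⟨⟨fun r hr hr' => ?_, rfl⟩, ?_⟩
    · rw [State.put_reg, State.put_reg, if_neg (by omega), if_neg (by omega)]
    · simp [h9]

end

/-! ### Sampling the candidate pairs -/

section

open Prog Operand

variable {w M : ℕ} {input : List ℝ} {N : ℕ} {ν : ℕ → ℝ} {s : State} {F : State → ℝ≥0∞} {c : ℝ≥0∞}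
variable {I : Instance N ν} {A : Family I}

/-! ### Sampling pairs of red and blue points -/

/-- The blue points which are paired directly with the red point in register `20`. -/
def redSetup : Prog := ld 24 4 (reg 20) ⨟ ld 21 1 (reg 24) ⨟ ld 22 5 (reg 20)

/-- Test the pair of the red point in register `24` and the blue point in register `25`. -/
def redTest : Prog := ld 33 2 (reg 25) ⨟ cmp 34 (reg 33) (reg 24) ⨟ add 9 (reg 9) (reg 34)

/-- The red points which are paired with the blue point in register `20` by means of levels. -/
def blueSetup : Prog := ld 24 2 (reg 20) ⨟ ld 21 9 (reg 20) ⨟ ld 22 10 (reg 20)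

/-- Test the pair of the red point in register `25` and the blue point in register `24`. -/
def blueTest : Prog :=
  ld 33 5 (reg 25) ⨟ lt 34 (reg 20) (reg 33) ⨟
    branch (reg 34) skip (ld 33 4 (reg 25) ⨟ cmp 34 (reg 24) (reg 33) ⨟ add 9 (reg 9) (reg 34))

/-- Count all pairs if there are fewer than `N₀` points, and sample otherwise. -/
def samplePairs (N₀ : ℕ) : Prog :=
  (set 12 (reg 20) ⨟ set 9 (lit 0) ⨟ lt 30 (reg 0) (lit N₀) ⨟
    branch (reg 30) (set 8 (lit 1)) (div 8 (reg 7) (reg 0) ⨟ add 8 (reg 8) (lit 1))) ⨟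
  forChunks 5 redSetup redTest ⨟ forChunks 12 blueSetup blueTest ⨟ mul 0 (reg 9) (reg 8)

/-- The number of pairs which are found in the intervals. -/
def Family.found (A : Family I) (m : ℕ) (lo hi : ℕ → ℕ) : ℕ :=
  ∑ e ∈ range A.g, intervalCount (fun b => ν (I.bp b) < ν (A.GP e)) (I.cb (A.GP e)) (A.GX e) +
  ∑ b ∈ range m, intervalCount (fun e => A.GX e ≤ b ∧ ν (I.bp b) < ν (A.GP e)) (lo b) (hi b)

/-- The number of candidates for pairs. -/
def Family.tot (A : Family I) (m : ℕ) (lo hi : ℕ → ℕ) : ℕ :=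
  ∑ e ∈ range A.g, (A.GX e - I.cb (A.GP e)) + ∑ b ∈ range m, (hi b - lo b)

/-- Rounding up costs at most one extra chunk per interval. -/
theorem sum_div_le {n W : ℕ} (hW : 0 < W) (f : ℕ → ℕ) :
    ∑ j ∈ range n, (f j + W - 1) / W ≤ (∑ j ∈ range n, f j) / W + n := by
  induction n with
  | zero => simp
  | succ n ih =>
    rw [sum_range_succ, sum_range_succ]
    have h1 : (f n + W - 1) / W ≤ f n / W + 1 := by
      rw [← Nat.add_div_right _ hW]
      exact Nat.div_le_div_right (by omega)
    have h2 := Nat.div_add_div_le_add_div (x := ∑ j ∈ range n, f j) (y := f n) (z := W)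
    omega

theorem Family.Assigned.tot_le {m : ℕ} {lo hi : ℕ → ℕ} (hA : A.Assigned m lo hi s) :
    A.tot m lo hi ≤ 2 * N * N := by
  have hnb := I.nb_le
  have h1 : ∑ e ∈ range A.g, (A.GX e - I.cb (A.GP e)) ≤ A.g * I.nb := sum_sub_le_mul A.GX_le
  have h2 : ∑ b ∈ range m, (hi b - lo b) ≤ m * A.g := sum_sub_le_mul fun b hb => (hA.hi_le b hb).2
  have h3 : A.g * I.nb ≤ N * N := Nat.mul_le_mul A.g_le hnb
  have h4 : m * A.g ≤ N * N := Nat.mul_le_mul (hA.m_le.trans hnb) A.g_le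
  rw [Family.tot, mul_assoc]
  omega

section

variable {m : ℕ} {lo hi : ℕ → ℕ} {co : ℕ → ℕ → ℕ} {Q : State → Prop} {t : State}

theorem redSetup_wlp (hA : A.Assigned m lo hi s) (hNM : 64 * (2 * N + 1) ≤ M) (ht : t.arr = s.arr)
    {e : ℕ} (he : e < A.g) (h20 : t.reg 20 = e) (hQ : ∀ t', t.Keep t' → t'.reg 9 = t.reg 9 →
      t'.reg 20 = e → t'.reg 21 = I.cb (A.GP e) → t'.reg 22 = A.GX e → t'.reg 24 = A.GP e → Q t') :
    redSetup.wlp M co Q t := by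
  have hnb := I.nb_le
  have h1 := A.GP_lt e he
  have h2 := A.GX_le e he
  have h3 := I.cb_le _ h1
  have h4 := A.g_le
  have e4 : t.arr 4 e = A.GP e := by rw [ht, hA.arr4 e he]
  have e1 : t.arr 1 (A.GP e) = I.cb (A.GP e) := by rw [ht, hA.arr1 _ h1]
  have e5 : t.arr 5 e = A.GX e := by rw [ht, hA.arr5 e he]
  simp [redSetup, wlp_ld, h20, e4, e1, e5]
  refine ⟨by omega, by omega, by omega, by omega, by omega, by omega, by omega, by omega,
    by omega, ?_⟩
  refine hQ _ ⟨fun r hr hr' => ?_, rfl⟩ ?_ ?_ ?_ ?_ ?_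
  · simp [show r ≠ 60 by omega, show r ≠ 24 by omega, show r ≠ 21 by omega, show r ≠ 22 by omega]
  all_goals simp [h20]

theorem blueSetup_wlp (hA : A.Assigned m lo hi s) (hNM : 64 * (2 * N + 1) ≤ M) (ht : t.arr = s.arr)
    {b : ℕ} (hb : b < m) (h20 : t.reg 20 = b) (hQ : ∀ t', t.Keep t' → t'.reg 9 = t.reg 9 →
      t'.reg 20 = b → t'.reg 21 = lo b → t'.reg 22 = hi b → t'.reg 24 = I.bp b → Q t') :
    blueSetup.wlp M co Q t := by
  have hnb := I.nb_le
  have hm := hA.m_le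
  have h1 := I.bp_lt b (by omega)
  have h2 := hA.hi_le b hb
  have h4 := A.g_le
  have e2 : t.arr 2 b = I.bp b := by rw [ht, hA.arr2 b (by omega)]
  have e9 : t.arr 9 b = lo b := by rw [ht, hA.arr9 b hb]
  have e10 : t.arr 10 b = hi b := by rw [ht, hA.arr10 b hb]
  simp [blueSetup, wlp_ld, h20, e2, e9, e10]
  refine ⟨by omega, by omega, by omega, by omega, by omega, by omega, by omega, by omega,
    by omega, ?_⟩
  refine hQ _ ⟨fun r hr hr' => ?_, rfl⟩ ?_ ?_ ?_ ?_ ?_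
  · simp [show r ≠ 60 by omega, show r ≠ 24 by omega, show r ≠ 21 by omega, show r ≠ 22 by omega]
  all_goals simp [h20]

theorem isTest_redTest (hA : A.Assigned m lo hi s) (hNM : 64 * (2 * N + 1) ≤ M) (ht : t.arr = s.arr)
    (hcmp : ∀ a < 2 * N, ∀ b < 2 * N, co a b = if ν a < ν b then 1 else 0)
    {e : ℕ} (he : e < A.g) (h24 : t.reg 24 = A.GP e) :
    IsTest M co redTest t (fun b => ν (I.bp b) < ν (A.GP e)) (I.cb (A.GP e)) (A.GX e) := by
  intro t1 b Q' h1 h2 h3 h4 h5 h6 h7 hQ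
  have hnb := I.nb_le
  have g1 := A.GP_lt e he
  have g2 := A.GX_le e he
  have g3 := I.bp_lt b (by omega)
  have e2 : t1.arr 2 b = I.bp b := by rw [h1.2, ht, hA.arr2 b (by omega)]
  have hite : (if ν (I.bp b) < ν (A.GP e) then 1 else 0) ≤ 1 := by split_ifs <;> omega
  simp [redTest, wlp_ld, h4, e2, h3, h24, hcmp _ g3 _ (show A.GP e < 2 * N by omega)]
  refine ⟨by omega, by omega, by omega, by omega, hQ _ (fun r hr hr' => ?_) rfl ?_⟩
  · simp [show r ≠ 60 by omega, show r ≠ 33 by omega, show r ≠ 34 by omega, hr']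
  · simp

/-- Red points with `A.GX e > b` are rejected: their pairs with blue point `b` belong to the direct
phase and must not be counted twice. -/
theorem isTest_blueTest (hA : A.Assigned m lo hi s) (hNM : 64 * (2 * N + 1) ≤ M) (ht : t.arr = s.arr)
    (hcmp : ∀ a < 2 * N, ∀ b < 2 * N, co a b = if ν a < ν b then 1 else 0)
    {b : ℕ} (hb : b < m) (h20 : t.reg 20 = b) (h24 : t.reg 24 = I.bp b) :
    IsTest M co blueTest t (fun e => A.GX e ≤ b ∧ ν (I.bp b) < ν (A.GP e)) (lo b) (hi b) := by
  intro t1 e Q' h1 h2 h3 h4 h5 h6 h7 hQ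
  have hnb := I.nb_le
  have hm := hA.m_le
  have g0 := (hA.hi_le b hb).2
  have gg := A.g_le
  have he : e < A.g := by omega
  have g1 := A.GP_lt e he
  have g2 := A.GX_le e he
  have g3 := I.bp_lt b (by omega)
  have e5 : t1.arr 5 e = A.GX e := by rw [h1.2, ht, hA.arr5 e he]
  have e4 : t1.arr 4 e = A.GP e := by rw [h1.2, ht, hA.arr4 e he]
  have hite : (if ν (I.bp b) < ν (A.GP e) then 1 else 0) ≤ 1 := by split_ifs <;> omega
  have hite' : (if b < A.GX e then 1 else 0) ≤ 1 := by split_ifs <;> omega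
  simp [blueTest, wlp_ld, h4, e5, e4, h3, h2, h20, h24, hcmp _ g3 _ (show A.GP e < 2 * N by omega)]
  refine ⟨by omega, by omega, by omega, by omega, fun h => ⟨by omega, by omega, by omega, by omega, ?_⟩,
    fun h => ?_⟩
  · refine hQ _ (fun r hr hr' => ?_) rfl ?_
    · simp [show r ≠ 60 by omega, show r ≠ 33 by omega, show r ≠ 34 by omega, hr']
    · simp [h]
  · refine hQ _ (fun r hr hr' => ?_) rfl ?_
    · simp [show r ≠ 60 by omega, show r ≠ 33 by omega, show r ≠ 34 by omega]
    · simp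
      omega

end

theorem samplePairs_triple (hM : M ≤ 2 ^ w) {m : ℕ} {lo hi : ℕ → ℕ} (hA : A.Assigned m lo hi s)
    (hNM : 64 * (2 * N + 1) * (2 * N + 1) * (2 * N + 1) ≤ M) {N₀ W : ℕ} (hN : 0 < N) (hN₀ : N₀ < M)
    (hcmp : ∀ a < 2 * N, ∀ b < 2 * N, compareInput input a b = if ν a < ν b then 1 else 0)
    (hW : W = if N < N₀ then 1 else A.tot m lo hi / N + 1) {p : ℕ → ℕ → ℝ≥0∞}
    (hp : IsPotential W p) (hF : ∀ t cnt, t.reg 0 = cnt * W → F t ≤ p cnt 0) :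
    Triple w input (samplePairs N₀) ((200 * N₀ + 500) * N + 50) s (p 0 (A.found m lo hi)) F := by
  have hnb := I.nb_le
  have hm := hA.m_le
  have hg := A.g_le
  have htot := hA.tot_le
  obtain ⟨tot, ht⟩ : ∃ tot, A.tot m lo hi = tot := ⟨_, rfl⟩
  have hNM2 : 64 * (2 * N + 1) * (2 * N + 1) ≤ M := (Nat.le_mul_of_pos_right _ (by omega)).trans hNM
  have hNM1 : 64 * (2 * N + 1) ≤ M := (Nat.le_mul_of_pos_right _ (by omega)).trans hNM2
  have hM2 : 2 ≤ M := by omega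
  have hlit : ∀ n ≤ 63, n < M := fun n hn => by omega
  have hite : ∀ (p : Prop) [Decidable p], (if p then 1 else 0) < M := fun p _ => by
    split_ifs <;> omega
  have h7 : s.reg 7 = tot := hA.reg7.trans ht
  rw [ht] at hW htot
  have hWpos : 0 < W := by
    rw [hW]
    split_ifs
    exacts [one_pos, Nat.succ_pos _]
  have hdiv : tot / N ≤ 2 * N := Nat.div_le_of_le_mul (by rw [mul_comm N]; exact htot)
  have hWle : W ≤ 2 * N + 1 := by
    rw [hW]
    split_ifs
    exacts [Nat.succ_le_succ (Nat.zero_le _), Nat.succ_le_succ hdiv]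
  have htotM : tot + 1 < M := by nlinarith
  have hprod : tot * W < M := by
    have : tot * W ≤ 2 * N * N * (2 * N + 1) := Nat.mul_le_mul htot hWle
    nlinarith
  -- For large `N` the choice of `W` leaves at most `N` full chunks. For `N < N₀` all of the at most
  -- `2 * N * N` candidates are tested, which is linear in `N` with a factor depending on `N₀`.
  have hquot : tot / W ≤ (2 * N₀ + 1) * N := by
    rw [hW]
    split_ifs with h
    · rw [Nat.div_one]
      nlinarith
    · have h1 : tot / (tot / N + 1) ≤ N := by
        refine Nat.div_le_of_le_mul ?_
        have := Nat.lt_div_mul_add (a := tot) (b := N) hN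
        rw [add_mul, one_mul]
        exact this.le
      exact h1.trans (Nat.le_mul_of_pos_left _ (Nat.succ_pos _))
  have hsum : ∑ e ∈ range A.g, (A.GX e - I.cb (A.GP e)) + ∑ b ∈ range m, (hi b - lo b) = tot := ht
  have hq1 := sum_div_le hWpos (n := A.g) fun e => A.GX e - I.cb (A.GP e)
  have hq2 := sum_div_le hWpos (n := m) fun b => hi b - lo b
  have hq3 := Nat.div_add_div_le_add_div (x := ∑ e ∈ range A.g, (A.GX e - I.cb (A.GP e)))
    (y := ∑ b ∈ range m, (hi b - lo b)) (z := W)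
  rw [hsum] at hq3
  refine .seq_wlp hM hM2 (m := (200 * N₀ + 500) * N + 30) (by simp; omega) ?_
  suffices hmain : ∀ t, t.arr = s.arr → (∀ r < 8, t.reg r = s.reg r) → t.reg 12 = m →
      t.reg 9 = 0 → t.reg 8 = W → Triple w input (forChunks 5 redSetup redTest ⨟
        forChunks 12 blueSetup blueTest ⨟ mul 0 (reg 9) (reg 8)) ((200 * N₀ + 500) * N + 30) t
        (p 0 (A.found m lo hi)) F by
    simp [hlit, hA.reg20, hA.reg0, h7, hN₀]
    refine ⟨by omega, hite _, fun h => ⟨by omega, by omega, ?_⟩, fun h => ?_⟩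
    · refine hmain _ ?_ ?_ ?_ ?_ ?_
      · simp
      · intro r hr
        simp [show r ≠ 12 by omega, show r ≠ 9 by omega, show r ≠ 30 by omega, show r ≠ 8 by omega]
      · simp
      · simp
      · simp [hW, h]
    · refine hmain _ ?_ ?_ ?_ ?_ ?_
      · simp
      · intro r hr
        simp [show r ≠ 12 by omega, show r ≠ 9 by omega, show r ≠ 30 by omega, show r ≠ 8 by omega]
      · simp
      · simp
      · simp [hW, h]
  intro t ha hr h12 h9 h8
  have hM64 : 64 ≤ M := by omega
  obtain ⟨totE, hE⟩ : ∃ x, ∑ e ∈ range A.g, (A.GX e - I.cb (A.GP e)) = x := ⟨_, rfl⟩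
  obtain ⟨totF, hFF⟩ : ∃ x, ∑ b ∈ range m, (hi b - lo b) = x := ⟨_, rfl⟩
  obtain ⟨nE, hnE⟩ : ∃ x, ∑ j ∈ range A.g, (A.GX j - I.cb (A.GP j) + W - 1) / W = x := ⟨_, rfl⟩
  obtain ⟨nF, hnF⟩ : ∃ x, ∑ j ∈ range m, (hi j - lo j + W - 1) / W = x := ⟨_, rfl⟩
  rw [hE] at hq1 hq3 hsum
  rw [hFF] at hq2 hq3 hsum
  rw [hnE] at hq1
  rw [hnF] at hq2
  generalize totE / W = q1 at *
  generalize totF / W = q2 at *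
  generalize tot / W = q at *
  have hlin : (200 * N₀ + 500) * N = 100 * ((2 * N₀ + 1) * N) + 400 * N := by ring
  refine .seq (n := 50 * nE + 100 * A.g + 10) (m := 50 * nF + 100 * m + 12)
    (c := p 0 (A.found m lo hi)) ?_ (by omega)
  have key := forChunks_triple (w := w) (input := input) (s := t) (setup := redSetup)
    (test := redTest) (R := ∑ b ∈ range m,
      intervalCount (fun e => A.GX e ≤ b ∧ ν (I.bp b) < ν (A.GP e)) (lo b) (hi b))
    (F := bestBound w input (forChunks 12 blueSetup blueTest ⨟ mul 0 (reg 9) (reg 8))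
      (50 * nF + 100 * m + 12) F)
    (lo := fun e => I.cb (A.GP e)) (hi := A.GX) (D := A.GP)
    (T := fun e b => ν (I.bp b) < ν (A.GP e)) (n := A.g) (y := 5) hM hM64 hp
    hWpos (by norm_num) (by norm_num) ((hr 5 (by norm_num)).trans hA.reg5) (by omega)
    (fun j hj => by have := A.GX_le j hj; omega) h8 h9 (by rw [hE]; omega) (by simp [redTest])
    (by simp [redSetup])
    (fun t1 h1 e he h20 Q hQ => redSetup_wlp hA hNM1 (h1.2.trans ha) he h20 hQ)
    (fun t1 h1 e he h20 h24 => isTest_redTest hA hNM1 (h1.2.trans ha) hcmp he h24) ?_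
  · rw [hnE, add_comm (∑ b ∈ range m, _)] at key
    exact key
  intro t1 h1 h1'
  rw [hE, zero_add] at h1'
  obtain ⟨a, ha'⟩ : ∃ a, t1.reg 9 = a := ⟨_, rfl⟩
  rw [ha'] at h1' ⊢
  refine Triple.bestBound_le (.seq (n := 50 * nF + 100 * m + 10) (m := 1) ?_ (by omega))
  have key := forChunks_triple (w := w) (input := input) (s := t1) (setup := blueSetup)
    (test := blueTest) (R := 0) (F := bestBound w input (mul 0 (reg 9) (reg 8)) 1 F)
    (lo := lo) (hi := hi) (D := I.bp)
    (T := fun b e => A.GX e ≤ b ∧ ν (I.bp b) < ν (A.GP e)) (n := m) (y := 12) hM hM64 hp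
    hWpos (by norm_num) (by norm_num) ((h1.1 12 (by norm_num) (by norm_num)).trans h12) (by omega)
    (fun j hj => by have := (hA.hi_le j hj).2; omega)
    ((h1.1 8 (by norm_num) (by norm_num)).trans h8) ha' (by rw [hFF]; omega) (by simp [blueTest])
    (by simp [blueSetup])
    (fun t2 h2 b hb h20 Q hQ => blueSetup_wlp hA hNM1 (h2.2.trans (h1.2.trans ha)) hb h20 hQ)
    (fun t2 h2 b hb h20 h24 =>
      isTest_blueTest hA hNM1 (h2.2.trans (h1.2.trans ha)) hcmp hb h20 h24) ?_
  · rw [hnF, zero_add] at key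
    exact key
  intro t2 h2 h2'
  rw [hFF] at h2'
  have e8 : t2.reg 8 = W := by
    rw [h2.1 8 (by norm_num) (by norm_num), h1.1 8 (by norm_num) (by norm_num), h8]
  refine bestBound_le_of_wlp hM hM2 (by simp) ?_
  simp only [wlp_mul, fits_reg, val_reg, true_and, e8]
  exact ⟨(Nat.mul_le_mul_right W (by omega)).trans_lt hprod, hF _ _ (by simp)⟩

end

/-! ### Candidates contain all pairs, and there are few of them -/

section

open Prog Operand

variable {w M : ℕ} {input : List ℝ} {N : ℕ} {ν : ℕ → ℝ} {s : State} {F : State → ℝ≥0∞} {c : ℝ≥0∞}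
variable {I : Instance N ν} {A : Family I}

/-! ### The approximate number of pairs -/

theorem intervalCount_eq_sum (T : ℕ → Prop) [DecidablePred T] (lo hi : ℕ) :
    intervalCount T lo hi = ∑ u ∈ Ico lo hi, if T u then 1 else 0 := by
  rw [intervalCount, card_filter]
  congr!

/-- Good intervals account for all pairs. -/
theorem Family.Covered.found_eq {ℓ m : ℕ} {lo hi : ℕ → ℕ} (h : A.Covered ℓ m lo hi)
    (hhi : ∀ b < m, hi b ≤ A.g) : A.found m lo hi = I.total := by
  have h1 : ∀ b ∈ range m,
      intervalCount (fun e => A.GX e ≤ b ∧ ν (I.bp b) < ν (A.GP e)) (lo b) (hi b) =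
      ∑ e ∈ range A.g, if A.GX e ≤ b ∧ ν (I.bp b) < ν (A.GP e) then 1 else 0 := by
    intro b hb
    rw [mem_range] at hb
    rw [intervalCount_eq_sum]
    refine sum_subset (fun e he => ?_) fun e he he' => if_neg fun h' => he' ?_
    · rw [mem_Ico] at he
      exact mem_range.2 (he.2.trans_le (hhi b hb))
    · rw [mem_Ico]
      exact h.covers b hb e (mem_range.1 he) h'.1 h'.2
  rw [Family.found, h.good.total_eq, sum_congr rfl h1, sum_comm, ← sum_add_distrib]
  refine sum_congr rfl fun e he => ?_
  have he' := mem_range.1 he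
  have h2 := h.good.range e he'
  have h3 := A.GX_le e he'
  -- The partners of red point `e` split at `A.GX e`: those before it are direct candidates, the
  -- others come from the intervals of blue points.
  rw [intervalCount_eq_sum, Instance.below, card_filter, ← sum_Ico_consecutive _ h2 h3, h.m_eq]
  congr 1
  rw [range_eq_Ico, ← sum_Ico_consecutive _ (Nat.zero_le (A.GX e)) h3]
  rw [sum_eq_zero fun b hb => if_neg fun h => ?_, zero_add]
  · refine sum_congr rfl fun b hb => ?_
    rw [mem_Ico] at hb
    exact if_congr (and_iff_right hb.1) rfl rfl
  · rw [mem_Ico] at hb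
    omega

theorem Family.Covered.tot_le {ℓ m : ℕ} {lo hi : ℕ → ℕ} (h : A.Covered ℓ m lo hi) :
    A.tot m lo hi ≤ ℓ * (4 * I.nb + 2 * A.g) := by
  have h1 := h.good.mass
  have h2 := h.sum_le
  have h3 : ℓ * (4 * I.nb + 2 * A.g) = 4 * ℓ * I.nb + 2 * ℓ * A.g := by ring
  rw [Family.tot]
  omega

/-- If `ℓ` was doubled, then `ℓ ^ 2 ≤ 8 * K` and `n ^ 2 ≤ K * N ≤ K * ℓ₀ ^ 2`. So `(6 * ℓ * n) ^ 2 ≤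
288 * (K * ℓ₀) ^ 2`, and `288 < 17 ^ 2`. -/
theorem mul_le_of_scale {ℓ ℓ₀ K n N : ℕ} (hℓ : ℓ = ℓ₀ ∨ ℓ * ℓ ≤ 8 * K) (hnN : n ≤ N)
    (hnK : n ≤ K) (hN : N ≤ ℓ₀ * ℓ₀) : ℓ * (6 * n) ≤ 17 * K * ℓ₀ := by
  rcases hℓ with rfl | hℓ
  · nlinarith [Nat.mul_le_mul_left ℓ hnK]
  · refine Nat.mul_self_le_mul_self_iff.1 ?_
    have h1 : n * n ≤ K * (ℓ₀ * ℓ₀) := Nat.mul_le_mul hnK (hnN.trans hN)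
    have h2 := Nat.mul_le_mul hℓ h1
    calc ℓ * (6 * n) * (ℓ * (6 * n)) = 36 * (ℓ * ℓ * (n * n)) := by ring
      _ ≤ 36 * (8 * K * (K * (ℓ₀ * ℓ₀))) := Nat.mul_le_mul_left _ h2
      _ ≤ 17 * K * ℓ₀ * (17 * K * ℓ₀) := by
        have : 17 * K * ℓ₀ * (17 * K * ℓ₀) = 289 * (K * (K * (ℓ₀ * ℓ₀))) := by ring
        rw [this]
        have : 36 * (8 * K * (K * (ℓ₀ * ℓ₀))) = 288 * (K * (K * (ℓ₀ * ℓ₀))) := by ring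
        rw [this]
        omega

/-- The number of pairs of the stored instance is computed approximately. -/
def countPairs (N₀ : ℕ) : Prog := sweep ⨟ flush ⨟ assignIntervals ⨟ samplePairs N₀

/-- Used to bound the time of the sampling after a failed sweep. -/
theorem isPotential_one (W : ℕ) : IsPotential W fun _ _ => 1 := by
  intro d hd a r
  rw [mul_one, mul_one, mul_one, ← Nat.cast_add, Nat.sub_add_cancel hd]

/-- The chunk length is known only after the sweep, so `hF` has to provide a potential for every `W`
which satisfies the bound on the candidates. -/
theorem countPairs_triple (hM : M ≤ 2 ^ w) (hI : I.Stored s) {N₀ ℓ₀ d : ℕ} {δ δ' : ℝ≥0∞}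
    (h2 : s.reg 2 = ℓ₀) (h3 : s.reg 3 = d) (hℓ : 0 < ℓ₀) (hℓN : ℓ₀ ≤ N) (hNℓ : N ≤ ℓ₀ * ℓ₀)
    (hδ : 4 * ℓ₀ ≤ N → ∃ e, 0 < e ∧ d = 2 * e ∧ d * d ≤ ℓ₀ ∧ attemptError N e ℓ₀ ≤ δ)
    (hNM : 64 * (2 * N + 1) * (2 * N + 1) * (2 * N + 1) ≤ M) (hN₀ : N₀ < M)
    (hcmp : ∀ a < 2 * N, ∀ b < 2 * N, compareInput input a b = if ν a < ν b then 1 else 0)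
    (hnb : I.nb ≤ I.total) (hg : (I.reds (N - 1)).length ≤ I.total) (hF1 : ∀ t, F t ≤ 1)
    (hF : ∀ W, 0 < W → (N < N₀ → W = 1) → N * (W - 1) ≤ 17 * I.total * ℓ₀ →
      ∃ p, IsPotential W p ∧ (∀ t cnt, t.reg 0 = cnt * W → F t ≤ p cnt 0) ∧ p 0 I.total ≤ δ') :
    Triple w input (countPairs N₀) ((200 * N₀ + 2500) * N + 150) s (δ' + N * δ) F := by
  have hN : 0 < N := hℓ.trans_le hℓN
  have hNM2 : 64 * (2 * N + 1) * (2 * N + 1) ≤ M := (Nat.le_mul_of_pos_right _ (by omega)).trans hNM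
  have hlin : (200 * N₀ + 2500) * N = (200 * N₀ + 500) * N + 2000 * N := by ring
  have hrest : ∀ {t : State} {A : Family I} {c : ℝ≥0∞}, A.Stored t →
      (∀ t m lo hi, A.Assigned m lo hi t → (∀ ℓ, A.Good ℓ → A.Covered ℓ m lo hi) →
        Triple w input (samplePairs N₀) ((200 * N₀ + 500) * N + 50) t c F) →
      Triple w input (assignIntervals ⨟ samplePairs N₀) ((200 * N₀ + 1500) * N + 80) t c F := by
    intro t A c hA h
    refine .seq (assignIntervals_triple hM hA hNM2 hcmp fun t m lo hi h1 h2 =>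
      (h t m lo hi h1 h2).bestBound_le) ?_
    have : (200 * N₀ + 1500) * N = (200 * N₀ + 500) * N + 1000 * N := by ring
    omega
  have hlin' : (200 * N₀ + 2500) * N = (200 * N₀ + 1500) * N + 1000 * N := by ring
  refine .seq (n := 800 * N + 20) (m := (200 * N₀ + 1500) * N + 60 * N + 110) ?_ (by omega)
  refine sweep_triple hM hI h2 h3 hℓ hℓN hδ hNM2 hcmp (fun t σ hσ hs => ?_) fun t σ hσ hs hg' => ?_
  · refine Triple.bestBound_le (.seq (flush_triple hM hσ hs hNM2 fun t' hA =>
      Triple.bestBound_le (hrest hA fun t'' m lo hi h1 _ => ?_)) (by omega))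
    exact samplePairs_triple hM h1 hNM hN hN₀ hcmp rfl (isPotential_one _) fun t _ _ => hF1 t
  · refine Triple.bestBound_le (.seq (flush_triple hM hσ hs hNM2 fun t' hA =>
      Triple.bestBound_le (hrest hA fun t'' m lo hi h1 h2 => ?_)) (by omega))
    have hcov := h2 _ (Sweep.family_good hs hg')
    generalize σ.family I hs = A at *
    have hgN : A.g ≤ I.total := hcov.good.g_eq ▸ hg
    have htot : A.tot m lo hi ≤ 17 * I.total * ℓ₀ := by
      refine (hcov.tot_le.trans (Nat.mul_le_mul_left _ ?_)).trans
        (mul_le_of_scale (n := max I.nb A.g) hg'.scale (max_le I.nb_le A.g_le) (max_le hnb hgN) hNℓ)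
      omega
    obtain ⟨p, hp, hp1, hp2⟩ := hF (if N < N₀ then 1 else A.tot m lo hi / N + 1)
      (by split_ifs; exacts [one_pos, Nat.succ_pos _]) (fun h => if_pos h) (by
        split_ifs
        · simp
        · exact (Nat.mul_div_le _ _).trans htot)
    refine (samplePairs_triple hM h1 hNM hN hN₀ hcmp rfl hp hp1).mono le_rfl ?_ fun _ => le_rfl
    rwa [hcov.found_eq fun b hb => (h1.hi_le b hb).2]

end

/-! ### From two lists to an instance without unmatched points -/

section

open Prog Operand

/-! ### The instance which is given by two lists -/

section

variable (N : ℕ) (ν : ℕ → ℝ)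

open Classical in
theorem lt_card_of_lt_count {P : ℕ → Prop} {b n : ℕ} (hb : b < Nat.count P n)
    (hf : (Set.ofPred P).Finite) : b < #hf.toFinset := hb.trans_le (Nat.count_le_card hf n)

open Classical in
/-- The instance with all points which occur in a pair. -/
def matchedInstance : Instance N ν where
  nb := Nat.count (BlueMatched N ν) N
  red := RedMatched N ν
  cb := fun i => Nat.count (BlueMatched N ν) (i + 1)
  bp := fun b => N + Nat.nth (BlueMatched N ν) b
  nb_le := Nat.count_le _
  cb_le := fun i hi => Nat.count_monotone _ hi
  cb_mono := fun i j h => Nat.count_monotone _ (Nat.succ_le_succ h)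
  cb_lt := fun i ⟨j, hj, hij, h⟩ _ =>
    (Nat.count_monotone _ hij).trans_lt (Nat.count_strict_mono ⟨i, hij, h⟩ hj)
  bp_lt := fun b hb => by
    have := Nat.nth_lt_of_lt_count hb
    omega

/-- The number of blue points which dominate a red point. -/
def dominating (i : ℕ) : ℕ := #{j ∈ range N | i < j ∧ ν (N + j) < ν i}

open Classical in
-- Every blue point which dominates `i` is matched, so the rank `Nat.count` is a bijection from the
-- dominating positions to the corresponding numbers, with inverse `Nat.nth`.
theorem matchedInstance_below (i : ℕ) : (matchedInstance N ν).below
    ((matchedInstance N ν).cb i) i = dominating N ν i := by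
  rw [Instance.below, dominating]
  symm
  refine card_bij (fun j _ => Nat.count (BlueMatched N ν) j) (fun j hj => ?_)
    (fun j hj j' hj' h => ?_) fun b hb => ?_
  · simp only [mem_filter, mem_range] at hj
    have hP : BlueMatched N ν j := ⟨i, hj.2⟩
    refine mem_filter.2 ⟨mem_Ico.2
      ⟨Nat.count_monotone _ hj.2.1, Nat.count_strict_mono hP hj.1⟩, ?_⟩
    simpa only [matchedInstance, Nat.nth_count hP] using hj.2.2
  · simp only [mem_filter, mem_range] at hj hj'
    exact Nat.count_injective ⟨i, hj.2⟩ ⟨i, hj'.2⟩ h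
  · rw [mem_filter, mem_Ico] at hb
    simp only [matchedInstance] at hb
    have h1 := Nat.count_nth (lt_card_of_lt_count hb.1.2)
    refine ⟨Nat.nth (BlueMatched N ν) b, ?_, h1⟩
    simp only [mem_filter, mem_range]
    refine ⟨Nat.nth_lt_of_lt_count hb.1.2, ?_, hb.2⟩
    by_contra h
    have h2 := Nat.count_strict_mono (Nat.nth_mem b (lt_card_of_lt_count hb.1.2))
      (show Nat.nth (BlueMatched N ν) b < i + 1 by omega)
    rw [h1] at h2
    omega

theorem dominating_pos {i : ℕ} : 0 < dominating N ν i ↔ RedMatched N ν i := by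
  rw [dominating, card_pos]
  constructor
  · rintro ⟨j, hj⟩
    simp only [mem_filter, mem_range] at hj
    exact ⟨j, hj⟩
  · rintro ⟨j, hj⟩
    exact ⟨j, by simpa using hj⟩

theorem matchedInstance_total : (matchedInstance N ν).total = ∑ i ∈ range N, dominating N ν i := by
  classical
  -- The last red point has no blue point to its right, so the sweep can stop before it.
  have h1 : ∀ i ∈ range N, i ∉ range (N - 1) → dominating N ν i = 0 := by
    intro i hi hi'
    by_contra h
    obtain ⟨j, hj, hij, -⟩ := (dominating_pos N ν).1 (Nat.pos_of_ne_zero h)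
    simp only [mem_range] at hi'
    omega
  rw [← sum_subset (range_subset_range.2 (Nat.sub_le N 1)) h1, Instance.total]
  simp only [matchedInstance_below, Instance.reds]
  generalize N - 1 = n
  induction n with
  | zero => simp
  | succ n ih =>
    rw [List.range_succ, List.filter_append, List.map_append, List.sum_append, ih, sum_range_succ]
    congr 1
    by_cases h : RedMatched N ν n
    · simp [matchedInstance, h]
    · have : dominating N ν n = 0 := by
        by_contra h'
        exact h ((dominating_pos N ν).1 (Nat.pos_of_ne_zero h'))
      simp [matchedInstance, h, this]

theorem matchedInstance_reds_le :
    ((matchedInstance N ν).reds (N - 1)).length ≤ (matchedInstance N ν).total := by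
  rw [Instance.total]
  have : ∀ x ∈ ((matchedInstance N ν).reds (N - 1)).map fun h =>
      (matchedInstance N ν).below ((matchedInstance N ν).cb h) h, 1 ≤ x := by
    intro x hx
    obtain ⟨h, hh, rfl⟩ := List.mem_map.1 hx
    rw [matchedInstance_below]
    exact (dominating_pos N ν).2 (Instance.mem_reds.1 hh).2
  simpa using List.card_nsmul_le_sum _ 1 this

/-- Each listed blue point occurs in some pair. This and its red analogue are the reason for
removing unmatched points: the number of candidates can be bounded by the number of pairs. -/
theorem matchedInstance_nb_le : (matchedInstance N ν).nb ≤ (matchedInstance N ν).total := by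
  classical
  have h1 : (matchedInstance N ν).nb = #{j ∈ range N | BlueMatched N ν j} :=
    Nat.count_eq_card_filter_range _ _
  simp only [h1, matchedInstance_total, dominating, card_filter]
  rw [sum_comm]
  refine sum_le_sum fun j hj => ?_
  split_ifs with h
  · obtain ⟨i, hij, h⟩ := h
    rw [mem_range] at hj
    exact (if_pos ⟨hij, h⟩).ge.trans (single_le_sum
      (f := fun i => if i < j ∧ ν (N + j) < ν i then 1 else 0) (fun _ _ => Nat.zero_le _)
      (mem_range.2 (hij.trans hj)))
  · exact Nat.zero_le _

end

variable {N : ℕ}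

theorem getD_append_ofFn (R B : Fin N → ℝ) (i : Fin N) :
    (List.ofFn R ++ List.ofFn B).getD i 0 = R i ∧
      (List.ofFn R ++ List.ofFn B).getD (N + i) 0 = B i := by
  constructor
  · rw [List.getD_append _ _ _ _ (by simp), List.getD_eq_getElem _ _ (by simp), List.getElem_ofFn]
  · rw [List.getD_append_right _ _ _ _ (by simp), List.getD_eq_getElem _ _ (by simp),
      List.getElem_ofFn]
    congr
    simp

/-- The instance has as many pairs as there are domination pairs. -/
theorem dominationCount_eq (R B : Fin N → ℝ) : dominationCount R B =
    (matchedInstance N fun i => (List.ofFn R ++ List.ofFn B).getD i 0).total := by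
  classical
  have h1 : dominationPairs R B = ((univ : Finset (Fin N × Fin N)).filter fun p =>
      p.1 < p.2 ∧ B p.2 < R p.1 : Finset (Fin N × Fin N)) := by
    ext p
    simp [dominationPairs]
  rw [dominationCount, h1, Set.ncard_coe_finset, card_filter, matchedInstance_total,
    ← univ_product_univ, sum_product, sum_range]
  refine sum_congr rfl fun i _ => ?_
  rw [dominating, card_filter, sum_range]
  refine sum_congr rfl fun j _ => ?_
  rw [(getD_append_ofFn R B i).1, (getD_append_ofFn R B j).2]
  exact if_congr (and_congr Fin.lt_def Iff.rfl) rfl rfl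

theorem compareInput_eq (R B : Fin N → ℝ) {a b : ℕ} (ha : a < 2 * N) (hb : b < 2 * N) :
    compareInput (List.ofFn R ++ List.ofFn B) a b =
      if (List.ofFn R ++ List.ofFn B).getD a 0 < (List.ofFn R ++ List.ofFn B).getD b 0
      then 1 else 0 := by
  have hlen : (List.ofFn R ++ List.ofFn B).length = 2 * N := by simp [two_mul]
  rw [compareInput, List.getElem?_eq_getElem (hlen ▸ ha), List.getElem?_eq_getElem (hlen ▸ hb),
    List.getD_eq_getElem _ _ (hlen ▸ ha), List.getD_eq_getElem _ _ (hlen ▸ hb)]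
  refine if_congr ?_ rfl rfl
  simp

end

/-! ### Exact and exponential potentials -/

section

/-! ### Potentials -/

/-- With chunks of length one every element is tested, so the counter plus the number of remaining
objects is constant. -/
theorem isPotential_exact (K : ℕ) : IsPotential 1 fun a r => if a + r = K then 0 else 1 := by
  intro d hd a r
  interval_cases d
  · simp
  · simp [add_right_comm, add_assoc]

theorem IsPotential.add {W : ℕ} {p q : ℕ → ℕ → ℝ≥0∞} (hp : IsPotential W p)
    (hq : IsPotential W q) : IsPotential W fun a r => p a r + q a r := by
  intro d hd a r
  have := add_le_add (hp d hd a r) (hq d hd a r)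
  rw [mul_add, mul_add, mul_add]
  refine le_trans (le_of_eq ?_) this
  ring

/-- The exponential potential. -/
theorem isPotential_exp {W : ℕ} (hW : 0 < W) (b θ : ℝ) : IsPotential W fun a r =>
    ENNReal.ofReal (Real.exp (b * (a - θ) + (Real.exp b - 1) / W * r)) := by
  intro d hd a r
  have hW' : (0 : ℝ) < W := by exact_mod_cast hW
  rw [← ENNReal.ofReal_natCast, ← ENNReal.ofReal_natCast, ← ENNReal.ofReal_natCast,
    ← ENNReal.ofReal_mul (by positivity), ← ENNReal.ofReal_mul (by positivity),
    ← ENNReal.ofReal_mul (by positivity), ← ENNReal.ofReal_add (by positivity) (by positivity)]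
  refine ENNReal.ofReal_le_ofReal ?_
  set x := b * (a - θ) + (Real.exp b - 1) / W * r with hx
  have e1 : b * ((a + 1 : ℕ) - θ) + (Real.exp b - 1) / W * r = x + b := by
    rw [hx]
    push_cast
    ring
  have e2 : b * (a - θ) + (Real.exp b - 1) / W * (r + d : ℕ) = x + (Real.exp b - 1) / W * d := by
    rw [hx]
    push_cast
    ring
  clear_value x
  rw [e1, e2, Real.exp_add x b, Real.exp_add x, Nat.cast_sub hd]
  -- A chunk with `d` objects multiplies `exp (b * a)` on average by `1 + (exp b - 1) * d / W`,
  -- which is at most `exp ((exp b - 1) * d / W)`.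
  have h1 := Real.add_one_le_exp ((Real.exp b - 1) / W * d)
  have h2 : (W : ℝ) * ((Real.exp b - 1) / W * d + 1) = (W - d) + d * Real.exp b := by
    field_simp
    ring
  calc (W - d : ℝ) * Real.exp x + d * (Real.exp x * Real.exp b)
      = Real.exp x * ((W : ℝ) * ((Real.exp b - 1) / W * d + 1)) := by rw [h2]; ring
    _ ≤ Real.exp x * ((W : ℝ) * Real.exp ((Real.exp b - 1) / W * d)) := by gcongr
    _ = W * (Real.exp x * Real.exp ((Real.exp b - 1) / W * d)) := by ring

/-- Sampling from chunks of size `W` gives a good approximation of the number of pairs. -/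
theorem exists_isPotential {W : ℕ} (hW : 0 < W) (K : ℕ) {ε : ℝ} (hε : 0 < ε) (hε1 : ε ≤ 1) :
    ∃ p, IsPotential W p ∧
      (∀ a : ℕ, ¬ ((a * W : ℕ) : ℝ) ∈ Set.Icc ((1 - ε) * K) ((1 + ε) * K) → 1 ≤ p a 0) ∧
      p 0 K ≤ ENNReal.ofReal (2 * Real.exp (-(ε ^ 2 / 4 * (K / W)))) := by
  have hW' : (0 : ℝ) < W := by exact_mod_cast hW
  -- The upper and the lower tail, with the near-optimal tilts `± ε / 2`. By `exp b ≤ 1 + b + b ^ 2`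
  -- both initial exponents are at most `-(ε ^ 2 / 4) * (K / W)`.
  refine ⟨_, (isPotential_exp hW (ε / 2) ((1 + ε) * (K / W))).add
    (isPotential_exp hW (-(ε / 2)) ((1 - ε) * (K / W))), fun a ha => ?_, ?_⟩
  · have hone : ∀ x : ℝ, 0 ≤ x → 1 ≤ ENNReal.ofReal (Real.exp x) := fun x hx => by
      rw [← ENNReal.ofReal_one]
      exact ENNReal.ofReal_le_ofReal (Real.one_le_exp hx)
    simp only [Nat.cast_zero, mul_zero, add_zero]
    rw [Set.mem_Icc, not_and_or, not_le, not_le, Nat.cast_mul] at ha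
    rcases ha with ha | ha
    · refine (hone _ ?_).trans (self_le_add_left _ _)
      have : (a : ℝ) ≤ (1 - ε) * (K / W) := by
        rw [← mul_div_assoc, le_div_iff₀ hW']
        exact ha.le
      nlinarith
    · refine (hone _ ?_).trans (self_le_add_right _ _)
      have : (1 + ε) * (K / W) ≤ (a : ℝ) := by
        rw [← mul_div_assoc, div_le_iff₀ hW']
        exact ha.le
      nlinarith
  · have hμ : (0 : ℝ) ≤ K / W := by positivity
    have hexp : ∀ b : ℝ, |b| ≤ 1 → Real.exp b - 1 ≤ b + b ^ 2 := fun b hb => by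
      have := (abs_le.1 (Real.abs_exp_sub_one_sub_id_le hb)).2
      linarith
    rw [← ENNReal.ofReal_add (by positivity) (by positivity)]
    refine ENNReal.ofReal_le_ofReal ?_
    rw [two_mul]
    refine add_le_add (Real.exp_le_exp.2 ?_) (Real.exp_le_exp.2 ?_)
    · have h := hexp (ε / 2) (by rw [abs_of_pos (by linarith)]; linarith)
      have h' := mul_le_mul_of_nonneg_right h hμ
      have e : (Real.exp (ε / 2) - 1) / W * K = (Real.exp (ε / 2) - 1) * (K / W) := by ring
      rw [e]
      push_cast
      nlinarith
    · have h := hexp (-(ε / 2)) (by rw [abs_neg, abs_of_pos (by linarith)]; linarith)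
      have h' := mul_le_mul_of_nonneg_right h hμ
      have e : (Real.exp (-(ε / 2)) - 1) / W * K = (Real.exp (-(ε / 2)) - 1) * (K / W) := by ring
      rw [e]
      push_cast
      nlinarith

end

/-! ### Asymptotics: choosing `E` and `N₀` -/

section

open Filter

/-! ### The parameters -/

theorem four_pow_mul_self (k : ℕ) : 4 ^ k * 4 ^ k = 16 ^ k := by
  rw [← mul_pow]
  norm_num

theorem two_pow_mul_self (k : ℕ) : 2 ^ k * 2 ^ k = 4 ^ k := by
  rw [← mul_pow]
  norm_num

/-- The initial scale is of order `√N * log N`, hence at most `N` when `k` is not tiny: `16 * (k +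
1) ≤ 4 ^ k` for `k ≥ 4`. -/
theorem scale_le {k E N : ℕ} (hk : 4 ≤ k) (hN : 16 ^ k ≤ 16 * N) : (k / E + 1) * 4 ^ k ≤ N := by
  have h1 : 16 * (k + 1) ≤ 4 ^ k := by
    induction k, hk using Nat.le_induction with
    | base => norm_num
    | succ k hk ih =>
      have := ih (by rw [pow_succ] at hN; omega)
      rw [pow_succ]
      omega
  have h2 : k / E + 1 ≤ k + 1 := Nat.succ_le_succ (Nat.div_le_self _ _)
  have h3 : 16 * ((k / E + 1) * 4 ^ k) ≤ 16 ^ k := by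
    rw [← four_pow_mul_self, ← mul_assoc]
    exact Nat.mul_le_mul_right _ ((Nat.mul_le_mul_left 16 h2).trans h1)
  omega

theorem log_sixteen_bounds : 2 ≤ Real.log 16 ∧ Real.log 16 ≤ 3 := by
  have h : Real.log 16 = 4 * Real.log 2 := by
    rw [show (16 : ℝ) = 2 ^ 4 by norm_num, Real.log_pow]
    norm_num
  have h1 := Real.log_two_gt_d9
  have h2 := Real.log_two_lt_d9
  constructor <;> linarith

/-- The exponent `k` is between `log N / 3` and `log N / 2 + 2`. -/
theorem exponent_bounds {k N : ℕ} (hN : 1 ≤ N) (h1 : N < 16 ^ k) (h2 : 16 ^ k ≤ 16 * N) :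
    Real.log N ≤ 3 * k ∧ 2 * (k : ℝ) ≤ Real.log N + 3 := by
  have hN' : (0 : ℝ) < N := by exact_mod_cast hN
  obtain ⟨b1, b2⟩ := log_sixteen_bounds
  have e1 : Real.log N ≤ k * Real.log 16 := by
    rw [← Real.log_pow]
    exact Real.log_le_log hN' (by exact_mod_cast h1.le)
  have e2 : k * Real.log 16 ≤ Real.log 16 + Real.log N := by
    rw [← Real.log_pow, ← Real.log_mul (by norm_num) hN'.ne']
    exact Real.log_le_log (by positivity) (by exact_mod_cast h2)
  have hk : (0 : ℝ) ≤ k := Nat.cast_nonneg k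
  constructor <;> nlinarith

theorem eventually_linear_le_two_pow (A : ℝ) : ∀ᶠ k : ℕ in atTop, A * k ≤ 2 ^ (k - 1) := by
  have h := (tendsto_pow_const_div_const_pow_of_one_lt 1 (one_lt_two : (1 : ℝ) < 2)).eventually
    (gt_mem_nhds (show (0 : ℝ) < 1 / (2 * (|A| + 1)) by positivity))
  filter_upwards [h, eventually_ge_atTop 1] with k hk hk1
  have h2 : (0 : ℝ) < 2 ^ k := by positivity
  have hA : (0 : ℝ) < |A| + 1 := by positivity
  rw [pow_one, div_lt_div_iff₀ h2 (by positivity), one_mul] at hk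
  obtain ⟨j, rfl⟩ := Nat.exists_eq_succ_of_ne_zero (Nat.one_le_iff_ne_zero.1 hk1)
  rw [Nat.succ_sub_one]
  have h3 : (2 : ℝ) ^ (j + 1) = 2 * 2 ^ j := by ring
  rw [h3] at hk
  have h4 : A * ((j + 1 : ℕ) : ℝ) ≤ (|A| + 1) * (j + 1 : ℕ) := by
    have := le_abs_self A
    gcongr
    linarith
  linarith

theorem three_quarters_pow_le {e : ℕ} {x : ℝ} (h : x ≤ e / 4) :
    (3 / 4 : ℝ) ^ e ≤ Real.exp (-x) := by
  have h1 : (3 / 4 : ℝ) ≤ Real.exp (-(1 / 4)) := by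
    have := Real.add_one_le_exp (-(1 / 4) : ℝ)
    linarith
  calc (3 / 4 : ℝ) ^ e ≤ Real.exp (-(1 / 4)) ^ e := by gcongr
    _ = Real.exp (e * (-(1 / 4))) := (Real.exp_nat_mul _ _).symm
    _ ≤ Real.exp (-x) := Real.exp_le_exp.2 (by linarith)

/-- To be read with `L = log N`, `r = N ^ (1 / 4)`, `f = 4 ^ k` and initial scale `q * f`. The
factor `34` bounds the chunk length, `4` comes from `f ≤ 4 * r ^ 2` and another `4` from the
Chernoff exponent; `544` is their product. -/
theorem le_deviation {L r f q E x : ℝ} (hL : 0 < L) (hr : 0 < r) (hf : 0 < f) (hq : 0 < q)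
    (hqE : q * E ≤ L) (hfr : f ≤ 4 * r ^ 2) (hx : r ^ 4 / (34 * (q * f)) ≤ x) :
    E / 544 * L ≤ (L / r) ^ 2 / 4 * x := by
  have h1 : E * (q * f) ≤ L * (4 * r ^ 2) := by
    calc E * (q * f) = (q * E) * f := by ring
      _ ≤ L * f := by gcongr
      _ ≤ L * (4 * r ^ 2) := by gcongr
  have h2 : E * r ^ 2 / (136 * L) ≤ r ^ 4 / (34 * (q * f)) := by
    rw [div_le_div_iff₀ (by positivity) (by positivity)]
    calc E * r ^ 2 * (34 * (q * f)) = 34 * r ^ 2 * (E * (q * f)) := by ring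
      _ ≤ 34 * r ^ 2 * (L * (4 * r ^ 2)) := by gcongr
      _ = r ^ 4 * (136 * L) := by ring
  calc E / 544 * L = (L / r) ^ 2 / 4 * (E * r ^ 2 / (136 * L)) := by
        field_simp
        ring
    _ ≤ (L / r) ^ 2 / 4 * x := mul_le_mul_of_nonneg_left (h2.trans hx) (by positivity)

/-- With a suitable constant `E`, the probability of an error is small for all large `N`. -/
theorem exists_parameters {c : ℝ} (hc : 0 < c) : ∃ E N₀ : ℕ, ∀ N k : ℕ, N₀ ≤ N → N < 16 ^ k →
    16 ^ k ≤ 16 * N → 4 ≤ k ∧ 0 < Real.log N / (N : ℝ) ^ (1 / 4 : ℝ) ∧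
    Real.log N / (N : ℝ) ^ (1 / 4 : ℝ) ≤ 1 ∧
    (∀ x : ℝ, N / (34 * ((k / E + 1) * 4 ^ k : ℕ)) ≤ x →
      ENNReal.ofReal (2 * Real.exp (-((Real.log N / (N : ℝ) ^ (1 / 4 : ℝ)) ^ 2 / 4 * x))) +
        N * attemptError N (2 ^ (k - 1)) ((k / E + 1) * 4 ^ k) ≤
      ENNReal.ofReal (1 / (N : ℝ) ^ c)) := by
  -- Large enough that each tail of the final estimate is below `N ^ (-(c + 2))`.
  obtain ⟨E, hE⟩ := exists_nat_gt (544 * (c + 3))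
  have hE0 : (0 : ℝ) < E := by linarith
  have hlog : Tendsto (fun N : ℕ => Real.log N) atTop atTop :=
    Real.tendsto_log_atTop.comp tendsto_natCast_atTop_atTop
  obtain ⟨k₀, hk₀⟩ := eventually_atTop.1 (eventually_linear_le_two_pow (12 * (c + 3)))
  -- These conditions serve, in this order: to absorb the sum of the errors, to make `k` large for
  -- the pivots, to give `k / E + 1 ≤ L / E`, to make the level test reliable, and to have `ε ≤ 1`.
  have hev : ∀ᶠ N : ℕ in atTop, 5 ≤ N ∧ 3 * (max k₀ 4 : ℕ) ≤ Real.log N ∧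
      2 * E + 3 ≤ Real.log N ∧ 54 * (E : ℝ) ^ 2 * (c + 3) ≤ Real.log N ∧
      Real.log N ≤ (N : ℝ) ^ (1 / 4 : ℝ) := by
    refine (eventually_ge_atTop 5).and ((hlog.eventually_ge_atTop _).and
      ((hlog.eventually_ge_atTop _).and ((hlog.eventually_ge_atTop _).and ?_)))
    have := (isLittleO_log_rpow_atTop (show (0 : ℝ) < 1 / 4 by norm_num)).bound one_pos
    filter_upwards [tendsto_natCast_atTop_atTop.eventually this, eventually_ge_atTop 1] with N h h1
    rw [one_mul, Real.norm_of_nonneg (Real.log_natCast_nonneg N),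
      Real.norm_of_nonneg (by positivity)] at h
    exact h
  obtain ⟨N₀, hN₀⟩ := eventually_atTop.1 hev
  refine ⟨E, N₀, fun N k hN h1 h2 => ?_⟩
  obtain ⟨g1, g2, g3, g4, g5⟩ := hN₀ N hN
  have hNpos : (0 : ℝ) < N := by
    have : 0 < N := by omega
    exact_mod_cast this
  obtain ⟨b1, b2⟩ := exponent_bounds (by omega) h1 h2
  have hk : max k₀ 4 ≤ k := by
    have : 3 * ((max k₀ 4 : ℕ) : ℝ) ≤ 3 * k := g2.trans b1
    have : ((max k₀ 4 : ℕ) : ℝ) ≤ k := by linarith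
    exact_mod_cast this
  set L := Real.log N with hL
  have hLpos : 0 < L := by linarith
  have hroot : (0 : ℝ) < (N : ℝ) ^ (1 / 4 : ℝ) := by positivity
  refine ⟨(le_max_right _ _).trans hk, by positivity, (div_le_one hroot).2 g5, fun x hx => ?_⟩
  have hEpos : 0 < E := by exact_mod_cast hE0
  have hNc : 1 / (N : ℝ) ^ c = Real.exp (-(c * L)) := by
    rw [one_div, ← Real.rpow_neg hNpos.le, Real.rpow_def_of_pos hNpos, mul_comm, neg_mul]
  have hNinv : ∀ y, Real.exp (-((y + 1) * L)) * N = Real.exp (-(y * L)) := fun y => by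
    have : Real.exp (-(y * L)) = Real.exp (-((y + 1) * L) + Real.log N) := by
      congr 1
      ring
    rw [this, Real.exp_add, Real.exp_log hNpos]
  -- The final estimate contributes two units of `N ^ (-(c + 2))`, and after multiplication by `N`
  -- attempts the pivots contribute two and the level tests one.
  have hN5 : 5 * Real.exp (-((c + 2) * L)) ≤ Real.exp (-(c * L)) := by
    have e1 := hNinv (c + 1)
    have e2 := hNinv c
    have hN1 : (5 : ℝ) ≤ N := by exact_mod_cast g1
    have p1 := Real.exp_pos (-((c + 1) * L))
    have p2 := Real.exp_pos (-((c + 1 + 1) * L))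
    rw [show c + 2 = c + 1 + 1 by ring, ← e2, ← e1]
    have h : Real.exp (-((c + 1 + 1) * L)) * N * 5 ≤ Real.exp (-((c + 1 + 1) * L)) * N * N := by
      gcongr
    have h' : Real.exp (-((c + 1 + 1) * L)) ≤ Real.exp (-((c + 1 + 1) * L)) * N :=
      le_mul_of_one_le_right p2.le (by linarith)
    linarith
  set q : ℝ := ((k / E : ℕ) : ℝ) + 1 with hq
  have hq1 : L / (3 * E) ≤ q := by
    have h : k < E * (k / E + 1) := by
      have := Nat.lt_div_mul_add (a := k) hEpos
      rwa [mul_add, mul_one, mul_comm]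
    have h' : (k : ℝ) ≤ E * q := by
      rw [hq]
      exact_mod_cast h.le
    rw [div_le_iff₀ (by positivity)]
    linarith
  have hq2 : q ≤ L / E := by
    have h : ((k / E : ℕ) : ℝ) ≤ k / E := Nat.cast_div_le
    have h' : (k : ℝ) / E + 1 ≤ L / E := by
      rw [div_add_one hE0.ne']
      gcongr
      linarith
    linarith
  have hqpos : 0 < q := by positivity
  have hf1 : (N : ℝ) ≤ 4 ^ k * 4 ^ k := by
    have := four_pow_mul_self k ▸ h1.le
    exact_mod_cast this
  have hf2 : (4 : ℝ) ^ k * 4 ^ k ≤ 16 * N := by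
    have := four_pow_mul_self k ▸ h2
    exact_mod_cast this
  set f : ℝ := (4 : ℝ) ^ k with hf
  have hfpos : 0 < f := by positivity
  have hcast : (((k / E + 1) * 4 ^ k : ℕ) : ℝ) = q * f := by
    rw [hq, hf]
    push_cast
    ring
  have hA1 : (3 / 4 : ℝ) ^ (2 ^ (k - 1)) ≤ Real.exp (-((c + 3) * L)) := by
    refine three_quarters_pow_le ?_
    have := hk₀ k ((le_max_left _ _).trans hk)
    push_cast
    rw [le_div_iff₀ (by norm_num)]
    refine le_trans ?_ this
    calc (c + 3) * L * 4 ≤ (c + 3) * (3 * k) * 4 := by gcongr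
      _ = 12 * (c + 3) * k := by ring
  -- `ℓ₀ ^ 2 ≥ (L / (3 * E)) ^ 2 * N`, so the exponent is at least `L ^ 2 / (54 * E ^ 2)`, quadratic
  -- in `log N`.
  have hA2 : Real.exp (-((q * f * (q * f)) / (6 * N))) ≤ Real.exp (-((c + 3) * L)) := by
    refine Real.exp_le_exp.2 (neg_le_neg ?_)
    rw [le_div_iff₀ (by positivity)]
    have h3 : L / (3 * E) * (L / (3 * E)) ≤ q * q := by gcongr
    have h4 : 6 * ((c + 3) * L) ≤ L / (3 * E) * (L / (3 * E)) := by
      rw [div_mul_div_comm, le_div_iff₀ (by positivity)]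
      calc 6 * ((c + 3) * L) * (3 * E * (3 * E)) = 54 * (E : ℝ) ^ 2 * (c + 3) * L := by ring
        _ ≤ L * L := by gcongr
    calc (c + 3) * L * (6 * N) = 6 * ((c + 3) * L) * N := by ring
      _ ≤ q * q * (f * f) := mul_le_mul (h4.trans h3) hf1 hNpos.le (by positivity)
      _ = q * f * (q * f) := by ring
  have hA3 : Real.exp (-((L / (N : ℝ) ^ (1 / 4 : ℝ)) ^ 2 / 4 * x)) ≤ Real.exp (-((c + 2) * L)) := by
    refine Real.exp_le_exp.2 (neg_le_neg ?_)
    set r := (N : ℝ) ^ (1 / 4 : ℝ) with hr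
    have hr4 : r ^ 4 = N := by
      rw [hr, ← Real.rpow_natCast, ← Real.rpow_mul hNpos.le]
      norm_num
    have hfr : f ≤ 4 * r ^ 2 := by
      refine (abs_le_of_sq_le_sq' ?_ (by positivity)).2
      calc f ^ 2 = f * f := sq f
        _ ≤ 16 * N := hf2
        _ = (4 * r ^ 2) ^ 2 := by rw [← hr4]; ring
    rw [hcast, ← hr4] at hx
    refine le_trans (mul_le_mul_of_nonneg_right (show c + 2 ≤ (E : ℝ) / 544 by linarith) hLpos.le)
      (le_deviation hLpos (show 0 < r from hroot) hfpos hqpos ?_ hfr hx)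
    rwa [← le_div_iff₀ hE0]
  rw [attemptError, ← ENNReal.ofReal_add (by positivity) (by positivity),
    ← ENNReal.ofReal_natCast, ← ENNReal.ofReal_mul hNpos.le,
    ← ENNReal.ofReal_add (by positivity) (by positivity), hNc, hcast]
  refine ENNReal.ofReal_le_ofReal ?_
  have h5 := hNinv (c + 2)
  rw [show c + 2 + 1 = c + 3 by ring] at h5
  have h6 := mul_le_mul_of_nonneg_left hA1 hNpos.le
  have h7 := mul_le_mul_of_nonneg_left hA2 hNpos.le
  linarith

end

/-! ### The whole program -/

section

open Prog Operand

/-- The number of domination pairs is computed approximately. -/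
def approximateCount (N₀ E : ℕ) : Prog :=
  markRed ⨟ listBlue ⨟ setParameters N₀ E ⨟ countPairs N₀

/-- A bound for the words. -/
def wordBound (N₀ E N : ℕ) : ℕ := 64 * (2 * N + 1) * (2 * N + 1) * (2 * N + 1) * 2 ^ (N₀ + E)

theorem wordBound_le {N₀ E N w : ℕ} (hN : 1 ≤ N) (hw : (12 + N₀ + E) * Nat.size N ≤ w) :
    wordBound N₀ E N ≤ 2 ^ w := by
  have hs : 1 ≤ Nat.size N := Nat.size_pos.2 hN
  have h1 : 2 * N + 1 ≤ 2 ^ (2 * Nat.size N) := by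
    have h2 := Nat.lt_size_self N
    have h3 : 2 * N + 1 ≤ 2 ^ (Nat.size N + 1) := by rw [pow_succ]; omega
    exact h3.trans (Nat.pow_le_pow_right two_pos (by omega))
  have h2 : 64 ≤ 2 ^ (6 * Nat.size N) :=
    (show 64 ≤ 2 ^ 6 by norm_num).trans (Nat.pow_le_pow_right two_pos (by omega))
  have h3 : 2 ^ (N₀ + E) ≤ 2 ^ ((N₀ + E) * Nat.size N) :=
    Nat.pow_le_pow_right two_pos (Nat.le_mul_of_pos_right _ hs)
  refine le_trans ?_ (Nat.pow_le_pow_right two_pos hw)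
  calc wordBound N₀ E N ≤ 2 ^ (6 * Nat.size N) * 2 ^ (2 * Nat.size N) * 2 ^ (2 * Nat.size N) *
        2 ^ (2 * Nat.size N) * 2 ^ ((N₀ + E) * Nat.size N) := by
        unfold wordBound
        gcongr
    _ = 2 ^ ((12 + N₀ + E) * Nat.size N) := by
        rw [← pow_add, ← pow_add, ← pow_add, ← pow_add]
        congr 1
        ring

theorem approximateCount_triple {c : ℝ} {N₀ E : ℕ}
    (hpar : ∀ N k : ℕ, N₀ ≤ N → N < 16 ^ k →
    16 ^ k ≤ 16 * N → 4 ≤ k ∧ 0 < Real.log N / (N : ℝ) ^ (1 / 4 : ℝ) ∧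
    Real.log N / (N : ℝ) ^ (1 / 4 : ℝ) ≤ 1 ∧
    (∀ x : ℝ, N / (34 * ((k / E + 1) * 4 ^ k : ℕ)) ≤ x →
      ENNReal.ofReal (2 * Real.exp (-((Real.log N / (N : ℝ) ^ (1 / 4 : ℝ)) ^ 2 / 4 * x))) +
        N * attemptError N (2 ^ (k - 1)) ((k / E + 1) * 4 ^ k) ≤
      ENNReal.ofReal (1 / (N : ℝ) ^ c)))
    {N w : ℕ} (hN : 1 ≤ N) (hw : (12 + N₀ + E) * Nat.size N ≤ w) (R B : Fin N → ℝ) {s : State}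
    (h0 : s.reg 0 = N) {F : State → ℝ≥0∞} (hF1 : ∀ t, F t ≤ 1)
    (hF : ∀ t, (t.reg 0 : ℝ) ∈ Set.Icc
      ((1 - Real.log N / (N : ℝ) ^ (1 / 4 : ℝ)) * dominationCount R B)
      ((1 + Real.log N / (N : ℝ) ^ (1 / 4 : ℝ)) * dominationCount R B) → F t = 0) :
    Triple w (List.ofFn R ++ List.ofFn B) (approximateCount N₀ E) ((200 * N₀ + 3000) * N) s
      (ENNReal.ofReal (1 / (N : ℝ) ^ c)) F := by
  classical
  set M := wordBound N₀ E N with hMdef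
  have hM : M ≤ 2 ^ w := wordBound_le hN hw
  have hNM : 64 * (2 * N + 1) * (2 * N + 1) * (2 * N + 1) ≤ M :=
    Nat.le_mul_of_pos_right _ (by positivity)
  have hNM1 : 64 * N + 64 ≤ M := by
    have h1 : 64 * (2 * N + 1) ≤ M := ((Nat.le_mul_of_pos_right _ (by omega)).trans
      (Nat.le_mul_of_pos_right _ (by omega))).trans hNM
    omega
  have hpow : 2 ^ (N₀ + E) ≤ M := Nat.le_mul_of_pos_left _ (by positivity)
  have hN₀ : N₀ < M :=
    (Nat.lt_two_pow_self.trans_le (Nat.pow_le_pow_right two_pos (Nat.le_add_right _ _))).trans_le hpow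
  have hE : E < M :=
    (Nat.lt_two_pow_self.trans_le (Nat.pow_le_pow_right two_pos (Nat.le_add_left _ _))).trans_le hpow
  set ν : ℕ → ℝ := fun i => (List.ofFn R ++ List.ofFn B).getD i 0 with hν
  have hcmp : ∀ a < 2 * N, ∀ b < 2 * N, compareInput (List.ofFn R ++ List.ofFn B) a b =
      if ν a < ν b then 1 else 0 := fun a ha b hb => compareInput_eq R B ha hb
  have hlin : (200 * N₀ + 3000) * N = (200 * N₀ + 2500) * N + 500 * N := by ring
  set ε := Real.log N / (N : ℝ) ^ (1 / 4 : ℝ) with hε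
  have hε0 : 0 ≤ ε := div_nonneg (Real.log_natCast_nonneg N) (by positivity)
  have hK := dominationCount_eq R B
  rw [hK] at hF
  set I := matchedInstance N ν with hI
  refine .seq (n := 100 * N) (m := 200 * N + (200 * N₀ + 2500) * N + 160)
    (markRed_triple (ν := ν) hM hN hNM1 hcmp h0 fun s1 a0 a1 => Triple.bestBound_le ?_) (by omega)
  refine .seq (n := 100 * N) (m := 100 * N + (200 * N₀ + 2500) * N + 155)
    (listBlue_triple (ν := ν) hM hN hNM1 hcmp a0 a1 fun s2 b0 b1 b2 b3 b4 => Triple.bestBound_le ?_)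
    (by omega)
  refine .seq (n := 100 * N) (m := (200 * N₀ + 2500) * N + 150)
    (setParameters_triple hM hN hNM1 hN₀ hE b0 fun s3 k c0 c1 c2 c3 c4 c5 c6 =>
      Triple.bestBound_le ?_) (by omega)
  have harr : s3.arr = s2.arr := by
    funext a i
    rw [State.arr, State.arr, c2]
  have hstored : I.Stored s3 := by
    refine ⟨c0, c1.trans b1, fun i hi => ?_, fun i hi => ?_, fun b hb => ?_⟩
    · rw [harr, b2 i hi]
      rfl
    · rw [harr, b3 i hi]
      rfl
    · rw [harr, b4 b hb]
      rfl
  have hexact : ∀ (s : State) (cnt : ℕ), s.reg 0 = cnt * 1 →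
      F s ≤ if cnt + 0 = I.total then 0 else 1 := by
    intro s cnt hs
    split_ifs with h
    · refine (hF s ?_).le
      rw [hs, ← h, mul_one, add_zero]
      have : (0 : ℝ) ≤ cnt := Nat.cast_nonneg _
      constructor <;> nlinarith
    · exact hF1 s
  by_cases hlt : N < N₀
  · rw [if_pos hlt] at c6
    -- For small lists the scale is `N`, so the active set never fills up and no attempt is made;
    -- with `W = 1` the count is exact and there is no error at all.
    refine (countPairs_triple (δ := 0) (δ' := 0) hM hstored c6 c5 hN le_rfl
      (Nat.le_mul_of_pos_left _ hN) (fun h => by omega) hNM hN₀ hcmp (matchedInstance_nb_le N ν)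
      (matchedInstance_reds_le N ν) hF1 fun W hW hW1 _ => ?_).mono le_rfl (by simp) fun _ => le_rfl
    rw [hW1 hlt]
    exact ⟨_, isPotential_exact I.total, hexact, by simp⟩
  · rw [if_neg hlt, mul_assoc, two_pow_mul_self] at c6
    obtain ⟨p1, p2, p3, p4⟩ := hpar N k (not_lt.1 hlt) c3 c4
    set ℓ₀ := (k / E + 1) * 4 ^ k with hℓ₀
    have hℓpos : 0 < ℓ₀ := by positivity
    have hfour : 4 ^ k ≤ ℓ₀ := Nat.le_mul_of_pos_left _ (Nat.succ_pos _)
    have hNℓ : N ≤ ℓ₀ * ℓ₀ :=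
      (four_pow_mul_self k ▸ c3.le).trans (Nat.mul_le_mul hfour hfour)
    refine (countPairs_triple (δ := attemptError N (2 ^ (k - 1)) ℓ₀)
      (δ' := ENNReal.ofReal (2 * Real.exp (-(ε ^ 2 / 4 * (N / (34 * ℓ₀ : ℕ)))))) hM hstored c6 c5
      hℓpos (scale_le p1 c4) hNℓ (fun _ => ⟨2 ^ (k - 1), by positivity, ?_, ?_, le_rfl⟩) hNM hN₀
      hcmp (matchedInstance_nb_le N ν) (matchedInstance_reds_le N ν) hF1
      fun W hW _ hWN => ?_).mono le_rfl (p4 _ (by push_cast; rfl)) fun _ => le_rfl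
    · rw [← pow_succ', Nat.sub_add_cancel (by omega)]
    · rw [two_pow_mul_self]
      exact hfour
    -- If `W = 1`, the count is exact even for few pairs, including none, where no deviation bound
    -- would help.
    · rcases (Nat.succ_le_of_lt hW).eq_or_lt with h1 | h1
      · rw [← h1]
        exact ⟨_, isPotential_exact I.total, hexact, by simp⟩
      · obtain ⟨p, hp, hp1, hp2⟩ := exists_isPotential hW I.total p2 p3
        refine ⟨p, hp, fun t cnt ht => ?_, hp2.trans (ENNReal.ofReal_le_ofReal ?_)⟩
        · by_cases h : (t.reg 0 : ℝ) ∈ Set.Icc ((1 - ε) * I.total) ((1 + ε) * I.total)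
          · rw [hF t h]
            exact zero_le
          · rw [ht] at h
            exact (hF1 t).trans (hp1 cnt h)
        · have hW' : (0 : ℝ) < W := by exact_mod_cast hW
          have hℓ' : (0 : ℝ) < (34 * ℓ₀ : ℕ) := by exact_mod_cast (by omega : 0 < 34 * ℓ₀)
          have hle : N * W ≤ I.total * (34 * ℓ₀) := by
            -- For `W ≥ 2` rounding up at most doubles the length, `W ≤ 2 * (W - 1)`; this turns
            -- `17` into `34`.
            have : N * W ≤ 2 * (N * (W - 1)) := by
              rw [mul_left_comm]
              exact Nat.mul_le_mul_left _ (by omega)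
            calc N * W ≤ 2 * (N * (W - 1)) := this
              _ ≤ 2 * (17 * I.total * ℓ₀) := Nat.mul_le_mul_left _ hWN
              _ = I.total * (34 * ℓ₀) := by ring
          have : (N : ℝ) / (34 * ℓ₀ : ℕ) ≤ I.total / W := by
            rw [div_le_div_iff₀ hℓ' hW']
            exact_mod_cast hle
          gcongr

end

end

end RedBlue

/-- For every constant `c > 0` there are a program for the randomized word RAM and constants `a`
and `C` such that, on any two real lists of length `N ≥ 1` and with any word size of at least `a`
times the bit length of `N`, the program always halts within `C * N` steps, and with probability
at least `1 - 1 / N ^ c` its output is within a factor `1 ± log N / N ^ (1 / 4)` of the number of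
domination pairs. -/
theorem theorem2 (c : ℝ) (hc : 0 < c) :
    ∃ (P : RedBlue.Prog) (a C : ℕ), ∀ (N : ℕ), 1 ≤ N → ∀ (w : ℕ), a * Nat.size N ≤ w →
      ∀ R B : Fin N → ℝ,
        (∀ k ∈ (RedBlue.runOn w P R B (C * N)).support, k.Halted) ∧
        ENNReal.ofReal (1 - 1 / (N : ℝ) ^ c) ≤
          (RedBlue.runOn w P R B (C * N)).toOuterMeasure
            {k | (k.output : ℝ) ∈ Set.Icc
              ((1 - Real.log N / (N : ℝ) ^ (1 / 4 : ℝ)) * RedBlue.dominationCount R B)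
              ((1 + Real.log N / (N : ℝ) ^ (1 / 4 : ℝ)) * RedBlue.dominationCount R B)} := by
  classical
  obtain ⟨E, N₀, hpar⟩ := RedBlue.exists_parameters hc
  refine ⟨RedBlue.approximateCount N₀ E, 12 + N₀ + E, 200 * N₀ + 3000, fun N hN w hw R B => ?_⟩
  have hNw : N < 2 ^ w := (Nat.lt_size_self N).trans_le (Nat.pow_le_pow_right two_pos
    ((Nat.le_mul_of_pos_left _ (by omega)).trans hw))
  have h := (RedBlue.approximateCount_triple hpar hN hw R B
    (s := (RedBlue.initial w N (RedBlue.approximateCount N₀ E)).state)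
    -- The indicator of a wrong output, whose expected value is the error probability.
    (F := fun t => if (t.reg 0 : ℝ) ∈ Set.Icc
      ((1 - Real.log N / (N : ℝ) ^ (1 / 4 : ℝ)) * RedBlue.dominationCount R B)
      ((1 + Real.log N / (N : ℝ) ^ (1 / 4 : ℝ)) * RedBlue.dominationCount R B) then 0 else 1)
    (by simp [RedBlue.initial, Nat.mod_eq_of_lt hNw]) (fun t => by split_ifs <;> simp)
    (fun t ht => if_pos ht)).run_spec (Q := fun t => (t.reg 0 : ℝ) ∈ Set.Icc
      ((1 - Real.log N / (N : ℝ) ^ (1 / 4 : ℝ)) * RedBlue.dominationCount R B)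
      ((1 + Real.log N / (N : ℝ) ^ (1 / 4 : ℝ)) * RedBlue.dominationCount R B))
    ENNReal.ofReal_ne_top fun t ht => (if_neg ht).ge
  refine ⟨h.1, le_trans ?_ h.2⟩
  rw [ENNReal.ofReal_sub _ (by positivity), ENNReal.ofReal_one]
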